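/- Let $(M_p)_{p\in\mathbb N}$ be a sequence of positive numbers with $M_0=1$ such that, for some constants $c_0,H\ge 1$, (M.1) $M_p^2\le M_{p-1}M_{p+1}$ for $p\ge 1$; (M.2) $M_p\le c_0H^p\min_{0\le q\le p}M_{p-q}M_q$ for $p\ge 0$; (M.3) $\sum_{p=q+1}^\infty M_{p-1}/M_p\le c_0\,q\,M_q/M_{q+1}$ for $q\ge 1$. Put $M(\rho)=\sup_{p\in\mathbb N}\log_+(\rho^p/M_p)$ for $\rho\ge0$. For multi-indices $\alpha\in\mathbb N^d$ write $M_\alpha=M_{|\alpha|}$, and write $\langle x\rangle=(1+|x|^2)^{1/2}$. For $K\subset\mathbb R^d$ compact and $h>0$ let $\mathcal D_K^{\{M_p\},h}$ be the space of $\varphi\in C^\infty(\mathbb R^d)$ with support in $K$ and $\sup_{\alpha}\sup_{x\in K}|D^\alpha\varphi(x)|/(h^{|\alpha|}M_\alpha)<\infty$, with this norm. For $m>0$ let $\mathcal S_2^{M_p,m}$ be the space of $\varphi\in C^\infty(\mathbb R^d)$ with $$\sigma_{m,2}(\varphi)=\Big(\sum_{\alpha,\beta\in\mathbb N^d}\int_{\mathbb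 R^d}\Big|\frac{m^{|\alpha|+|\beta|}\langle x\rangle^{|\alpha|}D^\beta\varphi(x)}{M_\alpha M_\beta}\Big|^2dx\Big)^{1/2}<\infty,$$ with this norm. In the Beurling case ($*=(M_p)$) put $\mathcal D^*=\varinjlim_K\varprojlim_{h\to0}\mathcal D_K^{\{M_p\},h}$ and $\mathcal S^*=\varprojlim_{m\to\infty}\mathcal S_2^{M_p,m}$; in the Roumieu case ($*=\{M_p\}$) put $\mathcal D^*=\varinjlim_K\varinjlim_{h\to\infty}\mathcal D_K^{\{M_p\},h}$ and $\mathcal S^*=\varinjlim_{m\to0}\mathcal S_2^{M_p,m}$. Let $\mathcal D'^*$ and $\mathcal S'^*$ be the spaces of continuous linear functionals on $\mathcal D^*$ and $\mathcal S^*$. For $T\in\mathcal D'^*$ and $\xi\in\mathbb R^d$ let $e^{-x\xi}T\in\mathcal D'^*$ be given by $\langle e^{-x\xi}T,\varphi\rangle=\langle T,e^{-x\xi}\varphi\rangle$; we write $e^{-x\xi}T\in\mathcal S'^*$ if it is the restriction to $\mathcal D^*$ of an element of $\mathcal S'^*$ (which is then unique and denoted in the same way). The Fourier transform is $(\mathcal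 F\psi)(x)=\int_{\mathbb R^d}e^{-ix\eta}\psi(\eta)\,d\eta$ on $\mathcal S^*$ and $\langle\mathcal FS,\psi\rangle=\langle S,\mathcal F\psi\rangle$ on $\mathcal S'^*$. **Theorem.** Let $B\subseteq\mathbb R^d$ be a connected open set with convex hull $\mathrm{ch}\,B$, let $*$ be $(M_p)$ or $\{M_p\}$, and let $T\in\mathcal D'^*$ be such that $e^{-x\xi}T\in\mathcal S'^*$ for every $\xi\in B$. Then $e^{-x\xi}T\in\mathcal S'^*$ for every $\xi\in\mathrm{ch}\,B$, and there is an analytic function $f$ on the tube $\mathrm{ch}\,B+i\mathbb R^d\subseteq\mathbb C^d$ such that for every $\xi\in\mathrm{ch}\,B$ the Fourier transform $\mathcal F_{x\to\eta}(e^{-x\xi}T)$ is the function $\eta\mapsto f(\xi+i\eta)$, that is, $\eta\mapsto f(\xi+i\eta)\psi(\eta)$ is integrable and $$\langle e^{-x\xi}T,\mathcal F\psi\rangle=\int_{\mathbb R^d}f(\xi+i\eta)\psi(\eta)\,d\eta\qquad\text{for all }\psi\in\mathcal S^*.$$ Moreover, for every compact $K\subset\mathrm{ch}\,B$: in the Beurling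 case there exist $k>0$ and $C>0$, and in the Roumieu case for every $k>0$ there exists $C>0$, such that $$|f(\xi+i\eta)|\le C\,e^{M(k|\eta|)}\qquad\text{for all }\xi\in K,\ \eta\in\mathbb R^d.$$ -/

import Mathlib

open scoped ContDiff ENNReal NNReal

noncomputable section

/-- A weight sequence `(M_p)` with `M_0 = 1` and the conditions (M.1), (M.2), (M.3). -/
structure IsWeightSequence (M : ℕ → ℝ) : Prop where
  pos : ∀ p, 0 < M p
  zero : M 0 = 1
  /-- (M.1): `M_p² ≤ M_{p-1} M_{p+1}` for `p ≥ 1`. -/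
  logConvex : ∀ p, 1 ≤ p → M p ^ 2 ≤ M (p - 1) * M (p + 1)
  /-- (M.2): `M_p ≤ c₀ H^p min_{q ≤ p} M_{p-q} M_q`. -/
  stable : ∃ c₀ H : ℝ, 1 ≤ c₀ ∧ 1 ≤ H ∧
    ∀ p q, q ≤ p → M p ≤ c₀ * H ^ p * (M (p - q) * M q)
  /-- (M.3): `∑_{p ≥ q+1} M_{p-1} / M_p ≤ c₀ q M_q / M_{q+1}` for `q ≥ 1`
  (the summation index is `p = q + 1 + j`). -/
  strong : ∃ c₀ : ℝ, 1 ≤ c₀ ∧ ∀ q, 1 ≤ q →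
    Summable (fun j : ℕ => M (q + j) / M (q + 1 + j)) ∧
    ∑' j : ℕ, M (q + j) / M (q + 1 + j) ≤ c₀ * q * (M q / M (q + 1))

/-- The associated function `M(ρ) = sup_p log₊ (ρ^p / M_p)`. -/
def assocFun (M : ℕ → ℝ) (ρ : ℝ) : ℝ := ⨆ p : ℕ, Real.posLog (ρ ^ p / M p)

/-- The two types of ultradistributions: Beurling `(M_p)` and Roumieu `{M_p}`. -/
inductive UltraType
  | beurling
  | roumieu

/-- `ℝ^d` with the Euclidean norm. -/
abbrev RSp (d : ℕ) := EuclideanSpace ℝ (Fin d)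

/-- `ℂ^d`. -/
abbrev CSp (d : ℕ) := EuclideanSpace ℂ (Fin d)

/-- The length `|α|` of a multi-index. -/
def miLen {d : ℕ} (α : Fin d → ℕ) : ℕ := ∑ i, α i

/-- The partial derivative `∂^α φ (x)` of a smooth function: the derivative of order `|α|`,
evaluated on `α_0` copies of the first basis vector, `α_1` copies of the second one, and so on.
Note `|D^α φ| = |∂^α φ|` for `D_j = i⁻¹ ∂_j`. -/
def partialD {d : ℕ} (α : Fin d → ℕ) (φ : RSp d → ℂ) (x : RSp d) : ℂ :=
  iteratedFDeriv ℝ (∑ i, α i) φ x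
    (fun j => EuclideanSpace.single (finSigmaFinEquiv.symm j).1 (1 : ℝ))

/-! ### Compactly supported test functions and ultradistributions -/

/-- `sup_α sup_{x ∈ K} |D^α φ(x)| / (h^{|α|} M_{|α|})`, possibly infinite. -/
def normD {d : ℕ} (M : ℕ → ℝ) (K : Set (RSp d)) (h : ℝ) (φ : RSp d → ℂ) : ℝ≥0∞ :=
  ⨆ (α : Fin d → ℕ) (x ∈ K),
    ENNReal.ofReal (‖partialD α φ x‖ / (h ^ miLen α * M (miLen α)))

/-- The space `𝒟_K^{{M_p},h}`. -/
def spaceDKh {d : ℕ} (M : ℕ → ℝ) (K : Set (RSp d)) (h : ℝ) : Set (RSp d → ℂ) :=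
  {φ | ContDiff ℝ ∞ φ ∧ tsupport φ ⊆ K ∧ normD M K h φ < ⊤}

/-- The space `𝒟_K^*`: the intersection over all `h > 0` in the Beurling case,
the union over all `h > 0` in the Roumieu case. -/
def spaceDK {d : ℕ} (M : ℕ → ℝ) (K : Set (RSp d)) : UltraType → Set (RSp d → ℂ)
  | .beurling => {φ | ∀ h : ℝ, 0 < h → φ ∈ spaceDKh M K h}
  | .roumieu => {φ | ∃ h : ℝ, 0 < h ∧ φ ∈ spaceDKh M K h}

/-- The test space `𝒟^*(ℝ^d)`, the union of the `𝒟_K^*` over all compact `K`. -/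
def spaceD (d : ℕ) (M : ℕ → ℝ) (t : UltraType) : Set (RSp d → ℂ) :=
  {φ | ∃ K : Set (RSp d), IsCompact K ∧ φ ∈ spaceDK M K t}

/-- Continuity of a linear functional on `𝒟^*(ℝ^d)`. In the Beurling case the space is the
inductive limit over `K` of the projective limits over `h → 0`; in the Roumieu case it is the
inductive limit over `K` and `h → ∞`. A linear functional on a locally convex inductive limit is
continuous iff its restrictions to all steps are, and on a projective limit of a directed
family of norms iff it is bounded by one of them. -/
def ContinuousOnD (d : ℕ) (M : ℕ → ℝ) (T : (RSp d → ℂ) → ℂ) : UltraType → Prop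
  | .beurling => ∀ K : Set (RSp d), IsCompact K → ∃ h : ℝ, 0 < h ∧ ∃ C : ℝ≥0,
      ∀ φ ∈ spaceDK M K .beurling, ‖T φ‖ₑ ≤ C * normD M K h φ
  | .roumieu => ∀ K : Set (RSp d), IsCompact K → ∀ h : ℝ, 0 < h → ∃ C : ℝ≥0,
      ∀ φ ∈ spaceDKh M K h, ‖T φ‖ₑ ≤ C * normD M K h φ

/-- `T ∈ 𝒟'^*(ℝ^d)`: a continuous linear functional on `𝒟^*(ℝ^d)`. Only the values of `T`
on `𝒟^*(ℝ^d)` are meaningful. -/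
structure IsUltradistribution (d : ℕ) (M : ℕ → ℝ) (t : UltraType)
    (T : (RSp d → ℂ) → ℂ) : Prop where
  map_add : ∀ φ ∈ spaceD d M t, ∀ ψ ∈ spaceD d M t, T (φ + ψ) = T φ + T ψ
  map_smul : ∀ (a : ℂ), ∀ φ ∈ spaceD d M t, T (a • φ) = a * T φ
  cont : ContinuousOnD d M T t

/-! ### Rapidly decreasing test functions and tempered ultradistributions -/

/-- The norm `σ_{m,2}`, possibly infinite. -/
def sigmaNorm {d : ℕ} (M : ℕ → ℝ) (m : ℝ) (φ : RSp d → ℂ) : ℝ≥0∞ :=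
  (∑' (α : Fin d → ℕ) (β : Fin d → ℕ), ∫⁻ x : RSp d,
    ENNReal.ofReal (m ^ (miLen α + miLen β) * √(1 + ‖x‖ ^ 2) ^ miLen α * ‖partialD β φ x‖
      / (M (miLen α) * M (miLen β))) ^ 2) ^ (1 / 2 : ℝ)

/-- The space `𝒮_2^{M_p,m}`. -/
def spaceSm (d : ℕ) (M : ℕ → ℝ) (m : ℝ) : Set (RSp d → ℂ) :=
  {φ | ContDiff ℝ ∞ φ ∧ sigmaNorm M m φ < ⊤}

/-- The test space `𝒮^*(ℝ^d)`. -/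
def spaceS (d : ℕ) (M : ℕ → ℝ) : UltraType → Set (RSp d → ℂ)
  | .beurling => {φ | ∀ m : ℝ, 0 < m → φ ∈ spaceSm d M m}
  | .roumieu => {φ | ∃ m : ℝ, 0 < m ∧ φ ∈ spaceSm d M m}

/-- Continuity of a linear functional on `𝒮^*(ℝ^d)`, the projective limit over `m → ∞` in the
Beurling case, the inductive limit over `m → 0` in the Roumieu case. -/
def ContinuousOnS (d : ℕ) (M : ℕ → ℝ) (S : (RSp d → ℂ) → ℂ) : UltraType → Prop
  | .beurling => ∃ m : ℝ, 0 < m ∧ ∃ C : ℝ≥0,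
      ∀ φ ∈ spaceS d M .beurling, ‖S φ‖ₑ ≤ C * sigmaNorm M m φ
  | .roumieu => ∀ m : ℝ, 0 < m → ∃ C : ℝ≥0,
      ∀ φ ∈ spaceSm d M m, ‖S φ‖ₑ ≤ C * sigmaNorm M m φ

/-- `S ∈ 𝒮'^*(ℝ^d)`: a continuous linear functional on `𝒮^*(ℝ^d)`. Only the values of `S`
on `𝒮^*(ℝ^d)` are meaningful. -/
structure IsTemperedUltradistribution (d : ℕ) (M : ℕ → ℝ) (t : UltraType)
    (S : (RSp d → ℂ) → ℂ) : Prop where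
  map_add : ∀ φ ∈ spaceS d M t, ∀ ψ ∈ spaceS d M t, S (φ + ψ) = S φ + S ψ
  map_smul : ∀ (a : ℂ), ∀ φ ∈ spaceS d M t, S (a • φ) = a * S φ
  cont : ContinuousOnS d M S t

/-- The product `e^{-xξ} T`: `⟨e^{-xξ} T, φ⟩ = ⟨T, e^{-xξ} φ⟩`. -/
def expMul {d : ℕ} (ξ : RSp d) (T : (RSp d → ℂ) → ℂ) : (RSp d → ℂ) → ℂ :=
  fun φ => T (fun x => (Real.exp (-inner ℝ x ξ) : ℂ) * φ x)

/-- `S` is an element of `𝒮'^*(ℝ^d)` whose restriction to `𝒟^*(ℝ^d)` is `U`; thus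
`U ∈ 𝒮'^*(ℝ^d)` means that such an `S` exists. -/
def IsTemperedExtension (d : ℕ) (M : ℕ → ℝ) (t : UltraType) (U S : (RSp d → ℂ) → ℂ) : Prop :=
  IsTemperedUltradistribution d M t S ∧ ∀ φ ∈ spaceD d M t, S φ = U φ

/-- The Fourier transform `(ℱψ)(x) = ∫ e^{-ixη} ψ(η) dη`. -/
def fourierT {d : ℕ} (ψ : RSp d → ℂ) (x : RSp d) : ℂ :=
  ∫ η : RSp d, Complex.exp (-(Complex.I * (inner ℝ x η : ℝ))) * ψ η

/-- The Fourier transform of `S ∈ 𝒮'^*`, given by `⟨ℱS, ψ⟩ = ⟨S, ℱψ⟩`, is the function `g`. -/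
def FourierIsFunction (d : ℕ) (M : ℕ → ℝ) (t : UltraType) (S : (RSp d → ℂ) → ℂ)
    (g : RSp d → ℂ) : Prop :=
  ∀ ψ ∈ spaceS d M t, fourierT ψ ∈ spaceS d M t ∧
    MeasureTheory.Integrable (fun η => g η * ψ η) ∧ S (fourierT ψ) = ∫ η, g η * ψ η

/-- The point `ξ + iη` of `ℂ^d`. -/
def tubePoint {d : ℕ} (ξ η : RSp d) : CSp d :=
  WithLp.toLp 2 (fun j => (ξ j : ℂ) + Complex.I * (η j : ℂ))

/-- The tube `A + iℝ^d` over `A ⊆ ℝ^d`. -/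
def tube {d : ℕ} (A : Set (RSp d)) : Set (CSp d) :=
  {ζ | ∃ ξ ∈ A, ∃ η : RSp d, ζ = tubePoint ξ η}

/-- The growth estimate over a set `K` of real parts: for some `k > 0` in the Beurling case,
for every `k > 0` in the Roumieu case, `|f(ξ+iη)| ≤ C e^{M(k|η|)}` for `ξ ∈ K`, `η ∈ ℝ^d`. -/
def GrowthBound {d : ℕ} (M : ℕ → ℝ) (K : Set (RSp d)) (f : CSp d → ℂ) : UltraType → Prop
  | .beurling => ∃ k : ℝ, 0 < k ∧ ∃ C : ℝ, 0 < C ∧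
      ∀ ξ ∈ K, ∀ η : RSp d, ‖f (tubePoint ξ η)‖ ≤ C * Real.exp (assocFun M (k * ‖η‖))
  | .roumieu => ∀ k : ℝ, 0 < k → ∃ C : ℝ, 0 < C ∧
      ∀ ξ ∈ K, ∀ η : RSp d, ‖f (tubePoint ξ η)‖ ≤ C * Real.exp (assocFun M (k * ‖η‖))

end

/-! Near a point ξ₀ of the open set ch B, the exponential e^{-xξ} is smaller by a factor e^{-ε|x|}
than the largest of finitely many e^{-xb}, b ∈ F ⊆ B (`exists_isExpFrame`: separation, and
compactness of the sphere). Hence, for Re ζ near ξ₀, the quotient θ_ζ(z) = e^{-zζ} / ∑_{b∈F} e^{-zb}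
is holomorphic in a strip |Im z| < r and is there O(e^{|Im z||Im ζ|} e^{-ε|Re z|})
(`IsExpFrame.norm_expQuot_le`). Cauchy's estimates, with radii adapted both to the order of the
derivative and to |Im ζ|, place θ_ζ in 𝒮^* with norms O(e^{M(k|Im ζ|)})
(`IsWeightSequence.exists_decayBound_of_strip_exp`).

Let S_b be the tempered extension of e^{-xb}T. The identity e^{-xζ} = ∑_b e^{-xb} θ_ζ(x) shows that
e^{-xξ}T = ∑_b θ_ξ S_b, which is tempered, and leads to f(ζ) = ∑_b S_b(θ_ζ). The growth of f is that
of the norms of θ_ζ. It is analytic because θ_{ζ+w} = θ_ζ e^{-zw}, where half of the decay of θ_ζ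
pays for expanding e^{-zw} in powers of w (`IsExpFrame.analyticAt_apply`). It is the Fourier
transform because θ_{ξ+iη}(x) = θ_ξ(x) e^{-ixη}, so that θ_ξ ℱψ is the integral of ψ(η) θ_{ξ+iη}
over η; S_b passes under this integral after a Hahn–Banach extension to a Banach space of bounded
jets, where the integral is a Bochner integral (`IsTemperedUltradistribution.integral`). Finally f
does not depend on F, since f(ζ) = lim T(e^{-xζ} χ_N) for cut-offs χ_N tending to 1; so the local
formulas agree on overlaps.

The weight sequence enters through three facts. By (M.2) a bounded shift of the index costs only a
geometric factor; with a Sobolev inequality this makes σ_{m,2} equivalent to sup norms up to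
rescaling m, and the quantifiers over m absorb the rescaling. By (M.3), M_n^a dominates L^n n!^{a+1}
for some a and every L; thus the Gevrey function exp(-(1-|x|²)^{-a}) belongs to every class and
yields the cut-offs, and M_n dominates L^n n!, so that exponential decay and holomorphy in a strip
are more than enough for 𝒮^*. By (M.1), M_i M_j ≤ M_{i+j}, which makes Leibniz' rule compatible with
the bounds and, with the other two facts, gives the invariance of 𝒮^* under ℱ. -/

namespace IsWeightSequence

/-! ### Weight sequences and the associated function -/

variable {M : ℕ → ℝ}

lemma ratio_antitone (hM : IsWeightSequence M) : Antitone fun p => M p / M (p + 1) := by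
  refine antitone_nat_of_succ_le fun p => ?_
  rw [div_le_div_iff₀ (hM.pos _) (hM.pos _)]
  simpa [sq] using hM.logConvex (p + 1) (by omega)

/-- Log-convexity with `M 0 = 1`: as the quotients M_p / M_{p+1} decrease, raising j by one
multiplies the right side by at least as much as the left. -/
lemma mul_le (hM : IsWeightSequence M) (i j : ℕ) : M i * M j ≤ M (i + j) := by
  induction j with
  | zero => simp [hM.zero]
  | succ j ih =>
    have h := hM.ratio_antitone (Nat.le_add_left j i)
    simp only at h
    rw [div_le_div_iff₀ (hM.pos _) (hM.pos _)] at h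
    rw [← add_assoc]
    have h1 := hM.pos (i + j)
    refine le_of_mul_le_mul_left (a := M (i + j)) ?_ h1
    have h2 := hM.pos (j + 1)
    have h3 := hM.pos (i + j + 1)
    calc M (i + j) * (M i * M (j + 1)) = M i * (M (i + j) * M (j + 1)) := by ring
      _ ≤ M i * (M j * M (i + j + 1)) := by
        have := (hM.pos i).le
        gcongr
      _ = (M i * M j) * M (i + j + 1) := by ring
      _ ≤ M (i + j) * M (i + j + 1) := by gcongr

/-- (M.2) with one index held fixed. It matters that H does not depend on the shift j. -/
lemma exists_shift (hM : IsWeightSequence M) :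
    ∃ H : ℝ, 1 ≤ H ∧ ∀ j, ∃ C : ℝ, 0 < C ∧ ∀ n, M (n + j) ≤ C * H ^ n * M n := by
  obtain ⟨c, H, hc, hH, h⟩ := hM.stable
  refine ⟨H, hH, fun j => ?_⟩
  have hj := hM.pos j
  refine ⟨c * H ^ j * M j, by positivity, fun n => ?_⟩
  have := h (n + j) j (by omega)
  rw [Nat.add_sub_cancel, pow_add] at this
  linarith

/-- A polynomial lower bound for the quotients `M_{p+1} / M_p` with an exponent exceeding `1`. -/
lemma exists_ratio_bound (hM : IsWeightSequence M) :
    ∃ a : ℕ, Odd a ∧ ∃ D : ℝ, 0 < D ∧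
      ∀ p : ℕ, (M p / M (p + 1)) ^ a * ((p : ℝ) + 1) ^ (a + 2) ≤ D := by
  obtain ⟨c, hc, hs⟩ := hM.strong
  set r : ℕ → ℝ := fun p => M p / M (p + 1) with hr
  have hrpos : ∀ p, 0 < r p := fun p => div_pos (hM.pos _) (hM.pos _)
  have hanti : Antitone r := hM.ratio_antitone
  -- R q is the tail of ∑ r_p from p = q on. (M.3) bounds it by c q r_q = c q (R q - R (q+1)), a
  -- discrete differential inequality that forces polynomial decay of the tails.
  set R : ℕ → ℝ := fun q => ∑' j : ℕ, M (q + j) / M (q + 1 + j) with hR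
  have hterm : ∀ q j, M (q + j) / M (q + 1 + j) = r (q + j) := fun q j => by
    simp only [hr]; congr 2; omega
  have hsum : ∀ q, 1 ≤ q → Summable fun j => r (q + j) := fun q hq => by
    simpa only [hterm] using (hs q hq).1
  have hR' : ∀ q, R q = ∑' j, r (q + j) := fun q => by simp only [hR, hterm]
  have hR0 : ∀ q, 0 ≤ R q := fun q => by
    rw [hR']; exact tsum_nonneg fun j => (hrpos _).le
  have hstep : ∀ q, 1 ≤ q → R q = r q + R (q + 1) := fun q hq => by
    rw [hR', hR', (hsum q hq).tsum_eq_zero_add]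
    simp only [add_zero]
    congr 1
    refine tsum_congr fun j => ?_
    congr 1; omega
  -- The bound 2c ≤ a makes R(q)^a q² decreasing. Oddness serves the bump function, where (1 -
  -- |x|²)^a has to be nonpositive outside the unit ball.
  obtain ⟨a, ha⟩ : ∃ a : ℕ, Odd a ∧ 2 * c ≤ a := by
    obtain ⟨n, hn⟩ := exists_nat_ge c
    exact ⟨2 * n + 1, odd_two_mul_add_one n, by push_cast; linarith⟩
  have hdec : ∀ q, 1 ≤ q →
      R (q + 1) ^ a * ((q + 1 : ℕ) : ℝ) ^ 2 ≤ R q ^ a * (q : ℝ) ^ 2 := fun q hq => by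
    have hq' : (0 : ℝ) < q := by exact_mod_cast hq
    have h1 : R q ≤ c * q * (R q - R (q + 1)) := by
      have := (hs q hq).2
      rw [hstep q hq, add_sub_cancel_right, ← hstep q hq]
      exact this
    have h2 : R (q + 1) ≤ R q * Real.exp (-(1 / (c * q))) := by
      have h3 : R (q + 1) ≤ R q * (1 - 1 / (c * q)) := by
        have : R q / (c * q) ≤ R q - R (q + 1) := by
          rw [div_le_iff₀ (by positivity)]; linarith
        have e : R q * (1 - 1 / (c * q)) = R q - R q / (c * q) := by ring
        linarith
      refine h3.trans (mul_le_mul_of_nonneg_left ?_ (hR0 q))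
      have := Real.add_one_le_exp (-(1 / (c * q)))
      linarith
    have h4 : ((q + 1 : ℕ) : ℝ) ≤ q * Real.exp (1 / q) := by
      have := Real.add_one_le_exp (1 / (q : ℝ))
      calc ((q + 1 : ℕ) : ℝ) = q * (1 / q + 1) := by push_cast; field_simp; ring
        _ ≤ _ := by gcongr
    calc R (q + 1) ^ a * ((q + 1 : ℕ) : ℝ) ^ 2
        ≤ (R q * Real.exp (-(1 / (c * q)))) ^ a * (q * Real.exp (1 / q)) ^ 2 := by
          have := hR0 q; have := hR0 (q + 1)
          gcongr
      _ = R q ^ a * (q : ℝ) ^ 2 * Real.exp (a * (-(1 / (c * q))) + 2 * (1 / q)) := by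
          rw [mul_pow, mul_pow, ← Real.exp_nat_mul, ← Real.exp_nat_mul, Real.exp_add]
          push_cast; ring
      _ ≤ R q ^ a * (q : ℝ) ^ 2 * 1 := by
          have := hR0 q
          gcongr
          rw [Real.exp_le_one_iff]
          have e : (a : ℝ) * (-(1 / (c * q))) + 2 * (1 / q) = (2 * c - a) / (c * q) := by
            field_simp; ring
          rw [e]
          exact div_nonpos_of_nonpos_of_nonneg (by linarith [ha.2]) (by positivity)
      _ = _ := mul_one _
  have hall : ∀ q, 1 ≤ q → R q ^ a * (q : ℝ) ^ 2 ≤ R 1 ^ a := fun q hq => by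
    induction q, hq using Nat.le_induction with
    | base => simp
    | succ q hq ih => exact (hdec q hq).trans ih
  -- The tail contains the q terms with indices from q to 2q - 1, each at least r (2q); this turns
  -- decay of the tail into decay of r with one more power of q.
  have hlow : ∀ q, 1 ≤ q → q * r (2 * q) ≤ R q := fun q hq => by
    rw [hR']
    calc (q : ℝ) * r (2 * q) = ∑ j ∈ Finset.range q, r (2 * q) := by simp
      _ ≤ ∑ j ∈ Finset.range q, r (q + j) := by
        refine Finset.sum_le_sum fun j hj => hanti ?_
        have := Finset.mem_range.1 hj; omega
      _ ≤ _ := (hsum q hq).sum_le_tsum _ fun j _ => (hrpos _).le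
  refine ⟨a, ha.1, R 1 ^ a * 4 ^ (a + 2) + r 0 ^ a * 2 ^ (a + 2), ?_, fun p => ?_⟩
  · have := hrpos 0; have := hR0 1; positivity
  have hr0 := hrpos 0
  have hR1 := hR0 1
  rcases lt_or_ge p 2 with hp | hp
  · have h1 : r p ≤ r 0 := hanti (Nat.zero_le p)
    have h2 : (p : ℝ) + 1 ≤ 2 := by
      have : (p : ℝ) ≤ 1 := by exact_mod_cast (by omega : p ≤ 1)
      linarith
    calc r p ^ a * ((p : ℝ) + 1) ^ (a + 2) ≤ r 0 ^ a * 2 ^ (a + 2) := by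
          have := hrpos p; gcongr
      _ ≤ _ := le_add_of_nonneg_left (by positivity)
  · have hq : 1 ≤ p / 2 := by omega
    have h1 : r p ≤ r (2 * (p / 2)) := hanti (by omega)
    have h2 : (p : ℝ) + 1 ≤ 4 * (p / 2 : ℕ) := by exact_mod_cast (by omega : p + 1 ≤ 4 * (p / 2))
    have h3 := hlow _ hq
    have h4 := hall _ hq
    set q := p / 2
    calc r p ^ a * ((p : ℝ) + 1) ^ (a + 2) ≤ r (2 * q) ^ a * (4 * q) ^ (a + 2) := by
          have := hrpos p; have := hrpos (2 * q)
          gcongr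
      _ = (q * r (2 * q)) ^ a * (q : ℝ) ^ 2 * 4 ^ (a + 2) := by ring
      _ ≤ R q ^ a * (q : ℝ) ^ 2 * 4 ^ (a + 2) := by
          have := hrpos (2 * q); gcongr
      _ ≤ R 1 ^ a * 4 ^ (a + 2) := by gcongr
      _ ≤ _ := le_add_of_nonneg_right (by positivity)

/-- Multiplying the quotient bounds gives n!^{a+2} ≤ D^n M_n^a. One of the factorials is sacrificed
to absorb (L D)^n for arbitrary L. -/
lemma exists_factorial_pow_le (hM : IsWeightSequence M) :
    ∃ a : ℕ, Odd a ∧ ∀ L : ℝ, 0 < L → ∃ C : ℝ, 1 ≤ C ∧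
      ∀ n : ℕ, L ^ n * (n.factorial : ℝ) ^ (a + 1) ≤ C * M n ^ a := by
  obtain ⟨a, ha, D, hD, h⟩ := hM.exists_ratio_bound
  have key : ∀ n : ℕ, (n.factorial : ℝ) ^ (a + 2) ≤ D ^ n * M n ^ a := fun n => by
    induction n with
    | zero => simp [hM.zero]
    | succ n ih =>
      have h1 := h n
      have hn := hM.pos n
      have hn1 := hM.pos (n + 1)
      rw [div_pow, div_mul_eq_mul_div, div_le_iff₀ (by positivity)] at h1
      refine le_of_mul_le_mul_left (a := M n ^ a) ?_ (by positivity)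
      calc M n ^ a * ((n + 1).factorial : ℝ) ^ (a + 2)
          = (M n ^ a * ((n : ℝ) + 1) ^ (a + 2)) * (n.factorial : ℝ) ^ (a + 2) := by
            rw [Nat.factorial_succ]; push_cast; rw [mul_pow]; ring
        _ ≤ (D * M (n + 1) ^ a) * (D ^ n * M n ^ a) := by gcongr
        _ = _ := by ring
  refine ⟨a, ha, fun L hL => ⟨Real.exp (L * D), Real.one_le_exp (by positivity), fun n => ?_⟩⟩
  have hf : (0 : ℝ) < n.factorial := by exact_mod_cast n.factorial_pos
  have hn := hM.pos n
  have h1 : (L * D) ^ n ≤ Real.exp (L * D) * n.factorial := by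
    have := Real.pow_div_factorial_le_exp (L * D) (by positivity) n
    rwa [div_le_iff₀ hf] at this
  refine le_of_mul_le_mul_right (a := (n.factorial : ℝ)) ?_ hf
  calc L ^ n * (n.factorial : ℝ) ^ (a + 1) * n.factorial
      = L ^ n * (n.factorial : ℝ) ^ (a + 2) := by ring
    _ ≤ L ^ n * (D ^ n * M n ^ a) := by gcongr; exact key n
    _ = (L * D) ^ n * M n ^ a := by ring
    _ ≤ Real.exp (L * D) * n.factorial * M n ^ a := by gcongr
    _ = _ := by ring

lemma exists_factorial_le (hM : IsWeightSequence M) (L : ℝ) (hL : 0 < L) :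
    ∃ C : ℝ, 1 ≤ C ∧ ∀ n : ℕ, L ^ n * (n.factorial : ℝ) ≤ C * M n := by
  obtain ⟨a, ha, h⟩ := hM.exists_factorial_pow_le
  obtain ⟨C, hC, h⟩ := h (L ^ a) (by positivity)
  have ha0 : a ≠ 0 := by rintro rfl; simp at ha
  refine ⟨C, hC, fun n => ?_⟩
  have hn := hM.pos n
  have hf : (1 : ℝ) ≤ n.factorial := by exact_mod_cast n.factorial_pos
  refine (pow_le_pow_iff_left₀ (by positivity) (by positivity) ha0).1 ?_
  calc (L ^ n * (n.factorial : ℝ)) ^ a = (L ^ a) ^ n * (n.factorial : ℝ) ^ a := by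
        rw [mul_pow, ← pow_mul, ← pow_mul, mul_comm n a]
    _ ≤ (L ^ a) ^ n * (n.factorial : ℝ) ^ (a + 1) := by gcongr; simp
    _ ≤ C * M n ^ a := h n
    _ ≤ C ^ a * M n ^ a := by gcongr; exact le_self_pow₀ hC ha0
    _ = _ := by rw [mul_pow]

lemma exists_pow_le (hM : IsWeightSequence M) (L : ℝ) (hL : 0 < L) :
    ∃ C : ℝ, 1 ≤ C ∧ ∀ n : ℕ, L ^ n ≤ C * M n := by
  obtain ⟨C, hC, h⟩ := hM.exists_factorial_le L hL
  refine ⟨C, hC, fun n => le_trans ?_ (h n)⟩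
  exact le_mul_of_one_le_right (by positivity) (by exact_mod_cast n.factorial_pos)

/-- The form of the factorial bound that meets Cauchy's estimates, where a radius r is split into n
+ 1 equal steps. -/
lemma exists_self_pow_le (hM : IsWeightSequence M) (L : ℝ) (hL : 0 < L) :
    ∃ C : ℝ, 1 ≤ C ∧ ∀ n : ℕ, (L * (n + 1)) ^ n ≤ C * M n := by
  obtain ⟨C, hC, h⟩ := hM.exists_factorial_le (L * Real.exp 1) (by positivity)
  refine ⟨Real.exp 1 * C, by nlinarith [Real.add_one_le_exp 1], fun n => ?_⟩
  have h1 : ((n : ℝ) + 1) ^ n ≤ Real.exp (n + 1) * n.factorial := by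
    have := Real.pow_div_factorial_le_exp ((n : ℝ) + 1) (by positivity) n
    rwa [div_le_iff₀ (by positivity)] at this
  calc (L * (n + 1)) ^ n = L ^ n * ((n : ℝ) + 1) ^ n := mul_pow _ _ _
    _ ≤ L ^ n * (Real.exp (n + 1) * n.factorial) := by gcongr
    _ = Real.exp 1 * ((L * Real.exp 1) ^ n * n.factorial) := by
      rw [Real.exp_add, mul_pow, ← Real.exp_nat_mul]; simp; ring
    _ ≤ Real.exp 1 * (C * M n) := mul_le_mul_of_nonneg_left (h n) (by positivity)
    _ = _ := by ring

lemma one_le_const_mul (hM : IsWeightSequence M) : ∃ C : ℝ, 1 ≤ C ∧ ∀ n, 1 ≤ C * M n := by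
  simpa using hM.exists_pow_le 1 one_pos

lemma bddAbove_assocFun (hM : IsWeightSequence M) {ρ : ℝ} (hρ : 0 ≤ ρ) :
    BddAbove (Set.range fun p : ℕ => Real.posLog (ρ ^ p / M p)) := by
  obtain ⟨C, hC, h⟩ := hM.exists_pow_le (ρ + 1) (by positivity)
  refine ⟨Real.posLog C, ?_⟩
  rintro _ ⟨p, rfl⟩
  have hp := hM.pos p
  refine Real.posLog_le_posLog (by positivity) ?_
  rw [div_le_iff₀ hp]
  exact le_trans (by gcongr; linarith) (h p)

lemma pow_div_le_exp_assocFun (hM : IsWeightSequence M) {ρ : ℝ} (hρ : 0 ≤ ρ) (p : ℕ) :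
    ρ ^ p / M p ≤ Real.exp (assocFun M ρ) := by
  have hp := hM.pos p
  rcases hρ.eq_or_lt with h0 | h0
  · rcases Nat.eq_zero_or_pos p with rfl | hp'
    · simp only [pow_zero, hM.zero, div_one]
      refine Real.one_le_exp (Real.iSup_nonneg fun _ => Real.posLog_nonneg)
    · rw [← h0, zero_pow hp'.ne', zero_div]; positivity
  · have h1 : Real.log (ρ ^ p / M p) ≤ assocFun M ρ :=
      (le_max_right _ _).trans (le_ciSup (hM.bddAbove_assocFun hρ) p)
    rwa [Real.log_le_iff_le_exp (by positivity)] at h1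

lemma one_le_exp_assocFun (ρ : ℝ) : 1 ≤ Real.exp (assocFun M ρ) :=
  Real.one_le_exp (Real.iSup_nonneg fun _ => Real.posLog_nonneg)

lemma exp_assocFun_le (hM : IsWeightSequence M) {ρ Y : ℝ} (hρ : 0 ≤ ρ) (hY : 1 ≤ Y)
    (h : ∀ p, ρ ^ p / M p ≤ Y) : Real.exp (assocFun M ρ) ≤ Y := by
  rw [← Real.le_log_iff_exp_le (by linarith)]
  refine ciSup_le fun p => ?_
  rw [← Real.posLog_eq_log (by rwa [abs_of_nonneg (by linarith)])]
  have := hM.pos p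
  exact Real.posLog_le_posLog (by positivity) (h p)

lemma assocFun_mono (hM : IsWeightSequence M) {ρ ρ' : ℝ} (hρ : 0 ≤ ρ) (h : ρ ≤ ρ') :
    assocFun M ρ ≤ assocFun M ρ' := by
  rw [← Real.exp_le_exp]
  refine hM.exp_assocFun_le hρ (one_le_exp_assocFun _) fun p => ?_
  have := hM.pos p
  exact le_trans (by gcongr) (hM.pow_div_le_exp_assocFun (hρ.trans h) p)

end IsWeightSequence

/-! ### Cauchy's estimates for Fréchet derivatives -/

section Cauchy

variable {E : Type} [NormedAddCommGroup E] [NormedSpace ℂ E]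

/-- The one-variable Cauchy estimate on each complex line t ↦ z + t v, over the disc of radius s /
‖v‖. -/
lemma norm_fderiv_le_of_closedBall {F : Type} [NormedAddCommGroup F] [NormedSpace ℂ F]
    {G : E → F} {z : E} {s A : ℝ} (hs : 0 < s)
    (hG : AnalyticOnNhd ℂ G (Metric.closedBall z s))
    (hA : ∀ w ∈ Metric.closedBall z s, ‖G w‖ ≤ A) : ‖fderiv ℂ G z‖ ≤ A / s := by
  have hz : z ∈ Metric.closedBall z s := Metric.mem_closedBall_self hs.le
  have hA0 : 0 ≤ A := (norm_nonneg _).trans (hA z hz)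
  refine ContinuousLinearMap.opNorm_le_bound _ (by positivity) fun v => ?_
  rcases eq_or_ne v 0 with rfl | hv
  · simp
  have hv' : 0 < ‖v‖ := norm_pos_iff.2 hv
  have hmem : ∀ t ∈ Metric.closedBall (0 : ℂ) (s / ‖v‖), z + t • v ∈ Metric.closedBall z s := by
    intro t ht
    rw [mem_closedBall_zero_iff, le_div_iff₀ hv'] at ht
    simpa [norm_smul] using ht
  have hd : ∀ t ∈ Metric.closedBall (0 : ℂ) (s / ‖v‖),
      DifferentiableAt ℂ (fun t : ℂ => G (z + t • v)) t := fun t ht =>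
    (hG _ (hmem t ht)).differentiableAt.comp t (by fun_prop)
  have h1 : deriv (fun t : ℂ => G (z + t • v)) 0 = fderiv ℂ G z v := by
    have hg : HasFDerivAt G (fderiv ℂ G z) (z + (0 : ℂ) • v) := by
      simpa using (hG z hz).differentiableAt.hasFDerivAt
    have hl : HasDerivAt (fun t : ℂ => z + t • v) v 0 := by
      simpa using ((hasDerivAt_id (0 : ℂ)).smul_const v).const_add z
    exact (hg.comp_hasDerivAt (0 : ℂ) hl).deriv
  rw [← h1]
  have h2 := Complex.norm_deriv_le_of_forall_mem_sphere_norm_le (c := 0) (R := s / ‖v‖) (C := A)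
    (f := fun t : ℂ => G (z + t • v)) (by positivity)
    (DifferentiableOn.diffContOnCl_ball (U := Metric.closedBall (0 : ℂ) (s / ‖v‖))
      (fun t ht => (hd t ht).differentiableWithinAt) subset_rfl)
    (fun t ht => hA _ (hmem t (Metric.sphere_subset_closedBall ht)))
  refine h2.trans (le_of_eq ?_)
  field_simp

/-- Each derivative consumes a shell of width s and costs a factor 1 / s. The target space varies in
the induction because the argument is applied to the derivative of G; the real derivatives are
restrictions of complex ones. -/
lemma norm_iteratedFDeriv_le_of_closedBall (n : ℕ) :
    ∀ {F : Type} [NormedAddCommGroup F] [NormedSpace ℂ F] [CompleteSpace F] {G : E → F} {z : E} {s A : ℝ},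
      0 < s → AnalyticOnNhd ℂ G (Metric.closedBall z (n * s)) →
      (∀ w ∈ Metric.closedBall z (n * s), ‖G w‖ ≤ A) →
      ‖iteratedFDeriv ℝ n G z‖ ≤ A / s ^ n := by
  induction n with
  | zero =>
    intro F _ _ _ G z s A hs _ hA
    simpa using hA z (by simp)
  | succ n ih =>
    intro F _ _ _ G z s A hs hG hA
    have hsub : ∀ w ∈ Metric.closedBall z (n * s),
        Metric.closedBall w s ⊆ Metric.closedBall z ((n + 1 : ℕ) * s) := fun w hw =>
      Metric.closedBall_subset_closedBall' (by
        rw [Metric.mem_closedBall] at hw; push_cast; linarith)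
    have hsub' : Metric.closedBall z (n * s) ⊆ Metric.closedBall z ((n + 1 : ℕ) * s) :=
      Metric.closedBall_subset_closedBall (by push_cast; linarith)
    have heq : ∀ w ∈ Metric.closedBall z (n * s),
        fderiv ℝ G =ᶠ[nhds w]
          fun y => ContinuousLinearMap.restrictScalarsL ℂ E F ℝ ℂ (fderiv ℂ G y) := by
      intro w hw
      filter_upwards [(hG w (hsub' hw)).eventually_analyticAt] with y hy
      exact hy.differentiableAt.hasFDerivAt.restrictScalars ℝ |>.fderiv
    rw [← norm_iteratedFDeriv_fderiv, pow_succ', ← div_div]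
    refine ih hs ?_ ?_
    · intro w hw
      refine AnalyticAt.congr ?_ (heq w hw).symm
      exact (ContinuousLinearMap.analyticAt _ _).comp (hG w (hsub' hw)).fderiv
    · intro w hw
      rw [(heq w hw).eq_of_nhds]
      change ‖(fderiv ℂ G w).restrictScalars ℝ‖ ≤ _
      rw [ContinuousLinearMap.norm_restrictScalars]
      exact norm_fderiv_le_of_closedBall hs (fun y hy => hG y (hsub w hw hy))
        fun y hy => hA y (hsub w hw hy)

end Cauchy

/-! ### Real points, real and imaginary parts in `ℂ^d` -/

section

variable {d : ℕ}

/-- The inclusion `ℝ^d → ℂ^d`. -/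
noncomputable def ofRealE (d : ℕ) : RSp d →ₗᵢ[ℝ] CSp d where
  toFun x := WithLp.toLp 2 fun j => (x j : ℂ)
  map_add' x y := by ext j; simp
  map_smul' a x := by ext j; simp
  norm_map' x := by simp [EuclideanSpace.norm_eq]

@[simp] lemma ofRealE_apply (x : RSp d) (j : Fin d) : ofRealE d x j = (x j : ℂ) := rfl

/-- The real part `ℂ^d → ℝ^d`. -/
def reE (z : CSp d) : RSp d := WithLp.toLp 2 fun j => (z j).re

/-- The imaginary part `ℂ^d → ℝ^d`. -/
def imE (z : CSp d) : RSp d := WithLp.toLp 2 fun j => (z j).im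

@[simp] lemma reE_apply (z : CSp d) (j : Fin d) : reE z j = (z j).re := rfl
@[simp] lemma imE_apply (z : CSp d) (j : Fin d) : imE z j = (z j).im := rfl

lemma norm_reE_le (z : CSp d) : ‖reE z‖ ≤ ‖z‖ := by
  simp only [EuclideanSpace.norm_eq]
  gcongr with j
  exact Complex.abs_re_le_norm _

lemma norm_imE_le (z : CSp d) : ‖imE z‖ ≤ ‖z‖ := by
  simp only [EuclideanSpace.norm_eq]
  gcongr with j
  exact Complex.abs_im_le_norm _

lemma reE_sub (z w : CSp d) : reE (z - w) = reE z - reE w := by ext j; simp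
lemma imE_sub (z w : CSp d) : imE (z - w) = imE z - imE w := by ext j; simp
@[simp] lemma reE_ofRealE (x : RSp d) : reE (ofRealE d x) = x := by ext j; simp
@[simp] lemma imE_ofRealE (x : RSp d) : imE (ofRealE d x) = 0 := by ext j; simp
@[simp] lemma reE_tubePoint (ξ η : RSp d) : reE (tubePoint ξ η) = ξ := by ext j; simp [tubePoint]
@[simp] lemma imE_tubePoint (ξ η : RSp d) : imE (tubePoint ξ η) = η := by ext j; simp [tubePoint]

lemma tubePoint_reE_imE (z : CSp d) : tubePoint (reE z) (imE z) = z := by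
  ext j
  simp only [tubePoint, reE_apply, imE_apply]
  rw [mul_comm]; exact Complex.re_add_im _

lemma tubePoint_eq (ξ η : RSp d) :
    tubePoint ξ η = ofRealE d ξ + Complex.I • ofRealE d η := by
  ext j; simp [tubePoint]

lemma norm_le_reE_add_imE (z : CSp d) : ‖z‖ ≤ ‖reE z‖ + ‖imE z‖ := by
  conv_lhs => rw [← tubePoint_reE_imE z, tubePoint_eq]
  refine (norm_add_le _ _).trans ?_
  simp [norm_smul]

lemma mem_tube {A : Set (RSp d)} {z : CSp d} : z ∈ tube A ↔ reE z ∈ A := by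
  constructor
  · rintro ⟨ξ, hξ, η, rfl⟩; simpa using hξ
  · intro h; exact ⟨_, h, imE z, (tubePoint_reE_imE z).symm⟩

lemma norm_reE_sub_le {x : RSp d} {z : CSp d} {s : ℝ}
    (hz : z ∈ Metric.closedBall (ofRealE d x) s) : ‖reE z - x‖ ≤ s := by
  have := norm_reE_le (z - ofRealE d x)
  rw [reE_sub, reE_ofRealE] at this
  exact this.trans (mem_closedBall_iff_norm.1 hz)

lemma norm_imE_le_of_mem {x : RSp d} {z : CSp d} {s : ℝ}
    (hz : z ∈ Metric.closedBall (ofRealE d x) s) : ‖imE z‖ ≤ s := by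
  have := norm_imE_le (z - ofRealE d x)
  rw [imE_sub, imE_ofRealE, sub_zero] at this
  exact this.trans (mem_closedBall_iff_norm.1 hz)

lemma continuous_reE : Continuous (reE : CSp d → RSp d) := by
  unfold reE; fun_prop

lemma continuous_imE : Continuous (imE : CSp d → RSp d) := by
  unfold imE; fun_prop

/-- The strip `{z : ‖Im z‖ < r}`. -/
def strip (d : ℕ) (r : ℝ) : Set (CSp d) := {z | ‖imE z‖ < r}

lemma isOpen_strip (r : ℝ) : IsOpen (strip d r) :=
  isOpen_lt continuous_imE.norm continuous_const

lemma closedBall_subset_strip (x : RSp d) {s r : ℝ} (h : s < r) :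
    Metric.closedBall (ofRealE d x) s ⊆ strip d r := fun _ hz =>
  (norm_imE_le_of_mem hz).trans_lt h

lemma ofRealE_mem_strip (x : RSp d) {r : ℝ} (h : 0 < r) : ofRealE d x ∈ strip d r := by
  simpa [strip] using h

lemma contDiffAt_comp_ofRealE {G : CSp d → ℂ} {x : RSp d} (hG : AnalyticAt ℂ G (ofRealE d x)) :
    ContDiffAt ℝ ∞ (fun x => G (ofRealE d x)) x := by
  have h1 : ContDiffAt ℝ ∞ G (ofRealE d x) :=
    (hG.contDiffAt (n := ∞)).restrict_scalars ℝ
  exact h1.comp x (ofRealE d).contDiff.contDiffAt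

lemma contDiff_comp_ofRealE {G : CSp d → ℂ} {r : ℝ} (hr : 0 < r)
    (hG : AnalyticOnNhd ℂ G (strip d r)) : ContDiff ℝ ∞ fun x => G (ofRealE d x) :=
  contDiff_iff_contDiffAt.2 fun x => contDiffAt_comp_ofRealE (hG _ (ofRealE_mem_strip x hr))

/-- Cauchy's estimates on `ℝ^d`, for functions with a holomorphic extension. -/
lemma norm_iteratedFDeriv_comp_ofRealE_le {G : CSp d → ℂ} {U : Set (CSp d)} (hU : IsOpen U)
    (hG : AnalyticOnNhd ℂ G U) {x : RSp d} {n : ℕ} {s A : ℝ} (hs : 0 < s)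
    (hsub : Metric.closedBall (ofRealE d x) (n * s) ⊆ U)
    (hA : ∀ w ∈ Metric.closedBall (ofRealE d x) (n * s), ‖G w‖ ≤ A) :
    ‖iteratedFDeriv ℝ n (fun x => G (ofRealE d x)) x‖ ≤ A / s ^ n := by
  set ι : RSp d →L[ℝ] CSp d := (ofRealE d).toContinuousLinearMap
  have hx : ι x ∈ U := hsub (Metric.mem_closedBall_self (by positivity))
  have hU' : IsOpen (ι ⁻¹' U) := hU.preimage ι.continuous
  have hcd : ContDiffOn ℝ ∞ G U := fun z hz =>
    ((hG z hz).contDiffAt (n := ∞)).restrict_scalars ℝ |>.contDiffWithinAt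
  have h := ι.iteratedFDerivWithin_comp_right hcd hU.uniqueDiffOn hU'.uniqueDiffOn hx
    (i := n) (by exact_mod_cast le_top)
  rw [iteratedFDerivWithin_of_isOpen n hU' hx, iteratedFDerivWithin_of_isOpen n hU hx] at h
  have h2 := norm_iteratedFDeriv_le_of_closedBall n hs (fun w hw => hG w (hsub hw)) hA
  change ‖iteratedFDeriv ℝ n (G ∘ ι) x‖ ≤ _
  rw [h]
  refine (ContinuousMultilinearMap.norm_compContinuousLinearMap_le _ _).trans ?_
  have h3 : ‖ι‖ ≤ 1 := (ofRealE d).norm_toContinuousLinearMap_le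
  calc _ ≤ ‖iteratedFDeriv ℝ n G (ι x)‖ * ∏ _i : Fin n, (1 : ℝ) := by gcongr
    _ ≤ _ := by rw [Finset.prod_const_one, mul_one]; exact h2

/-! ### Sup-norm decay conditions -/

/-- The Japanese bracket `⟨x⟩`. -/
noncomputable def jb (x : RSp d) : ℝ := √(1 + ‖x‖ ^ 2)

lemma one_le_jb (x : RSp d) : 1 ≤ jb x := Real.one_le_sqrt.2 (by nlinarith [norm_nonneg x])

lemma jb_pos (x : RSp d) : 0 < jb x := one_pos.trans_le (one_le_jb x)

lemma norm_le_jb (x : RSp d) : ‖x‖ ≤ jb x := Real.le_sqrt_of_sq_le (by linarith)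

lemma jb_le (x : RSp d) : jb x ≤ 1 + ‖x‖ :=
  Real.sqrt_le_iff.2 ⟨by positivity, by nlinarith [norm_nonneg x]⟩

lemma continuous_jb : Continuous (jb : RSp d → ℝ) := by unfold jb; fun_prop

/-- `φ` and its derivatives satisfy the estimates of the sup-norm analogue of `σ_{m,2}`,
with constant `A`. -/
def DecayBound (M : ℕ → ℝ) (m A : ℝ) (φ : RSp d → ℂ) : Prop :=
  ∀ (n k : ℕ) (x : RSp d), m ^ (n + k) * jb x ^ k * ‖iteratedFDeriv ℝ n φ x‖ ≤ A * (M n * M k)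

variable {M : ℕ → ℝ}

/-- Exponential decay is stronger than the decay prescribed by a weight sequence. -/
lemma IsWeightSequence.exists_pow_jb_le (hM : IsWeightSequence M) {m ε : ℝ} (hm : 0 < m)
    (hε : 0 < ε) : ∃ C : ℝ, 0 < C ∧ ∀ (k : ℕ) (x : RSp d),
      m ^ k * jb x ^ k * Real.exp (-(ε * ‖x‖)) ≤ C * M k := by
  obtain ⟨C, hC, h⟩ := hM.exists_factorial_le (m / ε) (by positivity)
  refine ⟨Real.exp ε * C, by positivity, fun k x => ?_⟩
  have h1 : (ε * (1 + ‖x‖)) ^ k ≤ Real.exp (ε * (1 + ‖x‖)) * k.factorial := by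
    have := Real.pow_div_factorial_le_exp (ε * (1 + ‖x‖)) (by positivity) k
    rwa [div_le_iff₀ (by positivity)] at this
  calc m ^ k * jb x ^ k * Real.exp (-(ε * ‖x‖))
      ≤ m ^ k * (1 + ‖x‖) ^ k * Real.exp (-(ε * ‖x‖)) := by
        have := jb_pos x
        gcongr; exact jb_le x
    _ = (m / ε) ^ k * (ε * (1 + ‖x‖)) ^ k * Real.exp (-(ε * ‖x‖)) := by
        rw [← mul_pow, ← mul_pow]; congr 2; field_simp
    _ ≤ (m / ε) ^ k * (Real.exp (ε * (1 + ‖x‖)) * k.factorial) * Real.exp (-(ε * ‖x‖)) := by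
        gcongr
    _ = Real.exp ε * ((m / ε) ^ k * k.factorial) := by
        have : Real.exp (ε * (1 + ‖x‖)) = Real.exp ε * Real.exp (ε * ‖x‖) := by
          rw [← Real.exp_add]; ring_nf
        rw [this, Real.exp_neg]; field_simp
    _ ≤ Real.exp ε * (C * M k) := mul_le_mul_of_nonneg_left (h k) (by positivity)
    _ = _ := by ring

/-- A holomorphic function on a strip with exponential decay restricts to a rapidly decreasing
ultradifferentiable function. -/
lemma IsWeightSequence.exists_decayBound_of_strip (hM : IsWeightSequence M) {m ε r : ℝ}
    (hm : 0 < m) (hε : 0 < ε) (hr : 0 < r) : ∃ C : ℝ, 0 < C ∧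
      ∀ (G : CSp d → ℂ) (A : ℝ), AnalyticOnNhd ℂ G (strip d r) →
        (∀ z ∈ strip d r, ‖G z‖ ≤ A * Real.exp (-(ε * ‖reE z‖))) →
        DecayBound M m (A * C) fun x => G (ofRealE d x) := by
  obtain ⟨C₁, hC₁, h1⟩ := hM.exists_pow_jb_le (d := d) hm hε
  obtain ⟨C₂, hC₂, h2⟩ := hM.exists_self_pow_le (m / r) (by positivity)
  refine ⟨Real.exp (ε * r) * C₁ * C₂, by positivity, fun G A hG hA n k x => ?_⟩
  have hA0 : 0 ≤ A := by
    have := (norm_nonneg _).trans (hA _ (ofRealE_mem_strip 0 hr))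
    exact nonneg_of_mul_nonneg_left this (Real.exp_pos _)
  -- Steps of width r / (n + 1) rather than r / n keep the closed ball inside the open strip and
  -- make sense for n = 0.
  have hs : (n : ℝ) * (r / (n + 1)) < r := by
    rw [← mul_div_assoc, div_lt_iff₀ (by positivity)]; nlinarith
  have hsub := closedBall_subset_strip x hs
  have h3 := norm_iteratedFDeriv_comp_ofRealE_le (isOpen_strip r) hG (x := x) (n := n)
    (s := r / (n + 1)) (A := A * (Real.exp (ε * r) * Real.exp (-(ε * ‖x‖)))) (by positivity)
    hsub (fun w hw => (hA w (hsub hw)).trans (by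
      rw [← Real.exp_add]
      gcongr
      have e1 := norm_reE_sub_le hw
      have e2 := norm_sub_norm_le x (reE w)
      rw [norm_sub_rev] at e2
      nlinarith))
  have hn := hM.pos n
  have hj := jb_pos x
  calc m ^ (n + k) * jb x ^ k * ‖iteratedFDeriv ℝ n (fun x => G (ofRealE d x)) x‖
      ≤ m ^ (n + k) * jb x ^ k *
        (A * (Real.exp (ε * r) * Real.exp (-(ε * ‖x‖))) / (r / (n + 1)) ^ n) := by gcongr
    _ = A * Real.exp (ε * r) * (m ^ k * jb x ^ k * Real.exp (-(ε * ‖x‖))) *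
        (m / r * (n + 1)) ^ n := by
        rw [pow_add, div_pow, mul_pow, div_pow]; field_simp
    _ ≤ A * Real.exp (ε * r) * (C₁ * M k) * (C₂ * M n) := by
        have hk := hM.pos k
        have h1' := h1 k x
        have h2' := h2 n
        generalize m ^ k * jb x ^ k * Real.exp (-(ε * ‖x‖)) = a at h1' ⊢
        gcongr
    _ = _ := by ring

end

open MeasureTheory

/-! ### Symmetry of higher derivatives -/

/-- A pointwise linear symmetry of the values of g is inherited by all its derivatives. It is used
with Φ the exchange of the two arguments of a bilinear map. -/
lemma iteratedFDeriv_isometry_invariant {E G : Type} [NormedAddCommGroup E] [NormedSpace ℝ E]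
    [NormedAddCommGroup G] [NormedSpace ℝ G] (Φ : G ≃ₗᵢ[ℝ] G) {g : E → G} (hg : ContDiff ℝ ∞ g)
    (h : ∀ y, Φ (g y) = g y) (n : ℕ) (x : E) (w : Fin n → E) :
    Φ (iteratedFDeriv ℝ n g x w) = iteratedFDeriv ℝ n g x w := by
  have h2 := Φ.toContinuousLinearEquiv.toContinuousLinearMap.iteratedFDeriv_comp_left
    (hg.contDiffAt (x := x)) (i := n) (by exact_mod_cast le_top)
  have e : Φ.toContinuousLinearEquiv.toContinuousLinearMap ∘ g = g := funext h
  rw [e] at h2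
  conv_rhs => rw [h2]
  rfl

lemma iteratedFDeriv_apply_comm {E F : Type} [NormedAddCommGroup E] [NormedSpace ℝ E]
    [NormedAddCommGroup F] [NormedSpace ℝ F] {g : E → E →L[ℝ] E →L[ℝ] F}
    (hg : ContDiff ℝ ∞ g) (h : ∀ y a b, g y a b = g y b a) (n : ℕ) (x : E) (w : Fin n → E)
    (a b : E) : iteratedFDeriv ℝ n g x w a b = iteratedFDeriv ℝ n g x w b a := by
  have := iteratedFDeriv_isometry_invariant (ContinuousLinearMap.flipₗᵢ ℝ E E F) hg
    (fun y => by ext a b; exact h y b a) n x w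
  conv_lhs => rw [← this]
  rfl

/-- Exchanging the last two arguments is symmetry of the second derivative, which persists after n
further derivatives; every other adjacent transposition leaves the last argument alone and is
handled by induction on `fderiv ℝ f`. -/
lemma iteratedFDeriv_comp_swap {E : Type} [NormedAddCommGroup E] [NormedSpace ℝ E] (n : ℕ) :
    ∀ {F : Type} [NormedAddCommGroup F] [NormedSpace ℝ F] {f : E → F}, ContDiff ℝ ∞ f →
      ∀ (i : Fin n) (x : E) (v : Fin (n + 1) → E),
        iteratedFDeriv ℝ (n + 1) f x (v ∘ Equiv.swap i.castSucc i.succ) =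
          iteratedFDeriv ℝ (n + 1) f x v := by
  induction n with
  | zero => intro F _ _ f _ i; exact i.elim0
  | succ n ih =>
    intro F _ _ f hf i x v
    have hf1 : ContDiff ℝ ∞ (fderiv ℝ f) := hf.fderiv_right (by simp)
    refine Fin.lastCases ?_ (fun j => ?_) i
    · have hf2 : ContDiff ℝ ∞ (fderiv ℝ (fderiv ℝ f)) := hf1.fderiv_right (by simp)
      have h3 := iteratedFDeriv_apply_comm hf2 (fun y a b =>
        (hf.contDiffAt.isSymmSndFDerivAt (by simpa using ENat.LEInfty.out)).eq a b) n x
      rw [iteratedFDeriv_succ_apply_right, iteratedFDeriv_succ_apply_right,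
        iteratedFDeriv_succ_apply_right, iteratedFDeriv_succ_apply_right, h3]
      have e0 : Fin.init (Fin.init
          (v ∘ Equiv.swap (Fin.last n).castSucc (Fin.last n).succ)) = Fin.init (Fin.init v) := by
        ext1 k
        simp only [Fin.init, Function.comp]
        rw [Equiv.swap_apply_of_ne_of_ne]
        · exact fun h => (Fin.castSucc_lt_last k).ne (Fin.castSucc_injective _ h)
        · intro h
          have := congrArg Fin.val h
          simp at this; omega
      rw [e0]
      simp [Fin.init]
    · have e1 : Fin.init (v ∘ Equiv.swap j.castSucc.castSucc j.castSucc.succ) =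
          Fin.init v ∘ Equiv.swap j.castSucc j.succ := by
        ext1 k
        simp only [Fin.init, Function.comp]
        rw [← Fin.castSucc_succ]
        congr 1
        exact (Fin.castSucc_injective _).swap_apply _ _ _
      have e2 : (v ∘ Equiv.swap j.castSucc.castSucc j.castSucc.succ) (Fin.last (n + 1)) =
          v (Fin.last (n + 1)) := by
        simp only [Function.comp]
        rw [Equiv.swap_apply_of_ne_of_ne]
        · intro h; have := congrArg Fin.val h; simp at this; omega
        · intro h; have := congrArg Fin.val h; simp at this; omega
      rw [iteratedFDeriv_succ_apply_right, e1, e2, ih hf1, ← iteratedFDeriv_succ_apply_right]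

/-- The iterated derivatives of a smooth function are symmetric. -/
lemma ContDiff.iteratedFDeriv_comp_perm {E F : Type} [NormedAddCommGroup E] [NormedSpace ℝ E]
    [NormedAddCommGroup F] [NormedSpace ℝ F] {f : E → F} (hf : ContDiff ℝ ∞ f) {n : ℕ} (x : E)
    (v : Fin n → E) (σ : Equiv.Perm (Fin n)) :
    iteratedFDeriv ℝ n f x (v ∘ σ) = iteratedFDeriv ℝ n f x v := by
  cases n with
  | zero => rw [Subsingleton.elim (v ∘ σ) v]
  | succ n =>
    have hσ : σ ∈ Submonoid.closure
        (Set.range fun i : Fin n => Equiv.swap i.castSucc i.succ) := by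
      rw [Equiv.Perm.mclosure_swap_castSucc_succ]; trivial
    induction hσ using Submonoid.closure_induction generalizing v with
    | mem σ h =>
      obtain ⟨i, rfl⟩ := h
      exact iteratedFDeriv_comp_swap n hf i x v
    | one => rfl
    | mul σ τ _ _ h1 h2 =>
      rw [Equiv.Perm.coe_mul, ← Function.comp_assoc, h2, h1]

lemma ContDiff.iteratedFDeriv_comp_equiv {E F : Type} [NormedAddCommGroup E] [NormedSpace ℝ E]
    [NormedAddCommGroup F] [NormedSpace ℝ F] {f : E → F} (hf : ContDiff ℝ ∞ f) {n m : ℕ} (x : E)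
    (v : Fin m → E) (e : Fin n ≃ Fin m) :
    iteratedFDeriv ℝ n f x (v ∘ e) = iteratedFDeriv ℝ m f x v := by
  obtain rfl : n = m := by simpa using Fintype.card_congr e
  exact hf.iteratedFDeriv_comp_perm x v e

/-! ### Partial derivatives versus Fréchet derivatives, and Leibniz' rule -/

section

variable {d : ℕ}

lemma norm_partialD_le (β : Fin d → ℕ) (φ : RSp d → ℂ) (x : RSp d) :
    ‖partialD β φ x‖ ≤ ‖iteratedFDeriv ℝ (miLen β) φ x‖ := by
  refine (ContinuousMultilinearMap.le_opNorm _ _).trans ?_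
  simp only [miLen, EuclideanSpace.single, PiLp.norm_single, norm_one, Finset.prod_const_one, mul_one]
  exact le_rfl

/-- `partialD` lists its basis vectors in increasing order; by symmetry any word in the basis
vectors may be sorted, with β counting the letters. -/
lemma exists_partialD_eq {φ : RSp d → ℂ} (hφ : ContDiff ℝ ∞ φ) {n : ℕ} (s : Fin n → Fin d) :
    ∃ β : Fin d → ℕ, miLen β = n ∧ ∀ x,
      iteratedFDeriv ℝ n φ x (fun j => EuclideanSpace.single (s j) (1 : ℝ)) =
        partialD β φ x := by
  classical
  let β : Fin d → ℕ := fun i => Fintype.card {j // s j = i}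
  let e : Fin n ≃ Fin (∑ i, β i) :=
    (Equiv.sigmaFiberEquiv s).symm.trans
      ((Equiv.sigmaCongrRight fun i => Fintype.equivFin {j // s j = i}).trans finSigmaFinEquiv)
  have hn : n = ∑ i, β i := by simpa using Fintype.card_congr e
  refine ⟨β, hn.symm, fun x => ?_⟩
  rw [partialD, ← hφ.iteratedFDeriv_comp_equiv x _ e]
  congr 1
  ext1 j
  simp [e, Function.comp, Equiv.sigmaFiberEquiv]

/-- The operator norm of the `n`-th derivative is controlled by the partial derivatives. -/
lemma norm_iteratedFDeriv_le_of_partialD {φ : RSp d → ℂ} (hφ : ContDiff ℝ ∞ φ) {n : ℕ}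
    {x : RSp d} {B : ℝ} (hB : 0 ≤ B)
    (h : ∀ β : Fin d → ℕ, miLen β = n → ‖partialD β φ x‖ ≤ B) :
    ‖iteratedFDeriv ℝ n φ x‖ ≤ d ^ n * B := by
  refine ContinuousMultilinearMap.opNorm_le_bound (by positivity) fun v => ?_
  have hv : v = fun j => ∑ i : Fin d, v j i • EuclideanSpace.single i (1 : ℝ) := by
    ext1 j
    ext i
    simp [Pi.single_apply]
  conv_lhs => rw [hv]
  rw [ContinuousMultilinearMap.map_sum]
  refine (norm_sum_le _ _).trans ?_
  calc ∑ s : Fin n → Fin d, ‖iteratedFDeriv ℝ n φ x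
        fun j => v j (s j) • EuclideanSpace.single (s j) (1 : ℝ)‖
      ≤ ∑ s : Fin n → Fin d, (∏ j, ‖v j‖) * B := by
        refine Finset.sum_le_sum fun s _ => ?_
        rw [ContinuousMultilinearMap.map_smul_univ, norm_smul, norm_prod]
        obtain ⟨β, hβ, he⟩ := exists_partialD_eq hφ s
        rw [he x]
        gcongr with j
        · exact PiLp.norm_apply_le _ _
        · exact h β hβ
    _ = _ := by simp; ring

/-- In Leibniz' rule M_i M_{n-i} ≤ M_n, and the remaining sum is the binomial expansion of (h +
l)^n. -/
lemma IsWeightSequence.norm_iteratedFDeriv_mul_le {M : ℕ → ℝ} (hM : IsWeightSequence M)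
    {f g : RSp d → ℂ} (hf : ContDiff ℝ ∞ f) (hg : ContDiff ℝ ∞ g) {x : RSp d} {A B h l : ℝ}
    (hh : 0 ≤ h) (hl : 0 ≤ l)
    (h1 : ∀ n, ‖iteratedFDeriv ℝ n f x‖ ≤ A * h ^ n * M n)
    (h2 : ∀ n, ‖iteratedFDeriv ℝ n g x‖ ≤ B * l ^ n * M n) (n : ℕ) :
    ‖iteratedFDeriv ℝ n (fun y => f y * g y) x‖ ≤ A * B * (h + l) ^ n * M n := by
  have hA : 0 ≤ A := by simpa [hM.zero] using (norm_nonneg _).trans (h1 0)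
  have hB : 0 ≤ B := by simpa [hM.zero] using (norm_nonneg _).trans (h2 0)
  refine (_root_.norm_iteratedFDeriv_mul_le hf hg x (n := n) (by exact_mod_cast le_top)).trans ?_
  rw [add_pow, Finset.mul_sum, Finset.sum_mul]
  refine Finset.sum_le_sum fun i hi => ?_
  have hi' : i + (n - i) = n := by have := Finset.mem_range.1 hi; omega
  have hMi := hM.mul_le i (n - i)
  rw [hi'] at hMi
  have := hM.pos i
  have := hM.pos (n - i)
  calc (n.choose i : ℝ) * ‖iteratedFDeriv ℝ i f x‖ * ‖iteratedFDeriv ℝ (n - i) g x‖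
      ≤ (n.choose i : ℝ) * (A * h ^ i * M i) * (B * l ^ (n - i) * M (n - i)) := by
        gcongr
        · exact h1 i
        · exact h2 _
    _ = A * B * (h ^ i * l ^ (n - i) * n.choose i) * (M i * M (n - i)) := by ring
    _ ≤ _ := by gcongr


lemma norm_iteratedFDeriv_isometry_comp {E F G : Type} [NormedAddCommGroup E] [NormedSpace ℝ E]
    [NormedAddCommGroup F] [NormedSpace ℝ F] [NormedAddCommGroup G] [NormedSpace ℝ G]
    (Φ : G ≃ₗᵢ[ℝ] F) {f : E → F} {g : E → G} (h : ∀ y, f y = Φ (g y)) (i : ℕ) (x : E) :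
    ‖iteratedFDeriv ℝ i f x‖ = ‖iteratedFDeriv ℝ i g x‖ := by
  rw [show f = Φ ∘ g from funext h, LinearIsometryEquiv.norm_iteratedFDeriv_comp_left]

lemma norm_iteratedFDeriv_iteratedFDeriv {E F : Type} [NormedAddCommGroup E] [NormedSpace ℝ E]
    [NormedAddCommGroup F] [NormedSpace ℝ F] (f : E → F) (n i : ℕ) (x : E) :
    ‖iteratedFDeriv ℝ i (iteratedFDeriv ℝ n f) x‖ = ‖iteratedFDeriv ℝ (n + i) f x‖ := by
  induction n generalizing i with
  | zero =>
    rw [iteratedFDeriv_zero_eq_comp, LinearIsometryEquiv.norm_iteratedFDeriv_comp_left, zero_add]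
  | succ n ih =>
    let Φ : (E →L[ℝ] (E [×n]→L[ℝ] F)) ≃ₗᵢ[ℝ] (E [×(n + 1)]→L[ℝ] F) :=
      (continuousMultilinearCurryLeftEquiv ℝ (fun _ : Fin (n + 1) => E) F).symm
    have h : ∀ y, iteratedFDeriv ℝ (n + 1) f y = Φ (fderiv ℝ (iteratedFDeriv ℝ n f) y) :=
      fun y => congrFun iteratedFDeriv_succ_eq_comp_left y
    rw [norm_iteratedFDeriv_isometry_comp (F := E [×(n + 1)]→L[ℝ] F)
      (G := E →L[ℝ] (E [×n]→L[ℝ] F)) Φ (g := fderiv ℝ (iteratedFDeriv ℝ n f)) h i x, norm_iteratedFDeriv_fderiv, ih]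
    rw [show n + (i + 1) = n + 1 + i by omega]

/-! ### Sobolev inequalities -/

open FourierTransform in
/-- A Sobolev inequality: the sup norm is controlled by the `L¹` norms of the derivatives of order
at most `d + 1`. -/
lemma exists_sobolev (d : ℕ) : ∃ C : ℝ, 0 < C ∧
    ∀ {F : Type} [NormedAddCommGroup F] [NormedSpace ℂ F] [CompleteSpace F] (u : RSp d → F),
      ContDiff ℝ ∞ u → HasCompactSupport u → ∀ x,
        ‖u x‖ ≤ C * ∑ j ∈ Finset.range (d + 2), ∫ y, ‖iteratedFDeriv ℝ j u y‖ := by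
  -- The first d + 1 derivatives in L¹ give the Fourier transform this integrable decay; Fourier
  -- inversion then bounds u.
  set w : RSp d → ℝ := fun y => (1 + ‖y‖) ^ (-((d + 1 : ℕ) : ℝ)) with hw
  have hwint : Integrable w := integrable_one_add_norm (by simp)
  have hw0 : ∀ y, 0 ≤ w y := fun y => by positivity
  refine ⟨2 ^ (d + 1) * (2 ^ (d + 1) + 1) * (∫ y, w y) + 1, ?_, ?_⟩
  · have : 0 ≤ ∫ y, w y := integral_nonneg hw0
    positivity
  intro F _ _ _ u hu hsupp x
  set I : ℝ := ∑ j ∈ Finset.range (d + 2), ∫ y, ‖iteratedFDeriv ℝ j u y‖ with hI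
  have hint : ∀ j : ℕ, Integrable fun y => ‖iteratedFDeriv ℝ j u y‖ := fun j =>
    ((hu.continuous_iteratedFDeriv (by exact_mod_cast le_top)).integrable_of_hasCompactSupport
      (hsupp.iteratedFDeriv j)).norm
  have hint' : ∀ k n : ℕ, (k : ℕ∞) ≤ 0 → (n : ℕ∞) ≤ ⊤ →
      Integrable fun y => ‖y‖ ^ k * ‖iteratedFDeriv ℝ n u y‖ := fun k n hk _ => by
    obtain rfl : k = 0 := by simpa using hk
    simpa using hint n
  have hI0 : 0 ≤ I := Finset.sum_nonneg fun j _ => integral_nonneg fun y => norm_nonneg _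
  have hzero : ∀ y, ‖𝓕 u y‖ ≤ I := fun y => by
    refine (VectorFourier.norm_fourierIntegral_le_integral_norm _ _ _ _ _).trans ?_
    have := Finset.single_le_sum (f := fun j => ∫ y, ‖iteratedFDeriv ℝ j u y‖)
      (fun j _ => integral_nonneg fun y => norm_nonneg _)
      (Finset.mem_range.2 (by omega : 0 < d + 2))
    simpa using this
  have hpow : ∀ y, ‖y‖ ^ (d + 1) * ‖𝓕 u y‖ ≤ 2 ^ (d + 1) * I := fun y => by
    have := Real.pow_mul_norm_iteratedFDeriv_fourier_le (K := 0) (N := ⊤) (by exact_mod_cast hu)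
      hint' (k := 0) (n := d + 1) le_rfl le_top y
    rw [Finset.sum_product] at this
    simpa using this
  have hbound : ∀ y, ‖𝓕 u y‖ ≤ 2 ^ (d + 1) * (2 ^ (d + 1) + 1) * I * w y := fun y => by
    have h1 : (1 + ‖y‖) ^ (d + 1) ≤ 2 ^ (d + 1) * (1 + ‖y‖ ^ (d + 1)) := by
      rcases le_total ‖y‖ 1 with h | h
      · calc (1 + ‖y‖) ^ (d + 1) ≤ 2 ^ (d + 1) := by gcongr; linarith
          _ ≤ _ := le_mul_of_one_le_right (by positivity) (by simp)
      · calc (1 + ‖y‖) ^ (d + 1) ≤ (2 * ‖y‖) ^ (d + 1) := by gcongr; linarith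
          _ = 2 ^ (d + 1) * ‖y‖ ^ (d + 1) := mul_pow _ _ _
          _ ≤ _ := by gcongr; simp
    have h2 : w y = ((1 + ‖y‖) ^ (d + 1))⁻¹ := by
      simp only [hw]; rw [Real.rpow_neg (by positivity), Real.rpow_natCast]
    rw [h2, ← div_eq_mul_inv, le_div_iff₀ (by positivity)]
    calc ‖𝓕 u y‖ * (1 + ‖y‖) ^ (d + 1)
        ≤ ‖𝓕 u y‖ * (2 ^ (d + 1) * (1 + ‖y‖ ^ (d + 1))) := by gcongr
      _ = 2 ^ (d + 1) * (‖y‖ ^ (d + 1) * ‖𝓕 u y‖ + ‖𝓕 u y‖) := by ring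
      _ ≤ 2 ^ (d + 1) * (2 ^ (d + 1) * I + I) := by
          have := hpow y; have := hzero y; gcongr
      _ = _ := by ring
  have huint : Integrable u := hu.continuous.integrable_of_hasCompactSupport hsupp
  have hFcont : Continuous (𝓕 u) :=
    VectorFourier.fourierIntegral_continuous Real.continuous_fourierChar
      (by exact continuous_inner) huint
  have hFint : Integrable (𝓕 u) :=
    (hwint.const_mul (2 ^ (d + 1) * (2 ^ (d + 1) + 1) * I)).mono' hFcont.aestronglyMeasurable
      (Filter.Eventually.of_forall hbound)
  have hinv := congrFun (hu.continuous.fourierInv_fourier_eq huint hFint) x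
  rw [← hinv]
  calc ‖𝓕⁻ (𝓕 u) x‖ ≤ ∫ y, ‖𝓕 u y‖ := VectorFourier.norm_fourierIntegral_le_integral_norm _ _ _ _ _
    _ ≤ ∫ y, 2 ^ (d + 1) * (2 ^ (d + 1) + 1) * I * w y :=
      integral_mono hFint.norm (hwint.const_mul _) hbound
    _ = 2 ^ (d + 1) * (2 ^ (d + 1) + 1) * (∫ y, w y) * I := by rw [integral_const_mul]; ring
    _ ≤ _ := by rw [add_mul]; exact le_add_of_nonneg_right (by positivity)

/-- A local Sobolev inequality. -/
lemma exists_local_sobolev (d : ℕ) : ∃ C : ℝ, 0 < C ∧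
    ∀ {F : Type} [NormedAddCommGroup F] [NormedSpace ℂ F] [CompleteSpace F] (g : RSp d → F),
      ContDiff ℝ ∞ g → ∀ x, ‖g x‖ ≤ C * ∑ j ∈ Finset.range (d + 2),
        ∫ y in Metric.closedBall x 1, ‖iteratedFDeriv ℝ j g y‖ := by
  obtain ⟨C, hC, hsob⟩ := exists_sobolev d
  let b : ContDiffBump (0 : RSp d) := ⟨1 / 2, 1, by norm_num, by norm_num⟩
  have hb : ContDiff ℝ ∞ (b : RSp d → ℝ) := b.contDiff
  have hbs : HasCompactSupport (b : RSp d → ℝ) := b.hasCompactSupport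
  have hbd : ∀ j : ℕ, ∃ K : ℝ, ∀ y, ‖iteratedFDeriv ℝ j (b : RSp d → ℝ) y‖ ≤ K := fun j =>
    (hbs.iteratedFDeriv j).exists_bound_of_continuous
      (hb.continuous_iteratedFDeriv (by exact_mod_cast le_top))
  choose K hK using hbd
  set K' : ℝ := ∑ j ∈ Finset.range (d + 2), ‖K j‖ with hK'
  have hKK : ∀ j < d + 2, ∀ y, ‖iteratedFDeriv ℝ j (b : RSp d → ℝ) y‖ ≤ K' := fun j hj y =>
    (hK j y).trans ((le_abs_self _).trans (Finset.single_le_sum (f := fun j => ‖K j‖)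
      (fun j _ => norm_nonneg _) (Finset.mem_range.2 hj)))
  have hK0 : 0 ≤ K' := Finset.sum_nonneg fun j _ => norm_nonneg _
  refine ⟨C * ((d + 2) * (2 ^ (d + 2) * K')) + 1, by positivity, ?_⟩
  intro F _ _ _ g hg x
  set u : RSp d → F := fun y => b (y - x) • g y with hu
  have hbx : ContDiff ℝ ∞ fun y => b (y - x) := hb.comp (contDiff_id.sub contDiff_const)
  have hucd : ContDiff ℝ ∞ u := hbx.smul hg
  have htsupp : tsupport u ⊆ Metric.closedBall x 1 := by
    refine closure_minimal (fun y hy => ?_) Metric.isClosed_closedBall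
    by_contra hcon
    refine hy ?_
    have : b (y - x) = 0 := b.zero_of_le_dist (by
      simp only [Metric.mem_closedBall, not_le] at hcon
      simpa [dist_eq_norm] using hcon.le)
    simp [hu, this]
  have hus : HasCompactSupport u :=
    (isCompact_closedBall x 1).of_isClosed_subset (isClosed_tsupport _) htsupp
  have hux : u x = g x := by
    have : b (x - x) = 1 := b.one_of_mem_closedBall (by simp [b.rIn_pos.le])
    simp only [hu, this, one_smul]
  have hgc : ∀ j : ℕ, Continuous fun y => ‖iteratedFDeriv ℝ j g y‖ := fun j =>
    (hg.continuous_iteratedFDeriv (by exact_mod_cast le_top)).norm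
  have hgi : ∀ j : ℕ, IntegrableOn (fun y => ‖iteratedFDeriv ℝ j g y‖) (Metric.closedBall x 1) :=
    fun j => (hgc j).continuousOn.integrableOn_compact (isCompact_closedBall x 1)
  set I : ℝ := ∑ j ∈ Finset.range (d + 2),
    ∫ y in Metric.closedBall x 1, ‖iteratedFDeriv ℝ j g y‖ with hI
  have hI0 : 0 ≤ I := Finset.sum_nonneg fun j _ => integral_nonneg fun y => norm_nonneg _
  have key : ∀ j ∈ Finset.range (d + 2), ∫ y, ‖iteratedFDeriv ℝ j u y‖ ≤ 2 ^ (d + 2) * K' * I := by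
    intro j hj
    have hj' := Finset.mem_range.1 hj
    have hpt : ∀ y, ‖iteratedFDeriv ℝ j u y‖ ≤
        2 ^ (d + 2) * K' * ∑ i ∈ Finset.range (d + 2), ‖iteratedFDeriv ℝ i g y‖ := fun y => by
      refine (norm_iteratedFDeriv_smul_le hbx hg y (n := j) (by exact_mod_cast le_top)).trans ?_
      have hS : 0 ≤ ∑ i ∈ Finset.range (d + 2), ‖iteratedFDeriv ℝ i g y‖ :=
        Finset.sum_nonneg fun i _ => norm_nonneg _
      calc ∑ i ∈ Finset.range (j + 1), (j.choose i : ℝ) *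
            ‖iteratedFDeriv ℝ i (fun y => b (y - x)) y‖ * ‖iteratedFDeriv ℝ (j - i) g y‖
          ≤ ∑ i ∈ Finset.range (j + 1), (j.choose i : ℝ) *
            (K' * ∑ i ∈ Finset.range (d + 2), ‖iteratedFDeriv ℝ i g y‖) := by
            refine Finset.sum_le_sum fun i hi => ?_
            have hi' := Finset.mem_range.1 hi
            rw [mul_assoc]
            gcongr
            · rw [iteratedFDeriv_comp_sub]
              exact hKK i (by omega) _
            · exact Finset.single_le_sum (f := fun i => ‖iteratedFDeriv ℝ i g y‖)
                (fun i _ => norm_nonneg _) (Finset.mem_range.2 (by omega : j - i < d + 2))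
        _ = 2 ^ j * K' * ∑ i ∈ Finset.range (d + 2), ‖iteratedFDeriv ℝ i g y‖ := by
            rw [← Finset.sum_mul, mul_assoc]
            congr 1
            exact_mod_cast Nat.sum_range_choose j
        _ ≤ _ := by gcongr; norm_num
    have hzero : ∀ y, y ∉ Metric.closedBall x 1 → ‖iteratedFDeriv ℝ j u y‖ = 0 := fun y hy => by
      have h := (tsupport_iteratedFDeriv_subset (𝕜 := ℝ) (f := u) j).trans htsupp
      rw [image_eq_zero_of_notMem_tsupport fun hc => hy (h hc), norm_zero]
    rw [← setIntegral_eq_integral_of_forall_compl_eq_zero hzero]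
    calc ∫ y in Metric.closedBall x 1, ‖iteratedFDeriv ℝ j u y‖
        ≤ ∫ y in Metric.closedBall x 1,
          2 ^ (d + 2) * K' * ∑ i ∈ Finset.range (d + 2), ‖iteratedFDeriv ℝ i g y‖ := by
          refine integral_mono_of_nonneg (Filter.Eventually.of_forall fun y => norm_nonneg _) ?_
            (Filter.Eventually.of_forall hpt)
          exact (integrable_finsetSum _ fun i _ => hgi i).const_mul _
      _ = _ := by rw [integral_const_mul, integral_finsetSum _ fun i _ => hgi i]
  rw [← hux]
  calc ‖u x‖ ≤ C * ∑ j ∈ Finset.range (d + 2), ∫ y, ‖iteratedFDeriv ℝ j u y‖ := hsob u hucd hus x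
    _ ≤ C * ∑ j ∈ Finset.range (d + 2), 2 ^ (d + 2) * K' * I := by
      gcongr with j hj; exact key j hj
    _ = C * ((d + 2) * (2 ^ (d + 2) * K')) * I := by simp; ring
    _ ≤ _ := mul_le_mul_of_nonneg_right (by linarith) hI0

end

/-! ### Equivalence of the L² norms and the sup norms -/

section

variable {d : ℕ} {M : ℕ → ℝ}

/-- Only |α| enters the weights, so k times a basis vector will do. In dimension zero there is no
multi-index of positive length, but then ⟨x⟩ = 1 and m^k / M_k is bounded. -/
lemma IsWeightSequence.exists_multiIndex (hM : IsWeightSequence M) {m : ℝ} (hm : 0 < m) :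
    ∃ C : ℝ, 1 ≤ C ∧ ∀ k : ℕ, ∃ α : Fin d → ℕ, ∀ x : RSp d,
      m ^ k * jb x ^ k / M k ≤ C * (m ^ miLen α * jb x ^ miLen α / M (miLen α)) := by
  rcases Nat.eq_zero_or_pos d with rfl | hd
  · obtain ⟨C, hC, h⟩ := hM.exists_pow_le m hm
    refine ⟨C, hC, fun k => ⟨0, fun x => ?_⟩⟩
    have hx : jb x = 1 := by simp [jb, Subsingleton.elim x 0]
    have := hM.pos k
    simp only [hx, miLen, Finset.univ_eq_empty, Finset.sum_empty, hM.zero, one_pow, pow_zero,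
      mul_one, div_one]
    rw [div_le_iff₀ this]
    exact h k
  · refine ⟨1, le_rfl, fun k => ⟨Pi.single ⟨0, hd⟩ k, fun x => ?_⟩⟩
    have : miLen (Pi.single (⟨0, hd⟩ : Fin d) k) = k := by simp [miLen]
    rw [this, one_mul]

lemma sum_lintegral_le_of_sigmaNorm_le {m : ℝ} {φ : RSp d → ℂ} {Q : ℝ≥0∞}
    (h : sigmaNorm M m φ ≤ Q) (α : Fin d → ℕ) (s : Finset (Fin d → ℕ)) :
    ∑ β ∈ s, ∫⁻ x : RSp d, ENNReal.ofReal (m ^ (miLen α + miLen β) * jb x ^ miLen α *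
      ‖partialD β φ x‖ / (M (miLen α) * M (miLen β))) ^ 2 ≤ Q ^ 2 := by
  refine (ENNReal.sum_le_tsum s).trans (le_trans (ENNReal.le_tsum (f := fun α => ∑' β,
    ∫⁻ x : RSp d, ENNReal.ofReal (m ^ (miLen α + miLen β) * jb x ^ miLen α *
      ‖partialD β φ x‖ / (M (miLen α) * M (miLen β))) ^ 2) α) ?_)
  have h2 := pow_le_pow_left₀ (zero_le) h 2
  refine le_trans (le_of_eq ?_) h2
  rw [sigmaNorm, ← ENNReal.rpow_natCast, ← ENNReal.rpow_mul]
  norm_num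
  rfl

lemma continuous_partialD {φ : RSp d → ℂ} (hφ : ContDiff ℝ ∞ φ) (β : Fin d → ℕ) :
    Continuous (partialD β φ) := by
  have h : Continuous (iteratedFDeriv ℝ (∑ i, β i) φ) :=
    hφ.continuous_iteratedFDeriv (by exact_mod_cast le_top)
  exact h.eval_const _

/-- Of the double sum in σ only one α and the β of length n are kept. The factor d^n is the price of
the operator norm in terms of partial derivatives. -/
lemma IsWeightSequence.exists_lintegral_le (hM : IsWeightSequence M) {m : ℝ} (hm : 0 < m) :
    ∃ C : ℝ, 0 < C ∧ ∀ φ : RSp d → ℂ, ContDiff ℝ ∞ φ → ∀ q : ℝ, 0 ≤ q →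
      sigmaNorm M m φ ≤ ENNReal.ofReal q → ∀ n k : ℕ,
      ∫⁻ x : RSp d, ENNReal.ofReal (m ^ (n + k) * jb x ^ k * ‖iteratedFDeriv ℝ n φ x‖ /
        (M n * M k)) ^ 2 ≤ ENNReal.ofReal ((C * d ^ n * q) ^ 2) := by
  obtain ⟨C, hC, hα⟩ := hM.exists_multiIndex (d := d) hm
  refine ⟨C, by linarith, fun φ hφ q hq hσ n k => ?_⟩
  obtain ⟨α, hα⟩ := hα k
  set s : Finset (Fin d → ℕ) := Finset.piAntidiag Finset.univ n with hs
  have hmem : ∀ β : Fin d → ℕ, β ∈ s ↔ miLen β = n := fun β => by simp [hs, miLen]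
  have hMn := hM.pos n
  have hMk := hM.pos k
  have hMα := hM.pos (miLen α)
  set T : (Fin d → ℕ) → RSp d → ℝ := fun β x => m ^ (miLen α + miLen β) * jb x ^ miLen α *
      ‖partialD β φ x‖ / (M (miLen α) * M (miLen β)) with hT
  have hT0 : ∀ β x, 0 ≤ T β x := fun β x => by
    have := hM.pos (miLen β); have := jb_pos x; positivity
  have hTc : ∀ β, Continuous (T β) := fun β => by
    have h1 := continuous_partialD hφ β
    have h2 := continuous_jb (d := d)
    simp only [hT]
    exact ((continuous_const.mul (h2.pow _)).mul h1.norm).div_const _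
  have hpt : ∀ x, (m ^ (n + k) * jb x ^ k * ‖iteratedFDeriv ℝ n φ x‖ / (M n * M k)) ^ 2 ≤
      (C * d ^ n) ^ 2 * ∑ β ∈ s, T β x ^ 2 := fun x => by
    have hj := jb_pos x
    have h1 : ‖iteratedFDeriv ℝ n φ x‖ ≤ d ^ n * √(∑ β ∈ s, ‖partialD β φ x‖ ^ 2) := by
      refine norm_iteratedFDeriv_le_of_partialD hφ (Real.sqrt_nonneg _) fun β hβ => ?_
      refine Real.le_sqrt_of_sq_le ?_
      exact Finset.single_le_sum (f := fun β => ‖partialD β φ x‖ ^ 2) (fun _ _ => by positivity)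
        ((hmem β).2 hβ)
    calc (m ^ (n + k) * jb x ^ k * ‖iteratedFDeriv ℝ n φ x‖ / (M n * M k)) ^ 2
        = (m ^ k * jb x ^ k / M k * (m ^ n / M n) * ‖iteratedFDeriv ℝ n φ x‖) ^ 2 := by
          rw [pow_add]; field_simp
      _ ≤ (C * (m ^ miLen α * jb x ^ miLen α / M (miLen α)) * (m ^ n / M n) *
          (d ^ n * √(∑ β ∈ s, ‖partialD β φ x‖ ^ 2))) ^ 2 := by
          have := hα x
          gcongr
      _ = (C * d ^ n) ^ 2 * ((m ^ miLen α * jb x ^ miLen α / M (miLen α) * (m ^ n / M n)) ^ 2 *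
          √(∑ β ∈ s, ‖partialD β φ x‖ ^ 2) ^ 2) := by ring
      _ = _ := by
          rw [Real.sq_sqrt (Finset.sum_nonneg fun _ _ => by positivity), Finset.mul_sum]
          congr 1
          refine Finset.sum_congr rfl fun β hβ => ?_
          simp only [hT, (hmem β).1 hβ]
          rw [pow_add]; field_simp
  calc ∫⁻ x : RSp d, ENNReal.ofReal (m ^ (n + k) * jb x ^ k * ‖iteratedFDeriv ℝ n φ x‖ /
        (M n * M k)) ^ 2
      ≤ ∫⁻ x : RSp d, ENNReal.ofReal ((C * d ^ n) ^ 2) * ∑ β ∈ s, ENNReal.ofReal (T β x) ^ 2 := by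
        refine lintegral_mono fun x => ?_
        have hj := jb_pos x
        rw [← ENNReal.ofReal_pow (by positivity)]
        simp_rw [← ENNReal.ofReal_pow (hT0 _ x)]
        rw [← ENNReal.ofReal_sum_of_nonneg (fun _ _ => by positivity),
          ← ENNReal.ofReal_mul (by positivity)]
        exact ENNReal.ofReal_le_ofReal (hpt x)
    _ = ENNReal.ofReal ((C * d ^ n) ^ 2) * ∑ β ∈ s, ∫⁻ x, ENNReal.ofReal (T β x) ^ 2 := by
        have hmeas : ∀ β, Measurable fun x => ENNReal.ofReal (T β x) ^ 2 := fun β =>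
          ((hTc β).measurable.ennreal_ofReal).pow_const 2
        rw [lintegral_const_mul _ (Finset.measurable_fun_sum s fun β _ => hmeas β),
          lintegral_finsetSum s fun β _ => hmeas β]
    _ ≤ ENNReal.ofReal ((C * d ^ n) ^ 2) * ENNReal.ofReal q ^ 2 := by
        gcongr
        exact sum_lintegral_le_of_sigmaNorm_le hσ α s
    _ = _ := by
        rw [← ENNReal.ofReal_pow hq, ← ENNReal.ofReal_mul (by positivity)]
        congr 1; ring

/-- A crude substitute for Cauchy–Schwarz on the unit ball: v ≤ v² / l + l for every l > 0, with l
close to Q. -/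
lemma setIntegral_le_of_lintegral_sq_le {v : RSp d → ℝ} (hv : Continuous v) (hv0 : ∀ x, 0 ≤ v x)
    {Q : ℝ} (hQ : 0 ≤ Q) (h : ∫⁻ x, ENNReal.ofReal (v x) ^ 2 ≤ ENNReal.ofReal (Q ^ 2))
    (x : RSp d) :
    ∫ y in Metric.closedBall x 1, v y ≤ (volume.real (Metric.closedBall x 1) + 1) * Q := by
  set B := Metric.closedBall x 1
  have hBc : IsCompact B := isCompact_closedBall x 1
  have hi0 : ∀ l : ℝ, IntegrableOn (fun _ => l) B := fun l =>
    continuous_const.continuousOn.integrableOn_compact hBc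
  have hi1 : IntegrableOn v B := hv.continuousOn.integrableOn_compact hBc
  have hi2 : IntegrableOn (fun y => v y ^ 2) B := (hv.pow 2).continuousOn.integrableOn_compact hBc
  have hsq : ∫ y in B, v y ^ 2 ≤ Q ^ 2 := by
    rw [← ENNReal.ofReal_le_ofReal_iff (by positivity),
      ofReal_integral_eq_lintegral_ofReal hi2 (Filter.Eventually.of_forall fun y => by positivity)]
    refine le_trans ?_ h
    refine (setLIntegral_le_lintegral _ _).trans (le_of_eq ?_)
    simp_rw [ENNReal.ofReal_pow (hv0 _)]
  refine le_of_forall_pos_le_add fun δ hδ => ?_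
  set V := volume.real B
  have hV : 0 ≤ V := measureReal_nonneg
  -- The extra term keeps l positive when Q = 0, and contributes exactly δ to the final bound (V +
  -- 1) l.
  set l := Q + δ / (V + 1) with hl
  have hlpos : 0 < l := by positivity
  calc ∫ y in B, v y ≤ ∫ y in B, ((1 / l) * v y ^ 2 + l) := by
        refine setIntegral_mono hi1 ?_ fun y => ?_
        · exact (hi2.const_mul _).add (hi0 l)
        · have : v y * l ≤ v y ^ 2 + l * l := by nlinarith [sq_nonneg (v y - l), sq_nonneg (v y + l)]
          have e : (1 / l) * v y ^ 2 + l = (v y ^ 2 + l * l) / l := by field_simp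
          change v y ≤ (1 / l) * v y ^ 2 + l
          rw [e, le_div_iff₀ hlpos]; exact this
    _ = (1 / l) * (∫ y in B, v y ^ 2) + V * l := by
        rw [integral_add (hi2.const_mul _) (hi0 l), integral_const_mul]
        simp [V]
    _ ≤ (1 / l) * l ^ 2 + V * l := by
        have : Q ^ 2 ≤ l ^ 2 := by
          have : 0 ≤ δ / (V + 1) := by positivity
          gcongr; linarith
        gcongr
        linarith
    _ = (V + 1) * l := by field_simp; ring
    _ = _ := by rw [hl, mul_add]; field_simp

lemma jb_le_two_mul {x y : RSp d} (h : y ∈ Metric.closedBall x 1) : jb x ≤ 2 * jb y := by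
  rw [Metric.mem_closedBall, dist_comm, dist_eq_norm] at h
  have h1 : ‖x‖ ≤ ‖y‖ + 1 := by
    have := norm_sub_norm_le x y; linarith
  have h2 : (2 : ℝ) * jb y = √(4 * (1 + ‖y‖ ^ 2)) := by
    rw [jb, Real.sqrt_mul (by norm_num), show (4 : ℝ) = 2 ^ 2 by norm_num,
      Real.sqrt_sq (by norm_num)]
  rw [h2]
  refine Real.sqrt_le_sqrt ?_
  nlinarith [norm_nonneg x, norm_nonneg y, sq_nonneg (‖y‖ - 1)]

lemma setIntegral_iteratedFDeriv_le {φ : RSp d → ℂ} (hφ : ContDiff ℝ ∞ φ) {m Q A : ℝ}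
    (hm : 0 < m) (hA : 0 < A) (hQ : 0 ≤ Q) (p k : ℕ)
    (h : ∫⁻ x : RSp d, ENNReal.ofReal (m ^ (p + k) * jb x ^ k * ‖iteratedFDeriv ℝ p φ x‖ / A) ^ 2 ≤
      ENNReal.ofReal (Q ^ 2)) (x : RSp d) :
    m ^ (p + k) * jb x ^ k * ∫ y in Metric.closedBall x 1, ‖iteratedFDeriv ℝ p φ y‖ ≤
      2 ^ k * A * ((volume.real (Metric.closedBall (0 : RSp d) 1) + 1) * Q) := by
  have hcont : Continuous fun y => ‖iteratedFDeriv ℝ p φ y‖ :=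
    (hφ.continuous_iteratedFDeriv (by exact_mod_cast le_top)).norm
  set v : RSp d → ℝ := fun y => m ^ (p + k) * jb y ^ k * ‖iteratedFDeriv ℝ p φ y‖ / A with hv
  have hvc : Continuous v :=
    ((continuous_const.mul (continuous_jb.pow _)).mul hcont).div_const _
  have hv0 : ∀ y, 0 ≤ v y := fun y => by have := jb_pos y; positivity
  have hint := setIntegral_le_of_lintegral_sq_le hvc hv0 hQ h x
  have hvol : volume.real (Metric.closedBall x 1) =
      volume.real (Metric.closedBall (0 : RSp d) 1) := by
    simp [measureReal_def, Measure.addHaar_closedBall_center]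
  rw [hvol] at hint
  rw [← integral_const_mul]
  refine le_trans ?_ (mul_le_mul_of_nonneg_left hint (by positivity : 0 ≤ 2 ^ k * A))
  rw [← integral_const_mul]
  refine setIntegral_mono_on
    ((continuous_const.mul hcont).continuousOn.integrableOn_compact (isCompact_closedBall x 1))
    ((continuous_const.mul hvc).continuousOn.integrableOn_compact (isCompact_closedBall x 1))
    measurableSet_closedBall fun y hy => ?_
  have e : 2 ^ k * A * v y = m ^ (p + k) * (2 * jb y) ^ k * ‖iteratedFDeriv ℝ p φ y‖ := by
    simp only [hv]; rw [mul_pow]; field_simp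
  rw [e]
  have := jb_le_two_mul hy
  have := jb_pos x
  gcongr

/-- The `L²` norms `σ_{m,2}` dominate the sup norms. -/
lemma IsWeightSequence.exists_decayBound_of_sigmaNorm (hM : IsWeightSequence M) (d : ℕ) :
    ∃ c : ℝ, 0 < c ∧ ∀ m : ℝ, 0 < m → ∃ K : ℝ, 0 < K ∧ ∀ φ : RSp d → ℂ, ContDiff ℝ ∞ φ →
      ∀ q : ℝ, 0 ≤ q → sigmaNorm M m φ ≤ ENNReal.ofReal q → DecayBound M (c * m) (K * q) φ := by
  obtain ⟨H, hH, hshift⟩ := hM.exists_shift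
  choose D hD hshift using hshift
  obtain ⟨C₁, hC₁, hsob⟩ := exists_local_sobolev d
  have hH0 : 0 < H := by linarith
  -- The 2 pays for comparing ⟨x⟩ with ⟨y⟩ on the unit ball about x, H for lowering the index n + j
  -- to n, and d + 1 for the factors d^n, with d = 0 allowed.
  refine ⟨1 / (2 * (H * (d + 1))), by positivity, fun m hm => ?_⟩
  obtain ⟨C, hC, hL2⟩ := hM.exists_lintegral_le (d := d) hm
  set V : ℝ := volume.real (Metric.closedBall (0 : RSp d) 1) with hV
  have hV0 : 0 ≤ V := measureReal_nonneg
  set K₀ : ℝ := ∑ j ∈ Finset.range (d + 2), (m ^ j)⁻¹ * D j * ((V + 1) * C * (d + 1) ^ j) with hK₀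
  have hK₀' : 0 ≤ K₀ := Finset.sum_nonneg fun j _ => by have := hD j; positivity
  refine ⟨C₁ * K₀ + 1, by positivity, fun φ hφ q hq hσ n k x => ?_⟩
  have hMn := hM.pos n
  have hMk := hM.pos k
  have hjx := jb_pos x
  have hterm : ∀ j, m ^ (n + k) * jb x ^ k *
      ∫ y in Metric.closedBall x 1, ‖iteratedFDeriv ℝ (n + j) φ y‖ ≤
      2 ^ k * (H * (d + 1)) ^ n * ((m ^ j)⁻¹ * D j * ((V + 1) * C * (d + 1) ^ j)) * q *
        (M n * M k) := fun j => by
    have hMj := hM.pos (n + j)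
    have hDj := hD j
    have hint := setIntegral_iteratedFDeriv_le hφ hm (A := M (n + j) * M k)
      (Q := C * d ^ (n + j) * q) (by positivity) (by positivity) (n + j) k
      (hL2 φ hφ q hq hσ (n + j) k) x
    have hQ : C * (d : ℝ) ^ (n + j) * q ≤ C * (d + 1) ^ (n + j) * q := by gcongr; linarith
    have hs := hshift j n
    rw [← hV] at hint
    generalize ∫ y in Metric.closedBall x 1, ‖iteratedFDeriv ℝ (n + j) φ y‖ = I at hint ⊢
    calc m ^ (n + k) * jb x ^ k * I = (m ^ j)⁻¹ * (m ^ (n + j + k) * jb x ^ k * I) := by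
          rw [pow_add, pow_add, pow_add]; field_simp
      _ ≤ (m ^ j)⁻¹ * (2 ^ k * (M (n + j) * M k) * ((V + 1) * (C * d ^ (n + j) * q))) := by gcongr
      _ ≤ (m ^ j)⁻¹ * (2 ^ k * ((D j * H ^ n * M n) * M k) *
          ((V + 1) * (C * (d + 1) ^ (n + j) * q))) := by gcongr
      _ = _ := by rw [mul_pow, pow_add]; ring
  have hx := hsob (iteratedFDeriv ℝ n φ) (hφ.iteratedFDeriv_right (m := ∞) (i := n) (by exact_mod_cast le_top)) x
  simp_rw [norm_iteratedFDeriv_iteratedFDeriv] at hx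
  have hpow : (1 / (2 * (H * (d + 1))) * m) ^ (n + k) * (2 ^ k * (H * (d + 1)) ^ n) ≤
      m ^ (n + k) := by
    have h1 : (1 : ℝ) ≤ 2 ^ n := one_le_pow₀ (by norm_num)
    have h2 : (1 : ℝ) ≤ (H * (d + 1)) ^ k := one_le_pow₀ (by
      have : (0 : ℝ) ≤ d := d.cast_nonneg
      nlinarith)
    have e : (1 / (2 * (H * ((d : ℝ) + 1))) * m) ^ (n + k) =
        m ^ (n + k) / (2 ^ (n + k) * (H * (d + 1)) ^ (n + k)) := by
      rw [one_div_mul_eq_div, div_pow, mul_pow 2]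
    rw [e, div_mul_eq_mul_div, div_le_iff₀ (by positivity)]
    have : (2 : ℝ) ^ k * (H * (d + 1)) ^ n ≤ 2 ^ (n + k) * (H * (d + 1)) ^ (n + k) := by
      rw [pow_add, pow_add]
      calc (2 : ℝ) ^ k * (H * (d + 1)) ^ n = 1 * 2 ^ k * ((H * (d + 1)) ^ n * 1) := by ring
        _ ≤ _ := by gcongr
    gcongr
  calc (1 / (2 * (H * (d + 1))) * m) ^ (n + k) * jb x ^ k * ‖iteratedFDeriv ℝ n φ x‖
      ≤ (1 / (2 * (H * (d + 1))) * m) ^ (n + k) * jb x ^ k * (C₁ * ∑ j ∈ Finset.range (d + 2),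
        ∫ y in Metric.closedBall x 1, ‖iteratedFDeriv ℝ (n + j) φ y‖) := by gcongr
    _ = C₁ * ((1 / (2 * (H * (d + 1))) * m) ^ (n + k) / m ^ (n + k)) *
        ∑ j ∈ Finset.range (d + 2), (m ^ (n + k) * jb x ^ k *
        ∫ y in Metric.closedBall x 1, ‖iteratedFDeriv ℝ (n + j) φ y‖) := by
        rw [← Finset.mul_sum]; field_simp
    _ ≤ C₁ * ((1 / (2 * (H * (d + 1))) * m) ^ (n + k) / m ^ (n + k)) *
        ∑ j ∈ Finset.range (d + 2), (2 ^ k * (H * (d + 1)) ^ n *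
          ((m ^ j)⁻¹ * D j * ((V + 1) * C * (d + 1) ^ j)) * q * (M n * M k)) := by
        refine mul_le_mul_of_nonneg_left (Finset.sum_le_sum fun j _ => hterm j) (by positivity)
    _ = ((1 / (2 * (H * (d + 1))) * m) ^ (n + k) * (2 ^ k * (H * (d + 1)) ^ n) / m ^ (n + k)) *
        (C₁ * K₀ * q * (M n * M k)) := by
        rw [← Finset.sum_mul, ← Finset.sum_mul, ← Finset.mul_sum]; ring
    _ ≤ 1 * (C₁ * K₀ * q * (M n * M k)) := by
        gcongr
        rw [div_le_one (by positivity)]; exact hpow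
    _ ≤ _ := by
        rw [one_mul]; gcongr; linarith

lemma tsum_pow_miLen_lt_top (d : ℕ) {q : ℝ≥0∞} (hq : q < 1) :
    ∑' α : Fin d → ℕ, q ^ miLen α < ⊤ := by
  induction d with
  | zero => simp [miLen]
  | succ d ih =>
    rw [← (Fin.consEquiv fun _ => ℕ).tsum_eq, ENNReal.tsum_prod']
    have : ∀ (a : ℕ) (α : Fin d → ℕ),
        q ^ miLen ((Fin.consEquiv fun _ => ℕ) (a, α)) = q ^ a * q ^ miLen α := fun a α => by
      simp [miLen, Fin.sum_univ_succ, pow_add]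
    simp_rw [this, ENNReal.tsum_mul_left, ENNReal.tsum_mul_right, ENNReal.tsum_geometric]
    refine ENNReal.mul_lt_top ?_ ih
    simpa using hq

/-- The sup norms dominate the `L²` norms `σ_{m,2}`. -/
lemma IsWeightSequence.exists_sigmaNorm_le_of_decayBound (hM : IsWeightSequence M) (d : ℕ) :
    ∃ c : ℝ, 0 < c ∧ ∀ m : ℝ, 0 < m → ∃ K : ℝ, 0 < K ∧ ∀ φ : RSp d → ℂ,
      ∀ A : ℝ, 0 ≤ A → DecayBound M m A φ → sigmaNorm M (c * m) φ ≤ ENNReal.ofReal (K * A) := by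
  obtain ⟨H, hH, hshift⟩ := hM.exists_shift
  obtain ⟨D, hD, hshift⟩ := hshift (d + 1)
  have hH0 : 0 < H := by linarith
  -- Spending d + 1 extra powers of ⟨x⟩ makes the integrals finite, and H absorbs the resulting
  -- shift of index. The 2 makes the sums over α and β geometric, with ratio 1/4 after squaring.
  refine ⟨1 / (2 * H), by positivity, fun m hm => ?_⟩
  set q : ℝ≥0∞ := ENNReal.ofReal (1 / 4) with hq
  have hq1 : q < 1 := by
    rw [hq, ENNReal.ofReal_lt_one]; norm_num
  set N : ℝ≥0∞ := ∑' α : Fin d → ℕ, q ^ miLen α with hN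
  have hN' : N < ⊤ := tsum_pow_miLen_lt_top d hq1
  set J : ℝ≥0∞ := ∫⁻ x : RSp d, ENNReal.ofReal ((jb x ^ (d + 1))⁻¹) ^ 2 with hJ
  have hJ' : J < ⊤ := by
    have hint : Integrable (fun x : RSp d => ((1 : ℝ) + ‖x‖ ^ 2) ^ (-((d + 1 : ℕ) : ℝ) / 2)) :=
      integrable_rpow_neg_one_add_norm_sq (by simp)
    refine lt_of_le_of_lt ?_ hint.lintegral_lt_top
    refine lintegral_mono fun x => ?_
    rw [← ENNReal.ofReal_pow (by have := jb_pos x; positivity)]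
    refine ENNReal.ofReal_le_ofReal ?_
    have hj := one_le_jb x
    have e : ((1 : ℝ) + ‖x‖ ^ 2) ^ (-((d + 1 : ℕ) : ℝ) / 2) = (jb x ^ (d + 1))⁻¹ := by
      rw [jb, Real.sqrt_eq_rpow, ← Real.rpow_natCast _ (d + 1), ← Real.rpow_mul (by positivity),
        ← Real.rpow_neg (by positivity)]
      congr 1; ring
    rw [e]
    have h0 : 0 ≤ (jb x ^ (d + 1))⁻¹ := by positivity
    have h1 : (jb x ^ (d + 1))⁻¹ ≤ 1 := inv_le_one_of_one_le₀ (one_le_pow₀ hj)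
    nlinarith
  set E : ℝ := D / m ^ (d + 1) with hE
  have hE0 : 0 < E := by positivity
  set K : ℝ := E * √((N * N * J).toReal) + 1 with hK
  refine ⟨K, by positivity, fun φ A hA hφ => ?_⟩
  have hpt : ∀ (α β : Fin d → ℕ) (x : RSp d),
      (1 / (2 * H) * m) ^ (miLen α + miLen β) * jb x ^ miLen α * ‖partialD β φ x‖ /
        (M (miLen α) * M (miLen β)) ≤
      E * A * (1 / 2) ^ (miLen α + miLen β) * (jb x ^ (d + 1))⁻¹ := fun α β x => by
    have hMa := hM.pos (miLen α)
    have hMb := hM.pos (miLen β)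
    have hj := jb_pos x
    have h1 := hφ (miLen β) (miLen α + (d + 1)) x
    have h2 := hshift (miLen α)
    generalize miLen α = a at *
    rw [div_le_iff₀ (by positivity)]
    have hb := norm_partialD_le β φ x
    generalize miLen β = b at *
    have hHb : 1 ≤ H ^ b := one_le_pow₀ hH
    calc (1 / (2 * H) * m) ^ (a + b) * jb x ^ a * ‖partialD β φ x‖
        ≤ (1 / (2 * H) * m) ^ (a + b) * jb x ^ a * ‖iteratedFDeriv ℝ b φ x‖ := by gcongr
      _ = (1 / (2 * H)) ^ (a + b) / m ^ (d + 1) * (jb x ^ (d + 1))⁻¹ *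
          (m ^ (b + (a + (d + 1))) * jb x ^ (a + (d + 1)) * ‖iteratedFDeriv ℝ b φ x‖) := by
          rw [mul_pow]; field_simp; ring
      _ ≤ (1 / (2 * H)) ^ (a + b) / m ^ (d + 1) * (jb x ^ (d + 1))⁻¹ *
          (A * (M b * (D * H ^ a * M a))) := by
          refine mul_le_mul_of_nonneg_left (h1.trans ?_) (by positivity)
          gcongr
      _ = (1 / 2) ^ (a + b) * E * A * (jb x ^ (d + 1))⁻¹ * (M a * M b) * (H ^ b)⁻¹ := by
          rw [hE, div_pow, div_pow, mul_pow, one_pow, pow_add H]; field_simp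
      _ ≤ (1 / 2) ^ (a + b) * E * A * (jb x ^ (d + 1))⁻¹ * (M a * M b) * 1 := by
          gcongr
          exact inv_le_one_of_one_le₀ hHb
      _ = _ := by ring
  have hsum : ∑' (α : Fin d → ℕ) (β : Fin d → ℕ), ∫⁻ x : RSp d,
      ENNReal.ofReal ((1 / (2 * H) * m) ^ (miLen α + miLen β) * √(1 + ‖x‖ ^ 2) ^ miLen α *
        ‖partialD β φ x‖ / (M (miLen α) * M (miLen β))) ^ 2 ≤
      ENNReal.ofReal ((E * A) ^ 2) * (N * N * J) := by
    calc _ ≤ ∑' (α : Fin d → ℕ) (β : Fin d → ℕ), ENNReal.ofReal ((E * A) ^ 2) *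
          (q ^ miLen α * q ^ miLen β * J) := by
          refine ENNReal.tsum_le_tsum fun α => ENNReal.tsum_le_tsum fun β => ?_
          rw [hJ, ← lintegral_const_mul' _ _ (by finiteness), ← lintegral_const_mul' _ _ (by finiteness)]
          refine lintegral_mono fun x => ?_
          have hj := jb_pos x
          refine (pow_le_pow_left₀ (zero_le) (ENNReal.ofReal_le_ofReal (hpt α β x)) 2).trans ?_
          rw [hq, ← ENNReal.ofReal_pow (by positivity), ← ENNReal.ofReal_pow (by positivity),
            ← ENNReal.ofReal_pow (by positivity), ← ENNReal.ofReal_pow (by positivity),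
            ← ENNReal.ofReal_mul (by positivity), ← ENNReal.ofReal_mul (by positivity),
            ← ENNReal.ofReal_mul (by positivity)]
          refine ENNReal.ofReal_le_ofReal (le_of_eq ?_)
          rw [show (1 / 4 : ℝ) = (1 / 2) ^ 2 by norm_num, ← pow_mul, ← pow_mul, pow_add]
          ring
      _ = _ := by
          simp_rw [ENNReal.tsum_mul_left, ENNReal.tsum_mul_right, ENNReal.tsum_mul_left,
            ENNReal.tsum_mul_right]
          rfl
  rw [sigmaNorm]
  refine (ENNReal.rpow_le_rpow hsum (by norm_num)).trans ?_
  have hfin : N * N * J ≠ ⊤ := by finiteness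
  rw [← ENNReal.ofReal_toReal hfin, ← ENNReal.ofReal_mul (by positivity),
    ENNReal.ofReal_rpow_of_nonneg (by positivity) (by norm_num), ← Real.sqrt_eq_rpow,
    Real.sqrt_mul (by positivity), Real.sqrt_sq (by positivity)]
  refine ENNReal.ofReal_le_ofReal ?_
  rw [hK]
  nlinarith

end

/-! ### Test spaces in terms of sup norms -/

/-- The quantifier over parameters that defines the test spaces: `∀ m > 0` in the Beurling case,
`∃ m > 0` in the Roumieu case. -/
def UltraType.forTest (P : ℝ → Prop) : UltraType → Prop
  | .beurling => ∀ m : ℝ, 0 < m → P m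
  | .roumieu => ∃ m : ℝ, 0 < m ∧ P m

/-- The quantifier over parameters that defines continuity of functionals: `∃ m > 0` in the
Beurling case, `∀ m > 0` in the Roumieu case. -/
def UltraType.forDual (P : ℝ → Prop) : UltraType → Prop
  | .beurling => ∃ m : ℝ, 0 < m ∧ P m
  | .roumieu => ∀ m : ℝ, 0 < m → P m

/-- Both test-space quantifiers are invariant under rescaling of the parameter, so that an estimate
may always lose a constant factor in m. This is what allows the two cases to be treated together. -/
lemma UltraType.forTest.scale {t : UltraType} {P Q : ℝ → Prop} (hP : t.forTest P) {c : ℝ}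
    (hc : 0 < c) (h : ∀ m : ℝ, 0 < m → P m → Q (c * m)) : t.forTest Q := by
  cases t with
  | beurling =>
    intro m hm
    have := h (m / c) (by positivity) (hP _ (by positivity))
    rwa [mul_div_cancel₀ _ hc.ne'] at this
  | roumieu =>
    obtain ⟨m, hm, hPm⟩ := hP
    exact ⟨c * m, by positivity, h m hm hPm⟩

lemma UltraType.forDual.scale {t : UltraType} {P Q : ℝ → Prop} (hP : t.forDual P) {c : ℝ}
    (hc : 0 < c) (h : ∀ m : ℝ, 0 < m → P m → Q (c * m)) : t.forDual Q := by
  cases t with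
  | roumieu =>
    intro m hm
    have := h (m / c) (by positivity) (hP _ (by positivity))
    rwa [mul_div_cancel₀ _ hc.ne'] at this
  | beurling =>
    obtain ⟨m, hm, hPm⟩ := hP
    exact ⟨c * m, by positivity, h m hm hPm⟩

lemma UltraType.forTest.mono {t : UltraType} {P Q : ℝ → Prop} (hP : t.forTest P)
    (h : ∀ m : ℝ, 0 < m → P m → Q m) : t.forTest Q :=
  hP.scale one_pos (by simpa using h)

lemma UltraType.forTest.and {t : UltraType} {P Q : ℝ → Prop} (hP : t.forTest P)
    (hQ : t.forTest Q) (hP' : ∀ m m' : ℝ, 0 < m' → m' ≤ m → P m → P m')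
    (hQ' : ∀ m m' : ℝ, 0 < m' → m' ≤ m → Q m → Q m') : t.forTest fun m => P m ∧ Q m := by
  cases t with
  | beurling => exact fun m hm => ⟨hP m hm, hQ m hm⟩
  | roumieu =>
    obtain ⟨m, hm, hPm⟩ := hP
    obtain ⟨m', hm', hQm⟩ := hQ
    have : 0 < min m m' := lt_min hm hm'
    exact ⟨min m m', this, hP' _ _ this (min_le_left _ _) hPm, hQ' _ _ this (min_le_right _ _) hQm⟩

lemma UltraType.forTest_of_forall {t : UltraType} {P : ℝ → Prop} (h : ∀ m : ℝ, 0 < m → P m) :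
    t.forTest P := by
  cases t with
  | beurling => exact h
  | roumieu => exact ⟨1, one_pos, h 1 one_pos⟩

/-- A parameter serving for a test function and for a functional at the same time. -/
lemma UltraType.exists_of_forTest_of_forDual {t : UltraType} {P Q : ℝ → Prop} (hP : t.forTest P)
    (hQ : t.forDual Q) : ∃ m : ℝ, 0 < m ∧ P m ∧ Q m := by
  cases t with
  | beurling =>
    obtain ⟨m, hm, h⟩ := hQ
    exact ⟨m, hm, hP m hm, h⟩
  | roumieu =>
    obtain ⟨m, hm, h⟩ := hP
    exact ⟨m, hm, h, hQ m hm⟩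

section

variable {d : ℕ} {M : ℕ → ℝ}

/-- Bounds `‖D^n f‖ ≤ A h^n M_n`, uniform in the point. -/
def DerivBound (M : ℕ → ℝ) (h A : ℝ) (f : RSp d → ℂ) : Prop :=
  ∀ (n : ℕ) (x : RSp d), ‖iteratedFDeriv ℝ n f x‖ ≤ A * h ^ n * M n

lemma DecayBound.nonneg (hM : IsWeightSequence M) {m A : ℝ} {φ : RSp d → ℂ}
    (h : DecayBound M m A φ) : 0 ≤ A := by
  have := h 0 0 0
  simp only [hM.zero, add_zero, pow_zero, one_mul, mul_one, norm_iteratedFDeriv_zero] at this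
  exact (norm_nonneg _).trans this

lemma DecayBound.anti {m m' A : ℝ} {φ : RSp d → ℂ}
    (h : DecayBound M m A φ) (hm : 0 < m') (hmm : m' ≤ m) : DecayBound M m' A φ := fun n k x => by
  refine le_trans ?_ (h n k x)
  have := jb_pos x
  gcongr

lemma DecayBound.mono (hM : IsWeightSequence M) {m A A' : ℝ} {φ : RSp d → ℂ}
    (h : DecayBound M m A φ) (hA : A ≤ A') : DecayBound M m A' φ := fun n k x => by
  have := hM.pos n; have := hM.pos k
  exact (h n k x).trans (by gcongr)

lemma DecayBound.add {m A B : ℝ} {φ ψ : RSp d → ℂ} (hm : 0 < m) (hφ : ContDiff ℝ ∞ φ)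
    (hψ : ContDiff ℝ ∞ ψ) (h : DecayBound M m A φ) (h' : DecayBound M m B ψ) :
    DecayBound M m (A + B) (φ + ψ) := fun n k x => by
  rw [iteratedFDeriv_add_apply (hφ.contDiffAt.of_le (by exact_mod_cast le_top))
    (hψ.contDiffAt.of_le (by exact_mod_cast le_top)), add_mul]
  refine le_trans ?_ (add_le_add (h n k x) (h' n k x))
  rw [← mul_add]
  have := jb_pos x
  gcongr
  exact norm_add_le _ _

lemma DecayBound.smul {m A : ℝ} {φ : RSp d → ℂ} (hφ : ContDiff ℝ ∞ φ) (a : ℂ)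
    (h : DecayBound M m A φ) : DecayBound M m (‖a‖ * A) (a • φ) := fun n k x => by
  rw [iteratedFDeriv_const_smul_apply (hφ.contDiffAt.of_le (by exact_mod_cast le_top)), norm_smul]
  have := mul_le_mul_of_nonneg_left (h n k x) (norm_nonneg a)
  linarith

lemma DecayBound.derivBound (hM : IsWeightSequence M) {m A : ℝ} {φ : RSp d → ℂ} (hm : 0 < m)
    (h : DecayBound M m A φ) : DerivBound M m⁻¹ A φ := fun n x => by
  have h1 := h n 0 x
  simp only [add_zero, pow_zero, mul_one, hM.zero] at h1
  rw [inv_pow, ← div_eq_mul_inv, div_mul_eq_mul_div, le_div_iff₀ (by positivity)]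
  linarith

lemma DerivBound.anti (hM : IsWeightSequence M) {m m' A : ℝ} {φ : RSp d → ℂ}
    (h : DerivBound M m⁻¹ A φ) (hm : 0 < m') (hmm : m' ≤ m) : DerivBound M m'⁻¹ A φ :=
  fun n x => by
  have hA : 0 ≤ A := by simpa [hM.zero] using (norm_nonneg _).trans (h 0 x)
  have := hM.pos n
  have : 0 < m := hm.trans_le hmm
  refine (h n x).trans ?_
  gcongr

lemma DerivBound.add {m A B : ℝ} {φ ψ : RSp d → ℂ} (hφ : ContDiff ℝ ∞ φ)
    (hψ : ContDiff ℝ ∞ ψ) (h : DerivBound M m A φ) (h' : DerivBound M m B ψ) :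
    DerivBound M m (A + B) (φ + ψ) := fun n x => by
  rw [iteratedFDeriv_add_apply (hφ.contDiffAt.of_le (by exact_mod_cast le_top))
    (hψ.contDiffAt.of_le (by exact_mod_cast le_top))]
  refine (norm_add_le _ _).trans ((add_le_add (h n x) (h' n x)).trans (le_of_eq ?_))
  ring

/-- Products with a multiplier whose derivatives may grow like `⟨x⟩^j`. -/
lemma DecayBound.mul (hM : IsWeightSequence M) {m A B : ℝ} (hm : 0 < m) {f φ : RSp d → ℂ}
    (hf : ContDiff ℝ ∞ f) (hφ : ContDiff ℝ ∞ φ) (j : ℕ) {H D : ℝ} (hH : 1 ≤ H) (hD : 0 < D)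
    (hshift : ∀ n, M (n + j) ≤ D * H ^ n * M n)
    (h1 : ∀ n x, ‖iteratedFDeriv ℝ n f x‖ ≤ A * jb x ^ j * m⁻¹ ^ n * M n)
    (h2 : DecayBound M m B φ) :
    DecayBound M (m / (2 * H)) (A * B * (D / m ^ j)) fun x => f x * φ x := fun n k x => by
  have hjx := jb_pos x
  have hMk := hM.pos k
  have hMkj := hM.pos (k + j)
  have hMn := hM.pos n
  have hH0 : 0 < H := by linarith
  have hA : 0 ≤ A := by
    have := (norm_nonneg _).trans (h1 0 x)
    simp only [pow_zero, mul_one, hM.zero] at this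
    exact nonneg_of_mul_nonneg_left this (by positivity)
  have hB := h2.nonneg hM
  -- The decay of φ is used with k + j powers of the weight: the j additional ones cancel the growth
  -- of f.
  have h3 : ∀ n, ‖iteratedFDeriv ℝ n φ x‖ ≤
      (B * M (k + j) / (m ^ (k + j) * jb x ^ (k + j))) * m⁻¹ ^ n * M n := fun n => by
    have := h2 n (k + j) x
    rw [pow_add] at this
    have e : (B * M (k + j) / (m ^ (k + j) * jb x ^ (k + j))) * m⁻¹ ^ n * M n =
        B * (M n * M (k + j)) / (m ^ n * m ^ (k + j) * jb x ^ (k + j)) := by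
      rw [inv_pow]; field_simp
    rw [e, le_div_iff₀ (by positivity)]
    linarith
  have h4 := hM.norm_iteratedFDeriv_mul_le hf hφ (by positivity) (by positivity)
    (fun n => h1 n x) h3 n
  have hHn : 1 ≤ H ^ n := one_le_pow₀ hH
  calc (m / (2 * H)) ^ (n + k) * jb x ^ k * ‖iteratedFDeriv ℝ n (fun x => f x * φ x) x‖
      ≤ (m / (2 * H)) ^ (n + k) * jb x ^ k * (A * jb x ^ j *
        (B * M (k + j) / (m ^ (k + j) * jb x ^ (k + j))) * (m⁻¹ + m⁻¹) ^ n * M n) := by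
        gcongr
    _ = A * B * (M (k + j) / m ^ j) * M n * ((1 / 2) ^ k * (H ^ (n + k))⁻¹) := by
        rw [← two_mul, mul_pow, inv_pow, div_pow, mul_pow, pow_add, pow_add, pow_add, pow_add,
          div_pow]
        field_simp
        ring
    _ ≤ A * B * ((D * H ^ k * M k) / m ^ j) * M n * (1 * (H ^ (n + k))⁻¹) := by
        gcongr
        · exact hshift k
        · exact pow_le_one₀ (by norm_num) (by norm_num)
    _ = A * B * (D / m ^ j) * (M n * M k) * (H ^ n)⁻¹ := by
        rw [pow_add]; field_simp
    _ ≤ A * B * (D / m ^ j) * (M n * M k) * 1 := by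
        gcongr
        exact inv_le_one_of_one_le₀ hHn
    _ = _ := mul_one _

lemma DerivBound.mul_decayBound (hM : IsWeightSequence M) {m A B : ℝ} (hm : 0 < m)
    {f φ : RSp d → ℂ} (hf : ContDiff ℝ ∞ f) (hφ : ContDiff ℝ ∞ φ)
    (h1 : DerivBound M m⁻¹ A f) (h2 : DecayBound M m B φ) :
    DecayBound M (1 / 2 * m) (A * B) fun x => f x * φ x := by
  have := DecayBound.mul hM hm hf hφ 0 le_rfl one_pos (by simp)
    (fun n x => by simpa using h1 n x) h2
  simpa [div_eq_inv_mul] using this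

/-- The two kinds of norms dominate each other after rescaling m, which the quantifier absorbs. From
here on 𝒮^* is handled through sup norms only. -/
lemma IsWeightSequence.mem_spaceS_iff (hM : IsWeightSequence M) {t : UltraType}
    {φ : RSp d → ℂ} : φ ∈ spaceS d M t ↔
      ContDiff ℝ ∞ φ ∧ t.forTest fun m => ∃ A, DecayBound M m A φ := by
  obtain ⟨c, hc, h1⟩ := hM.exists_decayBound_of_sigmaNorm d
  obtain ⟨c', hc', h2⟩ := hM.exists_sigmaNorm_le_of_decayBound d
  have hS : φ ∈ spaceS d M t ↔ t.forTest fun m => φ ∈ spaceSm d M m := by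
    cases t <;> rfl
  rw [hS]
  constructor
  · intro h
    refine ⟨?_, h.scale hc fun m hm hφ => ?_⟩
    · cases t with
      | beurling => exact (h 1 one_pos).1
      | roumieu => obtain ⟨m, _, h⟩ := h; exact h.1
    · obtain ⟨K, -, hK⟩ := h1 m hm
      exact ⟨_, hK φ hφ.1 (sigmaNorm M m φ).toReal ENNReal.toReal_nonneg
        (ENNReal.ofReal_toReal hφ.2.ne).ge⟩
  · rintro ⟨hφ, h⟩
    refine h.scale hc' fun m hm ⟨A, hA⟩ => ⟨hφ, ?_⟩
    obtain ⟨K, -, hK⟩ := h2 m hm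
    exact (hK φ A (hA.nonneg hM) hA).trans_lt ENNReal.ofReal_lt_top

/-- Boundedness of a functional with respect to the sup norm with parameter `m`. -/
def BoundedFor (d : ℕ) (M : ℕ → ℝ) (t : UltraType) (S : (RSp d → ℂ) → ℂ) (m : ℝ) : Prop :=
  ∃ C : ℝ, 0 ≤ C ∧ ∀ φ ∈ spaceS d M t, ∀ A, DecayBound M m A φ → ‖S φ‖ ≤ C * A

lemma IsWeightSequence.continuousOnS_iff (hM : IsWeightSequence M) {t : UltraType}
    {S : (RSp d → ℂ) → ℂ} : ContinuousOnS d M S t ↔ t.forDual (BoundedFor d M t S) := by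
  obtain ⟨c, hc, h1⟩ := hM.exists_decayBound_of_sigmaNorm d
  obtain ⟨c', hc', h2⟩ := hM.exists_sigmaNorm_le_of_decayBound d
  -- A common form of the two definitions: in the Beurling case membership in every step is
  -- automatic, and in the Roumieu case membership in one step suffices for 𝒮^*.
  have hS : ContinuousOnS d M S t ↔ t.forDual fun m => ∃ C : ℝ≥0,
      ∀ φ ∈ spaceS d M t, φ ∈ spaceSm d M m → ‖S φ‖ₑ ≤ C * sigmaNorm M m φ := by
    cases t with
    | beurling =>
      refine exists_congr fun m => and_congr_right fun hm => exists_congr fun C => ?_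
      exact forall₂_congr fun φ hφ => ⟨fun h _ => h, fun h => h (hφ m hm)⟩
    | roumieu =>
      refine forall₂_congr fun m hm => exists_congr fun C => ?_
      exact ⟨fun h φ _ hφ => h φ hφ, fun h φ hφ => h φ ⟨m, hm, hφ⟩ hφ⟩
  rw [hS]
  constructor
  · intro h
    refine h.scale (c := c'⁻¹) (by positivity) fun m hm ⟨C, hC⟩ => ?_
    obtain ⟨K, hK0, hK⟩ := h2 (c'⁻¹ * m) (by positivity)
    rw [mul_inv_cancel_left₀ hc'.ne'] at hK
    refine ⟨C * K, by positivity, fun φ hφ A hA => ?_⟩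
    have h3 := hK φ A (hA.nonneg hM) hA
    have h4 := (hC φ hφ ⟨(hM.mem_spaceS_iff.1 hφ).1, h3.trans_lt ENNReal.ofReal_lt_top⟩).trans
      (mul_le_mul_right h3 _)
    rw [← ofReal_norm, ← ENNReal.ofReal_coe_nnreal, ← ENNReal.ofReal_mul (by positivity),
      ENNReal.ofReal_le_ofReal_iff
        (by have := hA.nonneg hM; positivity)] at h4
    linarith
  · intro h
    refine h.scale (c := c⁻¹) (by positivity) fun m hm ⟨C, hC0, hC⟩ => ?_
    obtain ⟨K, hK0, hK⟩ := h1 (c⁻¹ * m) (by positivity)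
    rw [mul_inv_cancel_left₀ hc.ne'] at hK
    refine ⟨(C * K).toNNReal, fun φ hφ hφm => ?_⟩
    have h3 := hC φ hφ _ (hK φ hφm.1 (sigmaNorm M (c⁻¹ * m) φ).toReal ENNReal.toReal_nonneg
      (ENNReal.ofReal_toReal hφm.2.ne).ge)
    rw [← ENNReal.ofReal_toReal hφm.2.ne, ← ofReal_norm]
    change _ ≤ ENNReal.ofReal (C * K) * _
    rw [← ENNReal.ofReal_mul (by positivity)]
    refine ENNReal.ofReal_le_ofReal ?_
    rw [← mul_assoc] at h3
    exact h3

lemma IsWeightSequence.add_mem_spaceS (hM : IsWeightSequence M) {t : UltraType}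
    {φ ψ : RSp d → ℂ} (hφ : φ ∈ spaceS d M t) (hψ : ψ ∈ spaceS d M t) :
    φ + ψ ∈ spaceS d M t := by
  rw [hM.mem_spaceS_iff] at hφ hψ ⊢
  refine ⟨hφ.1.add hψ.1, ((hφ.2.and hψ.2 ?_ ?_).mono ?_)⟩
  · rintro m m' hm hmm ⟨A, hA⟩; exact ⟨A, hA.anti hm hmm⟩
  · rintro m m' hm hmm ⟨A, hA⟩; exact ⟨A, hA.anti hm hmm⟩
  · rintro m hm ⟨⟨A, hA⟩, B, hB⟩; exact ⟨_, hA.add hm hφ.1 hψ.1 hB⟩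

lemma IsWeightSequence.smul_mem_spaceS (hM : IsWeightSequence M) {t : UltraType}
    {φ : RSp d → ℂ} (a : ℂ) (hφ : φ ∈ spaceS d M t) : a • φ ∈ spaceS d M t := by
  rw [hM.mem_spaceS_iff] at hφ ⊢
  refine ⟨contDiff_const.smul hφ.1, hφ.2.mono ?_⟩
  rintro m hm ⟨A, hA⟩; exact ⟨_, hA.smul hφ.1 a⟩

lemma IsWeightSequence.mul_mem_spaceS (hM : IsWeightSequence M) {t : UltraType}
    {f φ : RSp d → ℂ} (hf : ContDiff ℝ ∞ f) (hf' : ∀ m : ℝ, 0 < m → ∃ A, DerivBound M m⁻¹ A f)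
    (hφ : φ ∈ spaceS d M t) : (fun x => f x * φ x) ∈ spaceS d M t := by
  rw [hM.mem_spaceS_iff] at hφ ⊢
  refine ⟨hf.mul hφ.1, hφ.2.scale (c := 1 / 2) (by norm_num) ?_⟩
  rintro m hm ⟨B, hB⟩
  obtain ⟨A, hA⟩ := hf' m hm
  exact ⟨_, hA.mul_decayBound hM hm hf hφ.1 hB⟩

lemma partialD_eq_zero {φ : RSp d → ℂ} {x : RSp d} (hx : x ∉ tsupport φ) (α : Fin d → ℕ) :
    partialD α φ x = 0 := by
  rw [partialD, image_eq_zero_of_notMem_tsupport fun h =>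
    hx (tsupport_iteratedFDeriv_subset (𝕜 := ℝ) (f := φ) _ h)]
  rfl

lemma IsWeightSequence.mem_spaceD_iff (hM : IsWeightSequence M) {t : UltraType}
    {φ : RSp d → ℂ} : φ ∈ spaceD d M t ↔ ContDiff ℝ ∞ φ ∧ HasCompactSupport φ ∧
      t.forTest fun m => ∃ A, DerivBound M m⁻¹ A φ := by
  have hDK : ∀ K : Set (RSp d), φ ∈ spaceDK M K t ↔
      t.forTest fun m => φ ∈ spaceDKh M K m⁻¹ := fun K => by
    cases t with
    | beurling =>
      exact ⟨fun h m hm => h _ (inv_pos.2 hm), fun h m hm => by simpa using h _ (inv_pos.2 hm)⟩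
    | roumieu =>
      exact ⟨fun ⟨m, hm, h⟩ => ⟨m⁻¹, inv_pos.2 hm, by simpa using h⟩,
        fun ⟨m, hm, h⟩ => ⟨m⁻¹, inv_pos.2 hm, h⟩⟩
  have hdef : φ ∈ spaceD d M t ↔ ∃ K : Set (RSp d), IsCompact K ∧ φ ∈ spaceDK M K t := Iff.rfl
  simp only [hdef, hDK]
  constructor
  · rintro ⟨K, hK, h⟩
    have hex : ∃ m, φ ∈ spaceDKh M K m := by
      cases t with
      | beurling => exact ⟨_, h 1 one_pos⟩
      | roumieu => obtain ⟨m, _, h⟩ := h; exact ⟨_, h⟩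
    obtain ⟨m₀, hm₀⟩ := hex
    have hφ := hm₀.1
    -- Shrinking the parameter by d + 1 absorbs the factor d^n between partial derivatives and
    -- operator norms.
    refine ⟨hφ, hK.of_isClosed_subset (isClosed_tsupport _) hm₀.2.1,
      h.scale (c := 1 / (d + 1)) (by positivity) ?_⟩
    rintro m hm ⟨-, hsupp, hfin⟩
    refine ⟨(normD M K m⁻¹ φ).toReal, fun n x => ?_⟩
    have hMn := hM.pos n
    have hB : ∀ β : Fin d → ℕ, miLen β = n →
        ‖partialD β φ x‖ ≤ (normD M K m⁻¹ φ).toReal * m⁻¹ ^ n * M n := fun β hβ => by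
      by_cases hx : x ∈ tsupport φ
      · have h1 : ENNReal.ofReal (‖partialD β φ x‖ / (m⁻¹ ^ miLen β * M (miLen β))) ≤
            normD M K m⁻¹ φ := le_iSup_of_le β (le_iSup₂_of_le x (hsupp hx) le_rfl)
        rw [hβ, ENNReal.ofReal_le_iff_le_toReal hfin.ne, div_le_iff₀ (by positivity)] at h1
        linarith
      · rw [partialD_eq_zero hx, norm_zero]; positivity
    refine (norm_iteratedFDeriv_le_of_partialD hφ (by positivity) hB).trans ?_
    rw [one_div_mul_eq_div, inv_div, div_pow, inv_pow]
    calc (d : ℝ) ^ n * ((normD M K m⁻¹ φ).toReal * (m ^ n)⁻¹ * M n)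
        ≤ (d + 1 : ℝ) ^ n * ((normD M K m⁻¹ φ).toReal * (m ^ n)⁻¹ * M n) := by
          gcongr; linarith
      _ = _ := by ring
  · rintro ⟨hφ, hsupp, h⟩
    refine ⟨tsupport φ, hsupp, h.mono ?_⟩
    rintro m hm ⟨A, hA⟩
    refine ⟨hφ, subset_rfl, lt_of_le_of_lt ?_ (ENNReal.ofReal_lt_top (r := A))⟩
    refine iSup_le fun α => iSup₂_le fun x _ => ENNReal.ofReal_le_ofReal ?_
    have := hM.pos (miLen α)
    rw [div_le_iff₀ (by positivity), ← mul_assoc]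
    exact (norm_partialD_le α φ x).trans (hA _ x)

lemma IsWeightSequence.add_mem_spaceD (hM : IsWeightSequence M) {t : UltraType}
    {φ ψ : RSp d → ℂ} (hφ : φ ∈ spaceD d M t) (hψ : ψ ∈ spaceD d M t) :
    φ + ψ ∈ spaceD d M t := by
  rw [hM.mem_spaceD_iff] at hφ hψ ⊢
  refine ⟨hφ.1.add hψ.1, hφ.2.1.add hψ.2.1, (hφ.2.2.and hψ.2.2 ?_ ?_).mono ?_⟩
  · rintro m m' hm hmm ⟨A, hA⟩; exact ⟨A, hA.anti hM hm hmm⟩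
  · rintro m m' hm hmm ⟨A, hA⟩; exact ⟨A, hA.anti hM hm hmm⟩
  · rintro m hm ⟨⟨A, hA⟩, B, hB⟩; exact ⟨_, hA.add hφ.1 hψ.1 hB⟩

lemma IsWeightSequence.zero_mem_spaceD (hM : IsWeightSequence M) {t : UltraType} :
    (0 : RSp d → ℂ) ∈ spaceD d M t := by
  rw [hM.mem_spaceD_iff]
  refine ⟨contDiff_const, HasCompactSupport.zero, UltraType.forTest_of_forall fun m hm => ⟨0, ?_⟩⟩
  intro n x
  simp

/-- Products of rapidly decreasing and compactly supported functions. -/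
lemma IsWeightSequence.mul_mem_spaceD (hM : IsWeightSequence M) {t : UltraType}
    {χ φ : RSp d → ℂ} (hχ : ContDiff ℝ ∞ χ) (hχs : HasCompactSupport χ)
    (hχ' : ∀ m : ℝ, 0 < m → ∃ A, DerivBound M m⁻¹ A χ)
    (hφ : φ ∈ spaceS d M t) : (fun x => χ x * φ x) ∈ spaceD d M t := by
  rw [hM.mem_spaceS_iff] at hφ
  rw [hM.mem_spaceD_iff]
  refine ⟨hχ.mul hφ.1, hχs.mul_right, hφ.2.scale (c := 1 / 2) (by norm_num) ?_⟩
  rintro m hm ⟨B, hB⟩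
  obtain ⟨A, hA⟩ := hχ' m hm
  refine ⟨A * B, fun n x => ?_⟩
  have := hM.norm_iteratedFDeriv_mul_le hχ hφ.1 (by positivity) (by positivity)
    (fun n => hA n x) (fun n => hB.derivBound hM hm n x) n
  convert this using 4
  field_simp; ring

/-- Products of compactly supported functions with functions that are holomorphic on a strip. -/
lemma IsWeightSequence.analytic_mul_mem_spaceD (hM : IsWeightSequence M) {t : UltraType}
    {G : CSp d → ℂ} {r : ℝ} (hr : 0 < r) (hG : AnalyticOnNhd ℂ G (strip d r))
    {φ : RSp d → ℂ} (hφ : φ ∈ spaceD d M t) :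
    (fun x => G (ofRealE d x) * φ x) ∈ spaceD d M t := by
  rw [hM.mem_spaceD_iff] at hφ ⊢
  obtain ⟨hφ, hφs, hφ'⟩ := hφ
  have hGc := contDiff_comp_ofRealE hr hG
  refine ⟨hGc.mul hφ, hφs.mul_left, hφ'.scale (c := 1 / 2) (by norm_num) ?_⟩
  rintro m hm ⟨B, hB⟩
  -- Near the compact support there is a compact complex neighbourhood inside the strip; G is
  -- bounded on it, and Cauchy's estimates apply at the points of the support.
  have hcomp : IsCompact (Metric.cthickening (r / 2) (ofRealE d '' tsupport φ)) :=
    (hφs.image (ofRealE d).continuous).cthickening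
  have hball : ∀ x ∈ tsupport φ, Metric.closedBall (ofRealE d x) (r / 2) ⊆
      Metric.cthickening (r / 2) (ofRealE d '' tsupport φ) := fun x hx =>
    Metric.closedBall_subset_cthickening (Set.mem_image_of_mem _ hx) _
  have hthick : Metric.cthickening (r / 2) (ofRealE d '' tsupport φ) ⊆ strip d r := by
    intro z hz
    rw [(hφs.image (ofRealE d).continuous).cthickening_eq_biUnion_closedBall (by positivity)] at hz
    simp only [Set.mem_iUnion] at hz
    obtain ⟨_, ⟨x, _, rfl⟩, hz⟩ := hz
    exact closedBall_subset_strip x (by linarith) hz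
  obtain ⟨A, hA⟩ := hcomp.exists_bound_of_continuousOn
    (fun z hz => (hG z (hthick hz)).continuousAt.continuousWithinAt)
  obtain ⟨C, hC, hC'⟩ := hM.exists_self_pow_le (m / (r / 2)) (by positivity)
  refine ⟨|A| * C * B, fun n x => ?_⟩
  by_cases hx : x ∈ tsupport φ
  · have h1 : ∀ n, ‖iteratedFDeriv ℝ n (fun x => G (ofRealE d x)) x‖ ≤
        |A| * C * m⁻¹ ^ n * M n := fun n => by
      have hs : (n : ℝ) * ((r / 2) / (n + 1)) ≤ r / 2 := by
        rw [← mul_div_assoc, div_le_iff₀ (by positivity)]; nlinarith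
      have hsub : Metric.closedBall (ofRealE d x) (n * ((r / 2) / (n + 1))) ⊆
          Metric.cthickening (r / 2) (ofRealE d '' tsupport φ) :=
        (Metric.closedBall_subset_closedBall hs).trans (hball x hx)
      have h2 := norm_iteratedFDeriv_comp_ofRealE_le (isOpen_strip r) hG (x := x) (n := n)
        (s := (r / 2) / (n + 1)) (A := |A|) (by positivity) (hsub.trans hthick)
        (fun w hw => (hA w (hsub hw)).trans (le_abs_self _))
      refine h2.trans ?_
      have e : |A| / (r / 2 / (n + 1)) ^ n = |A| * m⁻¹ ^ n * (m / (r / 2) * (n + 1)) ^ n := by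
        rw [mul_assoc, ← mul_pow, div_eq_mul_inv, ← inv_pow]
        congr 2
        field_simp
      rw [e]
      calc _ ≤ |A| * m⁻¹ ^ n * (C * M n) := mul_le_mul_of_nonneg_left (hC' n) (by positivity)
        _ = _ := by ring
    have := hM.norm_iteratedFDeriv_mul_le hGc hφ (by positivity) (by positivity)
      h1 (fun n => hB n x) n
    convert this using 4
    field_simp; ring
  · have hx' : x ∉ tsupport fun x => G (ofRealE d x) * φ x := fun h => hx (tsupport_mul_subset_right h)
    rw [image_eq_zero_of_notMem_tsupport fun h =>
      hx' (tsupport_iteratedFDeriv_subset (𝕜 := ℝ) _ h), norm_zero]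
    have hB0 : 0 ≤ B := by simpa [hM.zero] using (norm_nonneg _).trans (hB 0 x)
    have := hM.pos n
    positivity

end

/-! ### Cut-off functions -/

section

variable {d : ℕ} {M : ℕ → ℝ}

/-- The bilinear form `z · w = ∑ z_j w_j` on `ℂ^d`. -/
def cdot (z w : CSp d) : ℂ := ∑ j, z j * w j

lemma norm_cdot_le (z w : CSp d) : ‖cdot z w‖ ≤ ‖z‖ * ‖w‖ := by
  refine (norm_sum_le _ _).trans ?_
  simp_rw [norm_mul]
  rw [EuclideanSpace.norm_eq, EuclideanSpace.norm_eq]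
  exact Real.sum_mul_le_sqrt_mul_sqrt _ _ _

lemma analyticAt_cdot_self (z : CSp d) : AnalyticAt ℂ (fun z : CSp d => cdot z z) z := by
  unfold cdot
  refine Finset.analyticAt_fun_sum _ fun j _ => ?_
  exact ((EuclideanSpace.proj (𝕜 := ℂ) j).analyticAt z).mul
    ((EuclideanSpace.proj (𝕜 := ℂ) j).analyticAt z)

lemma cdot_ofRealE_self (x : RSp d) : cdot (ofRealE d x) (ofRealE d x) = ((‖x‖ ^ 2 : ℝ) : ℂ) := by
  rw [EuclideanSpace.norm_sq_eq]
  simp [cdot, sq]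

lemma cdot_self_sub (z w : CSp d) : cdot z z - cdot w w = cdot (z - w) (z + w) := by
  simp only [cdot, ← Finset.sum_sub_distrib]
  refine Finset.sum_congr rfl fun j _ => ?_
  simp; ring

lemma exists_re_inv_pow_ge (a : ℕ) :
    ∃ κ : ℝ, 0 < κ ∧ ∀ u : ℂ, ‖u‖ ≤ κ → 1 / 2 ≤ (((1 + u) ^ a)⁻¹).re := by
  have hc : ContinuousAt (fun u : ℂ => (((1 + u) ^ a)⁻¹).re) 0 := by
    refine Complex.continuous_re.continuousAt.comp (ContinuousAt.inv₀ (by fun_prop) (by simp))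
  have := hc.eventually (lt_mem_nhds (a := (1 / 2 : ℝ)) (by norm_num))
  obtain ⟨κ, hκ, h⟩ := Metric.eventually_nhds_iff_ball.1 this
  refine ⟨κ / 2, by positivity, fun u hu => (h u ?_).le⟩
  rw [mem_ball_zero_iff]; linarith

/-- With w = 1 - |x|², a complex ball of radius proportional to w keeps 1 - z·z equal to w (1 + u)
with u small. So exp(-(1 - z·z)^{-a}) stays as small there as exp(-w^{-a} / 2), up to the boundary
of the ball. -/
lemma norm_exp_neg_inv_le {a : ℕ} {κ : ℝ}
    (hκ : ∀ u : ℂ, ‖u‖ ≤ κ → 1 / 2 ≤ (((1 + u) ^ a)⁻¹).re) {x : RSp d} (hx : ‖x‖ < 1) {c : ℝ}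
    (hc1 : c ≤ 1) (hcκ : 3 * c ≤ κ) {z : CSp d}
    (hz : z ∈ Metric.closedBall (ofRealE d x) (c * (1 - ‖x‖ ^ 2))) :
    1 / 2 * ((1 - ‖x‖ ^ 2) ^ a)⁻¹ ≤ (((1 - cdot z z) ^ a)⁻¹).re := by
  set w : ℝ := 1 - ‖x‖ ^ 2 with hw
  have hx0 := norm_nonneg x
  have hw0 : 0 < w := by nlinarith
  have hw1 : w ≤ 1 := by nlinarith
  rw [mem_closedBall_iff_norm] at hz
  set u : ℂ := (cdot (ofRealE d x) (ofRealE d x) - cdot z z) / w with hu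
  have hz' : 1 - cdot z z = (w : ℂ) * (1 + u) := by
    have : (w : ℂ) ≠ 0 := by exact_mod_cast hw0.ne'
    rw [hu, mul_add, mul_div_cancel₀ _ this, cdot_ofRealE_self, hw]
    push_cast; ring
  have hnu : ‖u‖ ≤ κ := by
    rw [hu, norm_div, Complex.norm_real, Real.norm_of_nonneg hw0.le, div_le_iff₀ hw0,
      cdot_self_sub]
    refine (norm_cdot_le _ _).trans ?_
    have h1 : ‖ofRealE d x - z‖ ≤ c * w := by rwa [norm_sub_rev]
    have h2 : ‖ofRealE d x + z‖ ≤ 3 := by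
      have e : ofRealE d x + z = (z - ofRealE d x) + (2 : ℝ) • ofRealE d x := by
        rw [two_smul]; abel
      rw [e]
      refine (norm_add_le _ _).trans ?_
      rw [norm_smul, LinearIsometry.norm_map]
      norm_num
      nlinarith [norm_nonneg (z - ofRealE d x)]
    have h3 : 0 ≤ c * w := (norm_nonneg _).trans h1
    calc _ ≤ c * w * 3 := by gcongr
      _ = 3 * c * w := by ring
      _ ≤ κ * w := by gcongr
  have h := hκ u hnu
  rw [hz', mul_pow, mul_inv, ← Complex.ofReal_pow, ← Complex.ofReal_inv, Complex.re_ofReal_mul,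
    mul_comm]
  gcongr

/-- A compactly supported function in the Beurling class with value `1` at the origin. -/
lemma IsWeightSequence.exists_bump (hM : IsWeightSequence M) (d : ℕ) :
    ∃ χ : RSp d → ℂ, ContDiff ℝ ∞ χ ∧ HasCompactSupport χ ∧ χ 0 = 1 ∧
      ∀ m : ℝ, 0 < m → ∃ A, DerivBound M m⁻¹ A χ := by
  obtain ⟨a, ha, hfac⟩ := hM.exists_factorial_pow_le
  have ha0 : a ≠ 0 := by rintro rfl; simp at ha
  -- The function e · exp(-(1 - |x|²)^{-a}) on the unit ball, extended by zero. It is Gevrey of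
  -- order 1 + 1/a, which `hfac` places below M.
  set χ : RSp d → ℂ :=
    fun x => ((Real.exp 1 * expNegInvGlue ((1 - ‖x‖ ^ 2) ^ a) : ℝ) : ℂ) with hχ
  have hsm : ContDiff ℝ ∞ χ := by
    refine Complex.ofRealCLM.contDiff.comp (contDiff_const.mul (expNegInvGlue.contDiff.comp ?_))
    exact (contDiff_const.sub (contDiff_norm_sq ℝ)).pow a
  have hzero : ∀ x, 1 ≤ ‖x‖ → χ x = 0 := fun x hx => by
    have : (1 - ‖x‖ ^ 2) ^ a ≤ 0 := ha.pow_nonpos (by nlinarith)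
    simp [hχ, expNegInvGlue.zero_of_nonpos this]
  have hts : tsupport χ ⊆ Metric.closedBall 0 1 := by
    refine closure_minimal (fun x hx => ?_) Metric.isClosed_closedBall
    rw [mem_closedBall_zero_iff]
    by_contra h
    exact hx (hzero x (by linarith))
  have hcs : HasCompactSupport χ :=
    (isCompact_closedBall _ _).of_isClosed_subset (isClosed_tsupport _) hts
  have hone : χ 0 = 1 := by
    simp only [hχ, norm_zero]
    norm_num [expNegInvGlue]
    rw [← Complex.exp_add]; simp
  obtain ⟨κ, hκ, hκ'⟩ := exists_re_inv_pow_ge a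
  set c : ℝ := min 1 (κ / 3) with hc
  have hc0 : 0 < c := by positivity
  have hc1 : c ≤ 1 := min_le_left _ _
  have hcκ : 3 * c ≤ κ := by have : c ≤ κ / 3 := min_le_right _ _; linarith
  set G : CSp d → ℂ := fun z => Real.exp 1 * Complex.exp (-((1 - cdot z z) ^ a)⁻¹) with hG
  set U : Set (CSp d) := {z | cdot z z ≠ 1} with hU
  have hUo : IsOpen U := by
    have : Continuous fun z : CSp d => cdot z z :=
      continuous_iff_continuousAt.2 fun z => (analyticAt_cdot_self z).continuousAt
    exact isOpen_ne_fun this continuous_const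
  have hGa : AnalyticOnNhd ℂ G U := fun z hz => by
    refine analyticAt_const.mul (AnalyticAt.cexp' (AnalyticAt.neg (AnalyticAt.inv ?_ ?_)))
    · exact (analyticAt_const.sub (analyticAt_cdot_self z)).pow a
    · exact pow_ne_zero _ (sub_ne_zero.2 (Ne.symm hz))
  have hχG : ∀ x : RSp d, ‖x‖ < 1 → χ x = G (ofRealE d x) := fun x hx => by
    have hw : 0 < (1 - ‖x‖ ^ 2) ^ a := by
      have := norm_nonneg x
      have : 0 < 1 - ‖x‖ ^ 2 := by nlinarith
      positivity
    simp only [hχ, hG, cdot_ofRealE_self, expNegInvGlue, not_le.2 hw, if_false]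
    push_cast; rfl
  -- Stated for a-th powers to avoid roots: a factorials come from the (n + 1)^n of Cauchy's
  -- estimates, and one more from w^{-an} exp(-w^{-a} / 2) ≤ 2^n n!, which compensates the shrinking
  -- radius.
  have hbound : ∀ (n : ℕ) (x : RSp d), ‖x‖ < 1 → ‖iteratedFDeriv ℝ n χ x‖ ^ a ≤
      (Real.exp 1 ^ (2 * a)) * ((2 * (Real.exp 1 / c) ^ a) ^ n * (n.factorial : ℝ) ^ (a + 1)) := by
    intro n x hx
    set w : ℝ := 1 - ‖x‖ ^ 2 with hw
    have hw0 : 0 < w := by have := norm_nonneg x; nlinarith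
    have heq : χ =ᶠ[nhds x] fun x => G (ofRealE d x) := by
      filter_upwards [(isOpen_lt continuous_norm continuous_const).mem_nhds hx] with y hy
        using hχG y hy
    have hre : ∀ z ∈ Metric.closedBall (ofRealE d x) (n * (c * w / (n + 1))),
        1 / 2 * (w ^ a)⁻¹ ≤ (((1 - cdot z z) ^ a)⁻¹).re := fun z hz => by
      refine norm_exp_neg_inv_le hκ' hx hc1 hcκ (Metric.closedBall_subset_closedBall ?_ hz)
      rw [← mul_div_assoc, div_le_iff₀ (by positivity)]
      have : 0 < c * w := by positivity
      nlinarith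
    have h1 := norm_iteratedFDeriv_comp_ofRealE_le hUo hGa (x := x) (n := n)
      (s := c * w / (n + 1)) (A := Real.exp 1 * Real.exp (-(1 / 2 * (w ^ a)⁻¹))) (by positivity)
      (fun z hz => by
        intro h0
        have := hre z hz
        rw [h0, sub_self, zero_pow ha0, inv_zero, Complex.zero_re] at this
        have : 0 < (w ^ a)⁻¹ := by positivity
        linarith)
      (fun z hz => by
        simp only [hG, norm_mul, Complex.norm_real, Complex.norm_exp, Complex.neg_re]
        rw [Real.norm_of_nonneg (by positivity)]
        gcongr
        exact hre z hz)
    rw [Filter.EventuallyEq.eq_of_nhds (Filter.EventuallyEq.iteratedFDeriv (𝕜 := ℝ) heq n)]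
    have hn1 : ((n : ℝ) + 1) ^ n ≤ Real.exp 1 * (Real.exp 1 ^ n * n.factorial) := by
      have := Real.pow_div_factorial_le_exp ((n : ℝ) + 1) (by positivity) n
      rw [div_le_iff₀ (by positivity), Real.exp_add, ← mul_one (n : ℝ), Real.exp_nat_mul] at this
      simp only [mul_one] at this
      linarith
    have hy : ((w ^ a)⁻¹) ^ n * Real.exp (-(1 / 2 * (w ^ a)⁻¹)) ≤ 2 ^ n * n.factorial := by
      have := Real.pow_div_factorial_le_exp (1 / 2 * (w ^ a)⁻¹) (by positivity) n
      rw [div_le_iff₀ (by positivity), mul_pow] at this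
      rw [Real.exp_neg, ← div_eq_mul_inv, div_le_iff₀ (by positivity)]
      have h2 : ((w ^ a)⁻¹) ^ n = 2 ^ n * ((1 / 2) ^ n * ((w ^ a)⁻¹) ^ n) := by
        rw [← mul_assoc, ← mul_pow]; norm_num
      rw [h2]
      calc _ ≤ (2 : ℝ) ^ n * (Real.exp (1 / 2 * (w ^ a)⁻¹) * n.factorial) := by gcongr
        _ = _ := by ring
    -- Since a ≥ 1, one of the a exponential factors suffices.
    have hE : Real.exp (-(1 / 2 * (w ^ a)⁻¹)) ^ a ≤ Real.exp (-(1 / 2 * (w ^ a)⁻¹)) := by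
      refine pow_le_of_le_one (by positivity) ?_ ha0
      rw [Real.exp_le_one_iff]
      have : 0 < (w ^ a)⁻¹ := by positivity
      linarith
    have hy' := le_trans (mul_le_mul_of_nonneg_left hE
      (by positivity : (0 : ℝ) ≤ ((w ^ a)⁻¹) ^ n)) hy
    calc ‖iteratedFDeriv ℝ n (fun x => G (ofRealE d x)) x‖ ^ a
        ≤ (Real.exp 1 * Real.exp (-(1 / 2 * (w ^ a)⁻¹)) / (c * w / (n + 1)) ^ n) ^ a := by gcongr
      _ = Real.exp 1 ^ a * (((n : ℝ) + 1) ^ n) ^ a * ((c⁻¹) ^ n) ^ a *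
          (((w ^ a)⁻¹) ^ n * Real.exp (-(1 / 2 * (w ^ a)⁻¹)) ^ a) := by
          rw [div_pow, div_pow, div_pow, mul_pow, mul_pow, mul_pow, inv_pow, inv_pow, inv_pow,
            ← pow_mul w, ← pow_mul w, mul_comm a n]
          field_simp
      _ ≤ Real.exp 1 ^ a * (Real.exp 1 * (Real.exp 1 ^ n * n.factorial)) ^ a * ((c⁻¹) ^ n) ^ a *
          (2 ^ n * n.factorial) := by
          refine mul_le_mul (by gcongr) hy' (by positivity) (by positivity)
      _ = _ := by
          rw [mul_pow, mul_pow, mul_pow 2, div_eq_mul_inv, mul_pow _ (c⁻¹),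
            mul_pow _ (c⁻¹ ^ a), ← pow_mul, ← pow_mul, ← pow_mul, ← pow_mul, mul_comm a n,
            two_mul a, pow_add, pow_add]
          ring
  refine ⟨χ, hsm, hcs, hone, fun m hm => ?_⟩
  obtain ⟨C, hC, hC'⟩ := hfac (2 * (Real.exp 1 / c) ^ a * m ^ a) (by positivity)
  refine ⟨Real.exp 1 ^ 2 * C, ?_⟩
  have hball : ∀ (n : ℕ) (x : RSp d), ‖x‖ < 1 →
      ‖iteratedFDeriv ℝ n χ x‖ ≤ Real.exp 1 ^ 2 * C * m⁻¹ ^ n * M n := fun n x hx => by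
    have hMn := hM.pos n
    refine (pow_le_pow_iff_left₀ (norm_nonneg _) (by positivity) ha0).1
      ((hbound n x hx).trans ?_)
    have h1 := hC' n
    rw [mul_pow, ← pow_mul m] at h1
    have h2 : (2 * (Real.exp 1 / c) ^ a) ^ n * (n.factorial : ℝ) ^ (a + 1) ≤
        C ^ a * M n ^ a * (m⁻¹ ^ n) ^ a := by
      have e : (m⁻¹ ^ n) ^ a = (m ^ (a * n))⁻¹ := by rw [inv_pow, inv_pow, ← pow_mul, mul_comm]
      rw [e, ← div_eq_mul_inv, le_div_iff₀ (by positivity)]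
      calc _ = (2 * (Real.exp 1 / c) ^ a) ^ n * m ^ (a * n) * (n.factorial : ℝ) ^ (a + 1) := by ring
        _ ≤ C * M n ^ a := h1
        _ ≤ C ^ a * M n ^ a := by gcongr; exact le_self_pow₀ hC ha0
    calc _ ≤ Real.exp 1 ^ (2 * a) * (C ^ a * M n ^ a * (m⁻¹ ^ n) ^ a) := by gcongr
      _ = _ := by rw [mul_pow, mul_pow, mul_pow, pow_mul]; ring
  intro n x
  have hMn := hM.pos n
  by_cases hx : x ∈ Metric.closedBall (0 : RSp d) 1
  -- The estimate from the open ball extends to the unit sphere by continuity of the derivatives.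
  · rw [← closure_ball _ one_ne_zero] at hx
    have hcl : IsClosed {x : RSp d | ‖iteratedFDeriv ℝ n χ x‖ ≤
        Real.exp 1 ^ 2 * C * m⁻¹ ^ n * M n} :=
      isClosed_le (hsm.continuous_iteratedFDeriv (by exact_mod_cast le_top)).norm continuous_const
    refine closure_minimal (fun y hy => ?_) hcl hx
    exact hball n y (by simpa using hy)
  · rw [image_eq_zero_of_notMem_tsupport fun h =>
      hx (hts (tsupport_iteratedFDeriv_subset (𝕜 := ℝ) n h)), norm_zero]
    positivity

/-- Cut-off functions converging to `1`. -/
lemma IsWeightSequence.exists_cutoff (hM : IsWeightSequence M) (d : ℕ) :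
    ∃ χ : ℕ → RSp d → ℂ, (∀ N, ContDiff ℝ ∞ (χ N)) ∧ (∀ N, HasCompactSupport (χ N)) ∧
      (∀ N, ∀ m : ℝ, 0 < m → ∃ A, DerivBound M m⁻¹ A (χ N)) ∧
      ∀ m : ℝ, 0 < m → ∃ A : ℝ, ∀ N n x, ‖iteratedFDeriv ℝ n (fun y => 1 - χ N y) x‖ ≤
        A / (N + 1) * jb x ^ 1 * m⁻¹ ^ n * M n := by
  obtain ⟨χ, hχ, hχs, hχ1, hχb⟩ := hM.exists_bump d
  have hpos : ∀ N : ℕ, (0 : ℝ) < ((N : ℝ) + 1)⁻¹ := fun N => by positivity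
  have hle : ∀ N : ℕ, ((N : ℝ) + 1)⁻¹ ≤ 1 := fun N => inv_le_one_of_one_le₀ (by simp)
  have hder : ∀ (N n : ℕ) (x : RSp d),
      ‖iteratedFDeriv ℝ n (fun x => χ (((N : ℝ) + 1)⁻¹ • x)) x‖ ≤
        ((N : ℝ) + 1)⁻¹ ^ n * ‖iteratedFDeriv ℝ n χ (((N : ℝ) + 1)⁻¹ • x)‖ := fun N n x => by
    have h := ((((N : ℝ) + 1)⁻¹) • ContinuousLinearMap.id ℝ (RSp d)).iteratedFDeriv_comp_right
      hχ x (i := n) (by exact_mod_cast le_top)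
    refine (congrArg norm h).le.trans
      ((ContinuousMultilinearMap.norm_compContinuousLinearMap_le _ _).trans ?_)
    rw [Finset.prod_const, Finset.card_univ, Fintype.card_fin, mul_comm]
    refine mul_le_mul_of_nonneg_right (pow_le_pow_left₀ (norm_nonneg _) ?_ n) (norm_nonneg _)
    rw [norm_smul, Real.norm_of_nonneg (hpos N).le]
    exact mul_le_of_le_one_right (hpos N).le ContinuousLinearMap.norm_id_le
  have hsm : ∀ N : ℕ, ContDiff ℝ ∞ fun x : RSp d => χ (((N : ℝ) + 1)⁻¹ • x) := fun N =>
    hχ.comp (contDiff_const_smul _)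
  refine ⟨fun N x => χ (((N : ℝ) + 1)⁻¹ • x), hsm, fun N => ?_, fun N m hm => ?_, fun m hm => ?_⟩
  · exact hχs.comp_homeomorph (Homeomorph.smulOfNeZero _ (hpos N).ne')
  · obtain ⟨A, hA⟩ := hχb m hm
    refine ⟨A, fun n x => (hder N n x).trans (le_trans ?_ (hA n (((N : ℝ) + 1)⁻¹ • x)))⟩
    exact mul_le_of_le_one_left (norm_nonneg _) (pow_le_one₀ (hpos N).le (hle N))
  · obtain ⟨A, hA⟩ := hχb m hm
    have hA0 : 0 ≤ A := by simpa [hM.zero] using (norm_nonneg _).trans (hA 0 0)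
    have hM1 := hM.pos 1
    refine ⟨A * (1 + m⁻¹ * M 1), fun N n x => ?_⟩
    have hMn := hM.pos n
    have hj := one_le_jb x
    rw [pow_one]
    -- For n = 0 the gain 1 / (N + 1) comes from the mean value inequality, at the price of a factor
    -- |x|; for n ≥ 1 the dilation itself supplies it.
    rcases Nat.eq_zero_or_pos n with rfl | hn
    · rw [norm_iteratedFDeriv_zero, pow_zero, hM.zero, mul_one, mul_one, ← hχ1, norm_sub_rev]
      have hmv := Convex.norm_image_sub_le_of_norm_fderiv_le (𝕜 := ℝ) (f := χ)
        (C := A * m⁻¹ * M 1) (s := Set.univ) (x := 0) (y := ((N : ℝ) + 1)⁻¹ • x)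
        (fun y _ => (hχ.differentiable (by simp)).differentiableAt)
        (fun y _ => by
          have := hA 1 y
          rwa [← zero_add 1, ← norm_iteratedFDeriv_fderiv, norm_iteratedFDeriv_zero, zero_add,
            pow_one] at this) convex_univ trivial trivial
      refine hmv.trans ?_
      rw [sub_zero, norm_smul, Real.norm_of_nonneg (hpos N).le]
      calc A * m⁻¹ * M 1 * (((N : ℝ) + 1)⁻¹ * ‖x‖)
          ≤ (A * (1 + m⁻¹ * M 1)) * (((N : ℝ) + 1)⁻¹ * jb x) := by
            have := norm_le_jb x
            have h3 : A * m⁻¹ * M 1 ≤ A * (1 + m⁻¹ * M 1) := by nlinarith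
            gcongr
        _ = _ := by ring
    · have h1 : iteratedFDeriv ℝ n (fun y => 1 - χ (((N : ℝ) + 1)⁻¹ • y)) x =
          -iteratedFDeriv ℝ n (fun y => χ (((N : ℝ) + 1)⁻¹ • y)) x := by
        have := iteratedFDeriv_sub_apply (𝕜 := ℝ) (i := n) (f := fun _ : RSp d => (1 : ℂ))
          (g := fun y => χ (((N : ℝ) + 1)⁻¹ • y)) (x := x) contDiffAt_const
          ((hsm N).contDiffAt.of_le (by exact_mod_cast le_top))
        rw [iteratedFDeriv_const_of_ne hn.ne'] at this
        simpa [Pi.sub_def] using this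
      rw [h1, norm_neg]
      refine (hder N n x).trans ?_
      have hNn : ((N : ℝ) + 1)⁻¹ ^ n ≤ ((N : ℝ) + 1)⁻¹ :=
        pow_le_of_le_one (hpos N).le (hle N) hn.ne'
      have hp := hpos N
      calc _ ≤ ((N : ℝ) + 1)⁻¹ * (A * m⁻¹ ^ n * M n) := by
            gcongr
            exact hA _ _
        _ = A * 1 / (N + 1) * 1 * m⁻¹ ^ n * M n := by rw [div_eq_mul_inv]; ring
        _ ≤ _ := by
            gcongr
            have : 0 < m⁻¹ * M 1 := by positivity
            linarith

/-- Multiplication by cut-off functions converges to the identity under a tempered functional. -/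
lemma IsWeightSequence.exists_cutoff_tendsto (hM : IsWeightSequence M) (d : ℕ) :
    ∃ χ : ℕ → RSp d → ℂ, ∀ t : UltraType, ∀ φ ∈ spaceS d M t,
      (∀ N, (fun x => χ N x * φ x) ∈ spaceD d M t ∧ (fun x => χ N x * φ x) ∈ spaceS d M t) ∧
      ∀ S, IsTemperedUltradistribution d M t S →
        Filter.Tendsto (fun N => S fun x => χ N x * φ x) Filter.atTop (nhds (S φ)) := by
  obtain ⟨χ, hχ, hχs, hχb, hχ1⟩ := hM.exists_cutoff d
  refine ⟨χ, fun t φ hφ => ?_⟩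
  have hmem : ∀ N, (fun x => χ N x * φ x) ∈ spaceD d M t ∧
      (fun x => χ N x * φ x) ∈ spaceS d M t := fun N =>
    ⟨hM.mul_mem_spaceD (hχ N) (hχs N) (hχb N) hφ, hM.mul_mem_spaceS (hχ N) (hχb N) hφ⟩
  refine ⟨hmem, fun S hS => ?_⟩
  obtain ⟨H, hH, hshift⟩ := hM.exists_shift
  obtain ⟨D, hD, hshift⟩ := hshift 1
  have hφ' := hM.mem_spaceS_iff.1 hφ
  -- Multiplication by 1 - χ_N loses one power of ⟨x⟩ and hence shrinks the parameter from m to m /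
  -- (2H), where S still has to be bounded.
  have hdual : t.forDual fun m => BoundedFor d M t S (m / (2 * H)) :=
    (hM.continuousOnS_iff.1 hS.cont).scale (c := 2 * H) (by positivity) fun m _ h => by
      rwa [mul_div_cancel_left₀ _ (by positivity)]
  obtain ⟨m, hm, ⟨B, hB⟩, C, hC0, hC⟩ := UltraType.exists_of_forTest_of_forDual hφ'.2 hdual
  obtain ⟨A, hA⟩ := hχ1 m hm
  have hdiff : ∀ N, (fun x => (1 - χ N x) * φ x) = φ + (-1 : ℂ) • fun x => χ N x * φ x := fun N => by
    ext x; simp; ring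
  have hdmem : ∀ N, (fun x => (1 - χ N x) * φ x) ∈ spaceS d M t := fun N => by
    rw [hdiff]; exact hM.add_mem_spaceS hφ (hM.smul_mem_spaceS _ (hmem N).2)
  have hbound : ∀ N : ℕ, ‖(S fun x => χ N x * φ x) - S φ‖ ≤
      C * A * B * (D / m ^ 1) * (1 / ((N : ℝ) + 1)) := fun N => by
    have h1 := hC _ (hdmem N) _ (DecayBound.mul hM hm (contDiff_const.sub (hχ N)) hφ'.1 1 hH hD
      hshift (hA N) hB)
    rw [hdiff, hS.map_add _ hφ _ (hM.smul_mem_spaceS _ (hmem N).2), hS.map_smul _ _ (hmem N).2] at h1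
    rw [norm_sub_rev]
    refine le_of_eq_of_le ?_ (h1.trans (le_of_eq ?_))
    · congr 1; ring
    · ring
  rw [tendsto_iff_norm_sub_tendsto_zero]
  refine squeeze_zero (fun N => norm_nonneg _) hbound ?_
  rw [← mul_zero (C * A * B * (D / m ^ 1))]
  exact (tendsto_one_div_add_atTop_nhds_zero_nat (𝕜 := ℝ)).const_mul (C * A * B * (D / m ^ 1))

end

/-! ### The Fourier transform on the test spaces -/

namespace VectorFourier

open ContinuousMultilinearMap Complex Real

variable {V W E : Type*} [NormedAddCommGroup V] [NormedSpace ℝ V] [NormedAddCommGroup W]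
  [NormedSpace ℝ W] [NormedAddCommGroup E] [NormedSpace ℂ E] (L : V →L[ℝ] W →L[ℝ] ℝ)

lemma norm_iteratedFDeriv_const_smul_complex {G : Type*} [NormedAddCommGroup G]
    [NormedSpace ℝ G] [NormedSpace ℂ G] [SMulCommClass ℝ ℂ G] {g : V → G} {k : ℕ}
    (hg : ContDiff ℝ k g) (c : ℂ) (v : V) :
    ‖iteratedFDeriv ℝ k (fun y => c • g y) v‖ = ‖c‖ * ‖iteratedFDeriv ℝ k g v‖ := by
  rw [iteratedFDeriv_const_smul_apply' hg.contDiffAt, norm_smul]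

/-- A version of `norm_iteratedFDeriv_fourierPowSMulRight` that keeps the Leibniz sum. -/
lemma norm_iteratedFDeriv_fourierPowSMulRight_le_sum {f : V → E} {K : ℕ∞ω}
    (hf : ContDiff ℝ K f) {n : ℕ} {k : ℕ} (hk : k ≤ K) (v : V) :
    ‖iteratedFDeriv ℝ k (fun v ↦ fourierPowSMulRight L f v n) v‖ ≤
      (2 * π * ‖L‖) ^ n * ∑ i ∈ Finset.range (k + 1), k.choose i * n.descFactorial i *
        (‖v‖ ^ (n - i) * ‖iteratedFDeriv ℝ (k - i) f v‖) := by
  simp_rw [fourierPowSMulRight_eq_comp]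
  let T : (W →L[ℝ] ℝ) [×n]→L[ℝ] (W [×n]→L[ℝ] ℝ) :=
    compContinuousLinearMapLRight (ContinuousMultilinearMap.mkPiAlgebra ℝ (Fin n) ℝ)
  have I₁ m : ‖iteratedFDeriv ℝ m T (fun _ ↦ L v)‖ ≤
      n.descFactorial m * 1 * (‖L‖ * ‖v‖) ^ (n - m) := by
    have : ‖T‖ ≤ 1 := by
      apply (norm_compContinuousLinearMapLRight_le _ _).trans
      simp only [norm_mkPiAlgebra, le_refl]
    apply (ContinuousMultilinearMap.norm_iteratedFDeriv_le _ _ _).trans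
    simp only [Fintype.card_fin]
    gcongr
    refine (pi_norm_le_iff_of_nonneg (by positivity)).mpr (fun _ ↦ ?_)
    exact ContinuousLinearMap.le_opNorm _ _
  have I₂ m : ‖iteratedFDeriv ℝ m (T ∘ (ContinuousLinearMap.pi (fun (_ : Fin n) ↦ L))) v‖ ≤
      (n.descFactorial m * 1 * (‖L‖ * ‖v‖) ^ (n - m)) * ‖L‖ ^ m := by
    rw [ContinuousLinearMap.iteratedFDeriv_comp_right _ (ContinuousMultilinearMap.contDiff _)
      _ (mod_cast le_top)]
    apply (norm_compContinuousLinearMap_le _ _).trans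
    simp only [Finset.prod_const, Finset.card_fin]
    gcongr
    · exact I₁ m
    · exact ContinuousLinearMap.norm_pi_le_of_le (fun _ ↦ le_rfl) (norm_nonneg L)
  have I₃ m : ‖iteratedFDeriv ℝ m (T ∘ (ContinuousLinearMap.pi (fun (_ : Fin n) ↦ L))) v‖ ≤
      n.descFactorial m * ‖L‖ ^ n * ‖v‖ ^ (n - m) := by
    apply (I₂ m).trans (le_of_eq _)
    rcases le_or_gt m n with hm | hm
    · rw [show ‖L‖ ^ n = ‖L‖ ^ (m + (n - m)) by rw [Nat.add_sub_cancel' hm], pow_add]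
      ring
    · simp only [Nat.descFactorial_eq_zero_iff_lt.mpr hm, CharP.cast_eq_zero, mul_one, zero_mul]
  have A : ContDiff ℝ K (fun y ↦ T (fun _ ↦ L y)) :=
    (ContinuousMultilinearMap.contDiff _).comp (contDiff_pi.2 fun _ ↦ L.contDiff)
  rw [norm_iteratedFDeriv_const_smul_complex (hg := (smulRightL ℝ (fun _ ↦ W)
    E).isBoundedBilinearMap.contDiff.comp₂ (A.of_le hk) (hf.of_le hk))]
  simp only [mul_assoc, norm_pow, norm_neg, Complex.norm_mul, Complex.norm_ofNat, norm_real,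
    Real.norm_eq_abs, abs_of_nonneg pi_nonneg, norm_I, mul_one, smulRightL_apply]
  rw [← mul_assoc 2 π, mul_pow (2 * π), mul_assoc]
  refine mul_le_mul_of_nonneg_left ?_ (by positivity)
  refine (ContinuousLinearMap.norm_iteratedFDeriv_le_of_bilinear_of_le_one _ A hf _
    hk ContinuousMultilinearMap.norm_smulRightL_le).trans ?_
  rw [Finset.mul_sum]
  refine Finset.sum_le_sum fun i _ => ?_
  calc _ ≤ k.choose i * (n.descFactorial i * ‖L‖ ^ n * ‖v‖ ^ (n - i)) *
        ‖iteratedFDeriv ℝ (k - i) f v‖ := by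
        gcongr
        exact I₃ i
    _ = _ := by ring

end VectorFourier

section

variable {d : ℕ} {M : ℕ → ℝ}

lemma integrable_inv_jb_pow (d : ℕ) : Integrable fun x : RSp d => (jb x ^ (d + 1))⁻¹ := by
  have hint : Integrable (fun x : RSp d => ((1 : ℝ) + ‖x‖ ^ 2) ^ (-((d + 1 : ℕ) : ℝ) / 2)) :=
    integrable_rpow_neg_one_add_norm_sq (by simp)
  refine hint.congr (Filter.Eventually.of_forall fun x => ?_)
  have h0 : (0 : ℝ) ≤ 1 + ‖x‖ ^ 2 := by positivity
  simp only [jb]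
  rw [Real.sqrt_eq_rpow, ← Real.rpow_natCast _ (d + 1), ← Real.rpow_mul h0, ← Real.rpow_neg h0]
  congr 1
  ring

/-- The decay of test functions controls integrable majorants. -/
lemma IsWeightSequence.exists_integrable_majorant (hM : IsWeightSequence M) (d : ℕ) :
    ∃ H : ℝ, 1 ≤ H ∧ ∀ m : ℝ, 0 < m → ∃ C : ℝ, 0 < C ∧ ∀ (A : ℝ) (ψ : RSp d → ℂ),
      DecayBound M m A ψ → ∀ (n k : ℕ) (x : RSp d),
        m ^ (n + k) * jb x ^ k * ‖iteratedFDeriv ℝ n ψ x‖ ≤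
          C * A * H ^ k * (M n * M k) * (jb x ^ (d + 1))⁻¹ := by
  obtain ⟨H, hH, hs⟩ := hM.exists_shift
  obtain ⟨C, hC, hs⟩ := hs (d + 1)
  refine ⟨H, hH, fun m hm => ⟨C / m ^ (d + 1), by positivity, fun A ψ h n k x => ?_⟩⟩
  have hA := h.nonneg hM
  have h1 := h n (k + (d + 1)) x
  have hj := jb_pos x
  have hn := hM.pos n
  rw [← div_eq_mul_inv, le_div_iff₀ (by positivity), div_mul_eq_mul_div, div_mul_eq_mul_div,
    div_mul_eq_mul_div, le_div_iff₀ (by positivity)]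
  calc _ = m ^ (n + (k + (d + 1))) * jb x ^ (k + (d + 1)) * ‖iteratedFDeriv ℝ n ψ x‖ := by
        rw [← add_assoc, pow_add m (n + k), pow_add (jb x)]; ring
    _ ≤ A * (M n * M (k + (d + 1))) := h1
    _ ≤ A * (M n * (C * H ^ k * M k)) := by gcongr; exact hs k
    _ = _ := by ring

lemma DecayBound.integrable_pow_mul (hM : IsWeightSequence M) {m A : ℝ} (hm : 0 < m)
    {ψ : RSp d → ℂ} (hψ : ContDiff ℝ ∞ ψ) (h : DecayBound M m A ψ) (k n : ℕ) :
    Integrable fun v => ‖v‖ ^ k * ‖iteratedFDeriv ℝ n ψ v‖ := by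
  obtain ⟨H, hH, hs⟩ := hM.exists_integrable_majorant d
  obtain ⟨C, hC, hs⟩ := hs m hm
  have hc : Continuous (iteratedFDeriv ℝ n ψ) :=
    hψ.continuous_iteratedFDeriv (by exact_mod_cast le_top)
  refine ((integrable_inv_jb_pow d).const_mul
    (C * A * H ^ k * (M n * M k) / m ^ (n + k))).mono'
    ((continuous_norm.pow k).mul hc.norm).aestronglyMeasurable
    (Filter.Eventually.of_forall fun x => ?_)
  rw [Real.norm_of_nonneg (by positivity), div_mul_eq_mul_div, le_div_iff₀ (by positivity)]
  refine le_trans ?_ (hs A ψ h n k x)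
  have := norm_le_jb x
  calc _ = m ^ (n + k) * ‖x‖ ^ k * ‖iteratedFDeriv ℝ n ψ x‖ := by ring
    _ ≤ _ := by gcongr

/-- The bilinear form `(η, x) ↦ (2π)⁻¹ ⟪η, x⟫`. -/
noncomputable def scaledInner (d : ℕ) : RSp d →L[ℝ] RSp d →L[ℝ] ℝ := (2 * Real.pi)⁻¹ • innerSL ℝ

lemma scaledInner_apply (x y : RSp d) :
    scaledInner d x y = (2 * Real.pi)⁻¹ * inner ℝ x y := rfl

/-- The factor (2π)⁻¹ in the form cancels the 2π in the standard additive character. -/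
lemma fourierT_eq (ψ : RSp d → ℂ) : fourierT ψ = VectorFourier.fourierIntegral Real.fourierChar
    volume (scaledInner d).toLinearMap₁₂ ψ := by
  ext x
  simp only [fourierT, VectorFourier.fourierIntegral]
  refine integral_congr_ae (Filter.Eventually.of_forall fun η => ?_)
  simp only [Circle.smul_def, Real.fourierChar_apply, smul_eq_mul]
  congr 2
  have : (((scaledInner d).toLinearMap₁₂ η) x : ℝ) = (2 * Real.pi)⁻¹ * inner ℝ η x := rfl
  rw [this, real_inner_comm]
  push_cast
  have hpi : (Real.pi : ℂ) ≠ 0 := by exact_mod_cast Real.pi_ne_zero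
  field_simp

lemma norm_scaledInner_le (d : ℕ) : 2 * Real.pi * ‖scaledInner d‖ ≤ 1 := by
  have hpi := Real.pi_pos
  have h : ‖scaledInner d‖ ≤ (2 * Real.pi)⁻¹ :=
    ContinuousLinearMap.opNorm_le_bound₂ _ (by positivity) fun x y => by
      rw [scaledInner_apply, norm_mul, Real.norm_of_nonneg (by positivity), mul_assoc]
      gcongr
      exact norm_inner_le_norm x y
  calc _ ≤ 2 * Real.pi * (2 * Real.pi)⁻¹ := by gcongr
    _ = 1 := by field_simp

lemma DecayBound.contDiff_fourierT (hM : IsWeightSequence M) {m A : ℝ} (hm : 0 < m)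
    {ψ : RSp d → ℂ} (hψ : ContDiff ℝ ∞ ψ) (h : DecayBound M m A ψ) :
    ContDiff ℝ ∞ (fourierT ψ) := by
  rw [fourierT_eq]
  refine VectorFourier.contDiff_fourierIntegral _ fun n _ => ?_
  simpa using h.integrable_pow_mul hM hm hψ n 0

/-- The left side is controlled by the transform of the n-th derivative of the k-fold moment of ψ,
evaluated on (w, …, w). The Leibniz sum is kept, since each descending factorial must be weighed
against its own M_i. -/
lemma pow_mul_norm_iteratedFDeriv_fourierT_le {ψ : RSp d → ℂ} (hψ : ContDiff ℝ ∞ ψ)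
    (hint : ∀ k n : ℕ, Integrable fun v => ‖v‖ ^ k * ‖iteratedFDeriv ℝ n ψ v‖) (n k : ℕ)
    (w : RSp d) :
    ‖w‖ ^ n * ‖iteratedFDeriv ℝ k (fourierT ψ) w‖ ≤
      ∫ v, ∑ i ∈ Finset.range (n + 1), n.choose i * k.descFactorial i *
        (‖v‖ ^ (k - i) * ‖iteratedFDeriv ℝ (n - i) ψ v‖) := by
  set L := scaledInner d with hL
  have hpi := Real.pi_pos
  have hRint : Integrable fun v => ∑ i ∈ Finset.range (n + 1), (n.choose i : ℝ) *
      k.descFactorial i * (‖v‖ ^ (k - i) * ‖iteratedFDeriv ℝ (n - i) ψ v‖) :=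
    integrable_finsetSum _ fun i _ => (hint _ _).const_mul _
  have hkey : ‖VectorFourier.fourierPowSMulRight (-L.flip)
      (iteratedFDeriv ℝ k (fourierT ψ)) w n‖ ≤
      ∫ v, ∑ i ∈ Finset.range (n + 1), n.choose i * k.descFactorial i *
        (‖v‖ ^ (k - i) * ‖iteratedFDeriv ℝ (n - i) ψ v‖) := by
    rw [fourierT_eq, VectorFourier.fourierPowSMulRight_iteratedFDeriv_fourierIntegral L
      (K := ⊤) (N := ⊤) hψ (fun k n _ _ => hint k n) le_top le_top]
    refine (VectorFourier.norm_fourierIntegral_le_integral_norm _ _ _ _ _).trans ?_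
    refine integral_mono_of_nonneg (Filter.Eventually.of_forall fun v => norm_nonneg _) hRint
      (Filter.Eventually.of_forall fun v => ?_)
    refine (VectorFourier.norm_iteratedFDeriv_fourierPowSMulRight_le_sum L hψ
      (by exact_mod_cast le_top) v).trans ?_
    exact mul_le_of_le_one_left (by positivity)
      (pow_le_one₀ (by positivity) (norm_scaledInner_le d))
  rcases eq_or_ne w 0 with rfl | hw
  · rcases Nat.eq_zero_or_pos n with rfl | hn
    · refine le_trans (le_of_eq ?_) ((ContinuousMultilinearMap.le_opNorm _
        (fun _ => (0 : RSp d))).trans ((mul_le_mul_of_nonneg_right hkey (by positivity)).trans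
          (by simp)))
      simp
    · rw [norm_zero, zero_pow hn.ne', zero_mul]
      exact integral_nonneg fun v => by positivity
  · have hw' : 0 < ‖w‖ := norm_pos_iff.2 hw
    have h2 := (ContinuousMultilinearMap.le_opNorm _ (fun _ => w)).trans
      (mul_le_mul_of_nonneg_right hkey (by positivity))
    rw [VectorFourier.fourierPowSMulRight_apply] at h2
    simp only [Finset.prod_const, Finset.card_univ, Fintype.card_fin] at h2
    rw [norm_smul, norm_smul] at h2
    have h4 : ‖((-L.flip) w) w‖ = (2 * Real.pi)⁻¹ * ‖w‖ ^ 2 := by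
      have : ((-L.flip) w) w = -((2 * Real.pi)⁻¹ * ‖w‖ ^ 2) := by
        rw [← real_inner_self_eq_norm_sq]; rfl
      rw [this, norm_neg, Real.norm_of_nonneg (by positivity)]
    rw [norm_pow, norm_pow, h4] at h2
    have h5 : ‖-(2 * (Real.pi : ℂ) * Complex.I)‖ = 2 * Real.pi := by
      simp [abs_of_pos hpi]
    rw [h5, ← mul_assoc, ← mul_pow, mul_inv_cancel_left₀ (by positivity), sq, mul_pow] at h2
    have hwn : 0 < ‖w‖ ^ n := by positivity
    refine le_of_mul_le_mul_right ?_ hwn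
    linarith

/-- Powers of |x| are traded for powers of ⟨x⟩ by ⟨x⟩^k ≤ 2^k (1 + |x|^k). The summand 1 is the
estimate without weight, where m^k ≤ C₄ M_k supplies the missing factor. -/
lemma IsWeightSequence.decayBound_of_pow_mul_norm (hM : IsWeightSequence M) {m H K C₄ : ℝ}
    (hm : 0 < m) (hH : 1 ≤ H) (hK0 : 0 ≤ K) (hC₄ : 0 ≤ C₄) (h4 : ∀ n : ℕ, m ^ n ≤ C₄ * M n)
    {g : RSp d → ℂ} (hfin : ∀ (n k : ℕ) (w : RSp d), m ^ (n + k) * (‖w‖ ^ n *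
      ‖iteratedFDeriv ℝ k g w‖) ≤ K * (2 * H) ^ (n + k) * (M n * M k)) :
    ∃ A, DecayBound M ((4 * H)⁻¹ * m) A g := by
  have hH0 : 0 < H := by linarith
  refine ⟨K * (1 + C₄), fun n k x => ?_⟩
  have hn := hM.pos n
  have hk := hM.pos k
  have hj : jb x ^ k ≤ 2 ^ k * (1 + ‖x‖ ^ k) := by
    have h0 := norm_nonneg x
    calc jb x ^ k ≤ (1 + ‖x‖) ^ k := by gcongr; exacts [(jb_pos x).le, jb_le x]
      _ ≤ 2 ^ (k - 1) * (1 ^ k + ‖x‖ ^ k) := add_pow_le zero_le_one h0 k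
      _ ≤ _ := by
        rw [one_pow]; gcongr; exacts [one_le_two, Nat.sub_le _ _]
  have h0 := hfin 0 n x
  have h1 := hfin k n x
  set D := ‖iteratedFDeriv ℝ n g x‖ with hD
  have hD0 : 0 ≤ D := norm_nonneg _
  rw [pow_zero, one_mul, zero_add, hM.zero, one_mul] at h0
  have h5 := h4 k
  have hjb := (jb_pos x).le
  rw [inv_mul_eq_div, div_pow, div_mul_eq_mul_div, div_mul_eq_mul_div, div_le_iff₀ (by positivity)]
  have h6 : m ^ k * (m ^ n * D) ≤ C₄ * M k * (K * (2 * H) ^ (n + k) * M n) := by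
    refine mul_le_mul h5 (h0.trans ?_) (by positivity) (by positivity)
    gcongr
    · linarith
    · omega
  rw [add_comm k n] at h1
  calc m ^ (n + k) * jb x ^ k * D ≤ m ^ (n + k) * (2 ^ k * (1 + ‖x‖ ^ k)) * D := by gcongr
    _ = 2 ^ k * (m ^ k * (m ^ n * D) + m ^ (n + k) * (‖x‖ ^ k * D)) := by rw [pow_add]; ring
    _ ≤ 2 ^ k * (C₄ * M k * (K * (2 * H) ^ (n + k) * M n) +
        K * (2 * H) ^ (n + k) * (M k * M n)) := by gcongr
    _ = 2 ^ k * (K * (1 + C₄) * (M n * M k) * (2 * H) ^ (n + k)) := by ring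
    _ ≤ 2 ^ (n + k) * (K * (1 + C₄) * (M n * M k) * (2 * H) ^ (n + k)) := by
        gcongr
        · exact one_le_two
        · omega
    _ = K * (1 + C₄) * (M n * M k) * (2 ^ (n + k) * (2 * H) ^ (n + k)) := by ring
    _ = _ := by rw [← mul_pow]; congr 2; ring

/-- In the i-th Leibniz term i derivatives and i powers of v disappear at once, which costs m^{2i}
i!, up to 2^k. This is O(M_i²), and the two factors M_i restore M_{n-i} to M_n and M_{k-i} to M_k.
-/
lemma DecayBound.exists_fourierT (hM : IsWeightSequence M) (d : ℕ) :
    ∃ c : ℝ, 0 < c ∧ ∀ (m A : ℝ) (ψ : RSp d → ℂ), 0 < m → ContDiff ℝ ∞ ψ → DecayBound M m A ψ →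
      ∃ A', DecayBound M (c * m) A' (fourierT ψ) := by
  obtain ⟨H, hH, hs⟩ := hM.exists_integrable_majorant d
  have hH0 : 0 < H := by linarith
  refine ⟨(4 * H)⁻¹, by positivity, fun m A ψ hm hψ h => ?_⟩
  obtain ⟨C, hC, hs⟩ := hs m hm
  have hA := h.nonneg hM
  obtain ⟨C₂, hC₂, h2⟩ := hM.exists_factorial_le (m ^ 2) (by positivity)
  obtain ⟨C₃, hC₃, h3⟩ := hM.one_le_const_mul
  obtain ⟨C₄, hC₄, h4⟩ := hM.exists_pow_le m hm
  set I : ℝ := ∫ x : RSp d, (jb x ^ (d + 1))⁻¹ with hI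
  have hI0 : 0 ≤ I := integral_nonneg fun x => by have := jb_pos x; positivity
  have hint := fun k n => h.integrable_pow_mul hM hm hψ k n
  set K : ℝ := C * A * C₂ * C₃ * I with hK
  have hK0 : 0 ≤ K := by positivity
  have hterm : ∀ (n k i : ℕ), i ≤ n → ∀ v : RSp d, (n.choose i : ℝ) * k.descFactorial i *
      (‖v‖ ^ (k - i) * ‖iteratedFDeriv ℝ (n - i) ψ v‖) ≤
      n.choose i * (2 ^ k * (H ^ k * (C * A * C₂ * C₃) * (M n * M k)) / m ^ (n + k)
        * (jb v ^ (d + 1))⁻¹) := by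
    intro n k i hi v
    have hj := jb_pos v
    have hn := hM.pos n
    have hk := hM.pos k
    -- For i > k the subtraction k - i is truncated, but then the descending factorial vanishes.
    rcases lt_or_ge k i with hki | hki
    · rw [Nat.descFactorial_eq_zero_iff_lt.2 hki]
      simp only [Nat.cast_zero, mul_zero, zero_mul]
      positivity
    rw [mul_assoc]
    refine mul_le_mul_of_nonneg_left ?_ (by positivity)
    have e1 : (k.descFactorial i : ℝ) ≤ 2 ^ k * i.factorial := by
      rw [Nat.descFactorial_eq_factorial_mul_choose]
      push_cast
      have : (k.choose i : ℝ) ≤ 2 ^ k := by exact_mod_cast Nat.choose_le_two_pow k i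
      rw [mul_comm]
      gcongr
    have hMi := hM.pos i
    have hMn := hM.pos (n - i)
    have hMk := hM.pos (k - i)
    have e2 : m ^ (2 * i) * i.factorial ≤ C₂ * C₃ * (M i * M i) := by
      have := h2 i
      rw [← pow_mul] at this
      calc _ ≤ C₂ * M i * 1 := by linarith
        _ ≤ C₂ * M i * (C₃ * M i) := by gcongr; exact h3 i
        _ = _ := by ring
    have e3 := hs A ψ h (n - i) (k - i) v
    have e4 : M i * M (n - i) ≤ M n := by
      have := hM.mul_le i (n - i); rwa [Nat.add_sub_cancel' hi] at this
    have e5 : M i * M (k - i) ≤ M k := by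
      have := hM.mul_le i (k - i); rwa [Nat.add_sub_cancel' hki] at this
    have e6 : H ^ (k - i) ≤ H ^ k := pow_le_pow_right₀ hH (Nat.sub_le _ _)
    have e7 : m ^ (n + k) = m ^ (2 * i) * m ^ (n - i + (k - i)) := by
      rw [← pow_add]; congr 1; omega
    have e8 : ‖v‖ ^ (k - i) ≤ jb v ^ (k - i) := by gcongr; exact norm_le_jb v
    rw [div_mul_eq_mul_div, le_div_iff₀ (by positivity), e7]
    set D := ‖iteratedFDeriv ℝ (n - i) ψ v‖ with hD
    have hD0 : 0 ≤ D := norm_nonneg _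
    calc _ ≤ (2 ^ k * i.factorial) * (jb v ^ (k - i) * D) *
          (m ^ (2 * i) * m ^ (n - i + (k - i))) := by gcongr
      _ = 2 ^ k * (m ^ (2 * i) * i.factorial) * (m ^ (n - i + (k - i)) * jb v ^ (k - i) * D) := by
          ring
      _ ≤ 2 ^ k * (C₂ * C₃ * (M i * M i)) *
          (C * A * H ^ k * (M (n - i) * M (k - i)) * (jb v ^ (d + 1))⁻¹) := by
          refine mul_le_mul (mul_le_mul_of_nonneg_left e2 (by positivity)) (e3.trans ?_)
            (by positivity) (by positivity)
          gcongr
      _ = 2 ^ k * (H ^ k * (C * A * C₂ * C₃)) * ((M i * M (n - i)) * (M i * M (k - i))) *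
          (jb v ^ (d + 1))⁻¹ := by ring
      _ ≤ 2 ^ k * (H ^ k * (C * A * C₂ * C₃)) * (M n * M k) * (jb v ^ (d + 1))⁻¹ := by
          refine mul_le_mul_of_nonneg_right (mul_le_mul_of_nonneg_left
            (mul_le_mul e4 e5 (by positivity) (by positivity)) (by positivity)) (by positivity)
      _ = _ := by ring
  have hfin : ∀ (n k : ℕ) (w : RSp d), m ^ (n + k) * (‖w‖ ^ n *
      ‖iteratedFDeriv ℝ k (fourierT ψ) w‖) ≤ K * (2 * H) ^ (n + k) * (M n * M k) := by
    intro n k w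
    have hn := hM.pos n
    have hk := hM.pos k
    have h5 := (pow_mul_norm_iteratedFDeriv_fourierT_le hψ hint n k w).trans
      (integral_mono (integrable_finsetSum _ fun i _ => (hint _ _).const_mul _)
        (integrable_finsetSum _ fun i _ => ((integrable_inv_jb_pow d).const_mul
          (2 ^ k * (H ^ k * (C * A * C₂ * C₃) * (M n * M k)) / m ^ (n + k))).const_mul
            (n.choose i : ℝ))
        fun v => Finset.sum_le_sum fun i hi =>
          hterm n k i (Nat.lt_succ_iff.1 (Finset.mem_range.1 hi)) v)
    simp only [← Finset.sum_mul] at h5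
    rw [integral_const_mul, integral_const_mul, ← hI, ← Nat.cast_sum,
      Nat.sum_range_choose] at h5
    calc _ ≤ m ^ (n + k) * (((2 ^ n : ℕ) : ℝ) * (2 ^ k * (H ^ k * (C * A * C₂ * C₃) *
          (M n * M k)) / m ^ (n + k) * I)) := by gcongr
      _ = K * (2 ^ n * 2 ^ k * (1 * H ^ k)) * (M n * M k) := by
          push_cast; rw [hK]; field_simp
      _ ≤ K * (2 ^ n * 2 ^ k * (H ^ n * H ^ k)) * (M n * M k) := by
          gcongr; exact one_le_pow₀ hH
      _ = _ := by rw [mul_pow, pow_add, pow_add]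
  exact hM.decayBound_of_pow_mul_norm hm hH hK0 (by linarith) h4 hfin

lemma IsWeightSequence.fourierT_mem_spaceS (hM : IsWeightSequence M) {t : UltraType}
    {ψ : RSp d → ℂ} (hψ : ψ ∈ spaceS d M t) : fourierT ψ ∈ spaceS d M t := by
  rw [hM.mem_spaceS_iff] at hψ ⊢
  obtain ⟨c, hc, h⟩ := DecayBound.exists_fourierT hM d
  obtain ⟨m, hm, ⟨A, hA⟩, -⟩ := UltraType.exists_of_forTest_of_forDual (Q := fun _ => True) hψ.2
    (by cases t; exacts [⟨1, one_pos, trivial⟩, fun _ _ => trivial])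
  refine ⟨hA.contDiff_fourierT hM hm hψ.1, hψ.2.scale hc fun m hm ⟨A, hA⟩ => ?_⟩
  exact h m A ψ hm hψ.1 hA

/-- Products of test functions with functions of growth `exp (M (k ‖η‖))` are integrable. -/
lemma DecayBound.exists_exp_assocFun_mul_le (hM : IsWeightSequence M) (d : ℕ) :
    ∃ c : ℝ, 0 < c ∧ ∀ (m A : ℝ) (ψ : RSp d → ℂ), 0 < m → DecayBound M m A ψ →
      ∃ C : ℝ, ∀ k, 0 ≤ k → k ≤ c * m → ∀ η,
        Real.exp (assocFun M (k * ‖η‖)) * ‖ψ η‖ ≤ C * (jb η ^ (d + 1))⁻¹ := by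
  obtain ⟨H, hH, hs⟩ := hM.exists_integrable_majorant d
  have hH0 : 0 < H := by linarith
  refine ⟨H⁻¹, by positivity, fun m A ψ hm h => ?_⟩
  obtain ⟨C, hC, hs⟩ := hs m hm
  have hA := h.nonneg hM
  refine ⟨C * A, fun k hk hkm η => ?_⟩
  have hj := jb_pos η
  -- Each term of the supremum defining e^{M(k|η|)} is bounded separately, by the decay of ψ with p
  -- powers of the weight.
  have hest : ∀ p, (k * ‖η‖) ^ p / M p * ‖ψ η‖ ≤ C * A * (jb η ^ (d + 1))⁻¹ := fun p => by
    have hp := hM.pos p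
    have h1 := hs A ψ h 0 p η
    rw [norm_iteratedFDeriv_zero, hM.zero, one_mul, zero_add] at h1
    rw [div_mul_eq_mul_div, div_le_iff₀ hp]
    have h2 : k * ‖η‖ ≤ H⁻¹ * m * jb η := mul_le_mul hkm (norm_le_jb η) (norm_nonneg _)
      (by positivity)
    calc _ ≤ (H⁻¹ * m * jb η) ^ p * ‖ψ η‖ := by gcongr
      _ = (H⁻¹) ^ p * (m ^ p * jb η ^ p * ‖ψ η‖) := by rw [mul_pow, mul_pow]; ring
      _ ≤ (H⁻¹) ^ p * (C * A * H ^ p * M p * (jb η ^ (d + 1))⁻¹) := by gcongr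
      _ = ((H⁻¹) ^ p * H ^ p) * (C * A * (jb η ^ (d + 1))⁻¹ * M p) := by ring
      _ = _ := by rw [← mul_pow, inv_mul_cancel₀ hH0.ne', one_pow, one_mul]
  rcases (norm_nonneg (ψ η)).eq_or_lt with h0 | h0
  · rw [← h0, mul_zero]; positivity
  rw [← le_div_iff₀ h0]
  refine hM.exp_assocFun_le (by positivity) ?_ fun p => ?_
  · rw [le_div_iff₀ h0]
    simpa [hM.zero] using hest 0
  · rw [le_div_iff₀ h0]; exact hest p

end

section

variable {d : ℕ} {M : ℕ → ℝ}

/-! ### Quotients of exponentials -/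

/-- On the ball of radius `ε` about `ξ₀`, the exponentials `e^{-xξ}` are dominated by
`e^{-ε|x|}` times the largest of the finitely many `e^{-xb}`, `b ∈ F`; and `r` is so small that
these do not oscillate on the strip of width `r`. -/
structure IsExpFrame (F : Finset (RSp d)) (ξ₀ : RSp d) (ε r : ℝ) : Prop where
  eps_pos : 0 < ε
  r_pos : 0 < r
  norm_le : ∀ b ∈ F, r * ‖b‖ ≤ 1
  dominated : ∀ ξ ∈ Metric.closedBall ξ₀ ε, ∀ x : RSp d,
    ∃ b ∈ F, -inner ℝ x ξ + ε * ‖x‖ ≤ -inner ℝ x b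

/-- If x·b ≥ x·ξ₀ - δ/4 held for a unit vector x and all b ∈ B, it would hold on the hull, which
however contains ξ₀ - (δ/2) x. So each direction has a b below this level; compactness of the sphere
leaves finitely many, and homogeneity gives all x. -/
lemma exists_isExpFrame {B : Set (RSp d)} (hB : IsOpen B) {ξ₀ : RSp d}
    (hξ₀ : ξ₀ ∈ convexHull ℝ B) :
    ∃ (F : Finset (RSp d)) (ε r : ℝ), ↑F ⊆ B ∧ IsExpFrame F ξ₀ ε r := by
  obtain ⟨δ, hδ, hball⟩ := Metric.isOpen_iff.1 hB.convexHull ξ₀ hξ₀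
  have hex : ∀ x ∈ Metric.sphere (0 : RSp d) 1, ∃ b ∈ B,
      inner ℝ x b < inner ℝ x ξ₀ - δ / 4 := by
    intro x hx
    by_contra! hcon
    have h1 : convexHull ℝ B ⊆ {y | inner ℝ x ξ₀ - δ / 4 ≤ inner ℝ x y} :=
      convexHull_min hcon (convex_halfSpace_ge (innerSL ℝ x).isLinear _)
    have hx1 : ‖x‖ = 1 := by simpa using hx
    have h2 : ξ₀ - (δ / 2) • x ∈ convexHull ℝ B := by
      refine hball ?_
      rw [mem_ball_iff_norm, sub_sub_cancel_left, norm_neg, norm_smul, hx1, mul_one,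
        Real.norm_of_nonneg (by positivity)]
      linarith
    have h3 := h1 h2
    simp only [Set.mem_ofPred_eq, inner_sub_right, inner_smul_right, real_inner_self_eq_norm_sq,
      hx1] at h3
    linarith
  obtain ⟨F', hF'B, hF'fin, hF'⟩ := (isCompact_sphere (0 : RSp d) 1).elim_finite_subcover_image
    (b := B) (c := fun b => {x | inner ℝ x b < inner ℝ x ξ₀ - δ / 4})
    (fun b _ => isOpen_lt (by fun_prop) (by fun_prop))
    (fun x hx => by
      obtain ⟨b, hb, h⟩ := hex x hx
      exact Set.mem_iUnion₂.2 ⟨b, hb, h⟩)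
  -- Needed for x = 0, in particular in dimension zero, where the sphere is empty.
  obtain ⟨b₀, hb₀⟩ : B.Nonempty := convexHull_nonempty_iff.1 ⟨ξ₀, hξ₀⟩
  classical
  set F : Finset (RSp d) := insert b₀ hF'fin.toFinset with hF
  have hFB : ↑F ⊆ B := by
    intro b hb
    simp only [hF, Finset.coe_insert, Set.Finite.coe_toFinset, Set.mem_insert_iff] at hb
    rcases hb with rfl | hb
    exacts [hb₀, hF'B hb]
  have hsum : 0 ≤ ∑ b ∈ F, ‖b‖ := Finset.sum_nonneg fun _ _ => norm_nonneg _
  -- Of the gain δ/4, one half is spent on moving ξ within the ball of radius δ/8, and the other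
  -- half is the remaining decay.
  refine ⟨F, δ / 8, (1 + ∑ b ∈ F, ‖b‖)⁻¹, hFB, by positivity, by positivity, fun b hb => ?_,
    fun ξ hξ x => ?_⟩
  · rw [inv_mul_le_iff₀ (by positivity)]
    have := Finset.single_le_sum (f := fun b : RSp d => ‖b‖) (fun _ _ => norm_nonneg _) hb
    linarith
  · rcases eq_or_ne x 0 with rfl | hx
    · exact ⟨b₀, Finset.mem_insert_self _ _, by simp⟩
    have hx' : 0 < ‖x‖ := norm_pos_iff.2 hx
    have hu : ‖x‖⁻¹ • x ∈ Metric.sphere (0 : RSp d) 1 := by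
      rw [mem_sphere_zero_iff_norm, norm_smul, norm_inv, norm_norm, inv_mul_cancel₀ hx'.ne']
    obtain ⟨b, hb, hbx⟩ := Set.mem_iUnion₂.1 (hF' hu)
    refine ⟨b, Finset.mem_insert_of_mem (hF'fin.mem_toFinset.2 hb), ?_⟩
    simp only [Set.mem_ofPred_eq, real_inner_smul_left] at hbx
    have h1 : inner ℝ x b < inner ℝ x ξ₀ - δ / 4 * ‖x‖ := by
      have := mul_lt_mul_of_pos_left hbx hx'
      rw [mul_sub, mul_inv_cancel_left₀ hx'.ne', mul_inv_cancel_left₀ hx'.ne'] at this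
      linarith
    have h2 : inner ℝ x (ξ₀ - ξ) ≤ ‖x‖ * (δ / 8) := by
      refine (real_inner_le_norm _ _).trans ?_
      gcongr
      rw [norm_sub_rev]
      exact mem_closedBall_iff_norm.1 hξ
    rw [inner_sub_right] at h2
    linarith

/-- The linear form `w ↦ z · w`. -/
noncomputable def cdotL (z : CSp d) : CSp d →ₗ[ℂ] ℂ where
  toFun w := cdot z w
  map_add' v w := by simp [cdot, mul_add, Finset.sum_add_distrib]
  map_smul' a w := by
    simp only [cdot, PiLp.smul_apply, smul_eq_mul, RingHom.id_apply, Finset.mul_sum]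
    exact Finset.sum_congr rfl fun j _ => by ring

lemma cdot_add (z v w : CSp d) : cdot z (v + w) = cdot z v + cdot z w := (cdotL z).map_add v w

lemma analyticAt_cdot (w z : CSp d) : AnalyticAt ℂ (fun z : CSp d => cdot z w) z := by
  unfold cdot
  refine Finset.analyticAt_fun_sum _ fun j _ => ?_
  exact ((EuclideanSpace.proj (𝕜 := ℂ) j).analyticAt z).mul analyticAt_const

lemma re_cdot (z w : CSp d) :
    (cdot z w).re = inner ℝ (reE z) (reE w) - inner ℝ (imE z) (imE w) := by
  simp [cdot, PiLp.inner_apply, Finset.sum_sub_distrib, mul_comm]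

lemma im_cdot (z w : CSp d) :
    (cdot z w).im = inner ℝ (reE z) (imE w) + inner ℝ (imE z) (reE w) := by
  simp [cdot, PiLp.inner_apply, Finset.sum_add_distrib, mul_comm]

lemma cdot_ofRealE (x y : RSp d) :
    cdot (ofRealE d x) (ofRealE d y) = ((inner ℝ x y : ℝ) : ℂ) := by
  simp [cdot, PiLp.inner_apply, mul_comm]

/-- The sum of the exponentials `e^{-zb}`, `b ∈ F`. -/
noncomputable def expSum (F : Finset (RSp d)) (z : CSp d) : ℂ :=
  ∑ b ∈ F, Complex.exp (-cdot z (ofRealE d b))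

/-- The quotient `θ_ζ(z) = e^{-zζ} / ∑_{b ∈ F} e^{-zb}`. -/
noncomputable def expQuot (F : Finset (RSp d)) (ζ z : CSp d) : ℂ :=
  Complex.exp (-cdot z ζ) / expSum F z

namespace IsExpFrame

variable {F : Finset (RSp d)} {ξ₀ : RSp d} {ε r : ℝ}

/-- In the strip the phases z·b have imaginary part at most 1 in absolute value, so each cosine is
at least 1/2 and the exponentials cannot cancel. -/
lemma le_norm_expSum (hF : IsExpFrame F ξ₀ ε r) {z : CSp d} (hz : z ∈ strip d r) :
    1 / 2 * ∑ b ∈ F, Real.exp (-inner ℝ (reE z) b) ≤ ‖expSum F z‖ := by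
  refine le_trans ?_ (Complex.re_le_norm _)
  rw [expSum, Complex.re_sum, Finset.mul_sum]
  refine Finset.sum_le_sum fun b hb => ?_
  rw [Complex.exp_re, Complex.neg_re, Complex.neg_im, Real.cos_neg, re_cdot, im_cdot]
  simp only [reE_ofRealE, imE_ofRealE, inner_zero_right, sub_zero, zero_add]
  rw [mul_comm]
  gcongr
  have h1 : |inner ℝ (imE z) b| ≤ 1 :=
    (abs_real_inner_le_norm _ _).trans (le_trans (by gcongr; exact le_of_lt hz) (hF.norm_le b hb))
  have h2 := Real.one_sub_sq_div_two_le_cos (x := inner ℝ (imE z) b)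
  have h3 : inner ℝ (imE z) b ^ 2 ≤ 1 := by rw [← sq_abs]; exact pow_le_one₀ (abs_nonneg _) h1
  linarith

lemma exists_mem (hF : IsExpFrame F ξ₀ ε r) : F.Nonempty := by
  obtain ⟨b, hb, -⟩ := hF.dominated ξ₀ (Metric.mem_closedBall_self hF.eps_pos.le) 0
  exact ⟨b, hb⟩

lemma expSum_ne_zero (hF : IsExpFrame F ξ₀ ε r) {z : CSp d} (hz : z ∈ strip d r) :
    expSum F z ≠ 0 := by
  have h := hF.le_norm_expSum hz
  have : 0 < ∑ b ∈ F, Real.exp (-inner ℝ (reE z) b) :=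
    Finset.sum_pos (fun b _ => Real.exp_pos _) hF.exists_mem
  exact norm_pos_iff.1 (lt_of_lt_of_le (by positivity) h)

lemma analyticOnNhd_expQuot (hF : IsExpFrame F ξ₀ ε r) (ζ : CSp d) :
    AnalyticOnNhd ℂ (expQuot F ζ) (strip d r) := fun z hz => by
  refine AnalyticAt.div (analyticAt_cdot ζ z).neg.cexp ?_ (hF.expSum_ne_zero hz)
  unfold expSum
  exact Finset.analyticAt_fun_sum _ fun b _ => (analyticAt_cdot _ z).neg.cexp

/-- The one exponential e^{-zb} that dominates in the direction Re z already bounds the denominator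
from below. -/
lemma norm_expQuot_le (hF : IsExpFrame F ξ₀ ε r) {ζ z : CSp d}
    (hζ : reE ζ ∈ Metric.closedBall ξ₀ ε) (hz : z ∈ strip d r) :
    ‖expQuot F ζ z‖ ≤ 2 * Real.exp (‖imE z‖ * ‖imE ζ‖) * Real.exp (-(ε * ‖reE z‖)) := by
  obtain ⟨b, hb, h⟩ := hF.dominated _ hζ (reE z)
  have h1 := hF.le_norm_expSum hz
  have h2 := Finset.single_le_sum (f := fun b => Real.exp (-inner ℝ (reE z) b))
    (fun _ _ => (Real.exp_pos _).le) hb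
  have h0 : 0 < ‖expSum F z‖ := norm_pos_iff.2 (hF.expSum_ne_zero hz)
  rw [expQuot, norm_div, div_le_iff₀ h0, Complex.norm_exp, Complex.neg_re, re_cdot]
  have h3 : inner ℝ (imE z) (imE ζ) ≤ ‖imE z‖ * ‖imE ζ‖ := real_inner_le_norm _ _
  calc Real.exp (-(inner ℝ (reE z) (reE ζ) - inner ℝ (imE z) (imE ζ)))
      ≤ Real.exp (‖imE z‖ * ‖imE ζ‖ + -(ε * ‖reE z‖) + -inner ℝ (reE z) b) := by
        gcongr; linarith
    _ = 2 * Real.exp (‖imE z‖ * ‖imE ζ‖) * Real.exp (-(ε * ‖reE z‖)) *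
        (1 / 2 * Real.exp (-inner ℝ (reE z) b)) := by rw [Real.exp_add, Real.exp_add]; ring
    _ ≤ _ := by
        gcongr
        exact le_trans (by gcongr) h1

/-- The partition that writes e^{-xζ}T in terms of the tempered e^{-xb}T. -/
lemma sum_exp_mul_expQuot (hF : IsExpFrame F ξ₀ ε r) (ζ : CSp d) (x : RSp d) :
    ∑ b ∈ F, (Real.exp (-inner ℝ x b) : ℂ) * expQuot F ζ (ofRealE d x) =
      Complex.exp (-cdot (ofRealE d x) ζ) := by
  have h := hF.expSum_ne_zero (ofRealE_mem_strip x hF.r_pos)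
  rw [← Finset.sum_mul, expQuot, mul_div_assoc']
  rw [div_eq_iff h, mul_comm]
  congr 1
  rw [expSum]
  refine Finset.sum_congr rfl fun b _ => ?_
  rw [cdot_ofRealE]
  push_cast
  rfl

end IsExpFrame

/-- Estimates for functions of exponential type in the imaginary directions. -/
lemma IsWeightSequence.exists_decayBound_of_strip_exp (hM : IsWeightSequence M) {m ε r : ℝ}
    (hm : 0 < m) (hε : 0 < ε) (hr : 0 < r) :
    ∃ C : ℝ, 0 < C ∧ ∀ (G : CSp d → ℂ) (A ρ : ℝ), 0 ≤ A → 0 ≤ ρ →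
      AnalyticOnNhd ℂ G (strip d r) →
      (∀ z ∈ strip d r, ‖G z‖ ≤ A * Real.exp (‖imE z‖ * ρ) * Real.exp (-(ε * ‖reE z‖))) →
      DecayBound M m (A * C * Real.exp (assocFun M (2 * Real.exp 1 * m * ρ)))
        fun x => G (ofRealE d x) := by
  obtain ⟨C₁, hC₁, h1⟩ := hM.exists_pow_jb_le (d := d) hm hε
  obtain ⟨C₂, hC₂, h2⟩ := hM.exists_self_pow_le (4 * Real.exp 1 * m / r) (by positivity)
  refine ⟨Real.exp (ε * r) * C₁ * (C₂ + 1), by positivity, fun G A ρ hA0 hρ hG hA n k x => ?_⟩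
  have hn := hM.pos n
  have hk := hM.pos k
  -- With steps of width 1/σ the total radius n/σ stays below r, and the factor e^{|Im z|ρ} costs at
  -- most e^n. In return σ^n splits into a part of size (n/r)^n, controlled by M_n, and a part ρ^n,
  -- controlled by M_n e^{M(kρ)}.
  set σ : ℝ := 2 * (n + 1) / r + ρ with hσ
  have hσ0 : 0 < σ := by positivity
  have hns : (n : ℝ) * σ⁻¹ < r := by
    rw [← div_eq_mul_inv, div_lt_iff₀ hσ0, hσ, mul_add, mul_div_cancel₀ _ hr.ne']
    have : 0 ≤ r * ρ := by positivity
    linarith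
  have hnρ : (n : ℝ) * σ⁻¹ * ρ ≤ n := by
    rw [mul_assoc]
    refine mul_le_of_le_one_right (by positivity) ?_
    rw [inv_mul_le_iff₀ hσ0, mul_one, hσ]
    have : 0 ≤ 2 * ((n : ℝ) + 1) / r := by positivity
    linarith
  have hD := norm_iteratedFDeriv_comp_ofRealE_le (isOpen_strip r) hG (x := x) (n := n)
    (s := σ⁻¹) (A := A * Real.exp n * (Real.exp (ε * r) * Real.exp (-(ε * ‖x‖))))
    (by positivity) (closedBall_subset_strip x hns) (fun z hz => by
      have hi := norm_imE_le_of_mem hz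
      have hre := norm_reE_sub_le hz
      refine (hA z (closedBall_subset_strip x hns hz)).trans ?_
      rw [← Real.exp_add]
      have hx : ‖x‖ ≤ ‖reE z‖ + r := by
        have := norm_sub_norm_le x (reE z)
        rw [norm_sub_rev] at this
        linarith
      have e1 : ‖imE z‖ * ρ ≤ n := le_trans (by gcongr) hnρ
      have e2 : -(ε * ‖reE z‖) ≤ ε * r + -(ε * ‖x‖) := by nlinarith
      gcongr)
  rw [inv_pow, div_inv_eq_mul] at hD
  set E := Real.exp (assocFun M (2 * Real.exp 1 * m * ρ)) with hE
  have hE1 : 1 ≤ E := one_le_exp_assocFun _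
  have hpow : (m * (Real.exp 1 * σ)) ^ n ≤ (C₂ + 1) * E * M n := by
    have e1 : (m * (Real.exp 1 * σ)) ^ n ≤
        2 ^ n * ((m * Real.exp 1 * (2 * (n + 1) / r)) ^ n + (m * Real.exp 1 * ρ) ^ n) := by
      have := add_pow_le (a := m * Real.exp 1 * (2 * (n + 1) / r)) (b := m * Real.exp 1 * ρ)
        (by positivity) (by positivity) n
      rw [← mul_add, mul_assoc] at this
      refine this.trans ?_
      gcongr
      · exact one_le_two
      · exact Nat.sub_le _ _
    have e2 : (2 : ℝ) ^ n * (m * Real.exp 1 * (2 * (n + 1) / r)) ^ n ≤ C₂ * M n := by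
      refine le_trans (le_of_eq ?_) (h2 n)
      rw [← mul_pow]; congr 1; ring
    have e3 : (2 : ℝ) ^ n * (m * Real.exp 1 * ρ) ^ n ≤ E * M n := by
      rw [← div_le_iff₀ hn]
      refine le_trans (le_of_eq ?_) (hM.pow_div_le_exp_assocFun (by positivity) n)
      rw [← mul_pow]; congr 2; ring
    have e4 : C₂ * M n ≤ C₂ * E * M n := by
      gcongr; exact le_mul_of_one_le_right (by positivity) hE1
    rw [mul_add (2 ^ n : ℝ)] at e1
    linarith
  have hj := jb_pos x
  calc m ^ (n + k) * jb x ^ k * ‖iteratedFDeriv ℝ n (fun x => G (ofRealE d x)) x‖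
      ≤ m ^ (n + k) * jb x ^ k *
        (A * Real.exp n * (Real.exp (ε * r) * Real.exp (-(ε * ‖x‖))) * σ ^ n) := by gcongr
    _ = A * Real.exp (ε * r) * ((m * (Real.exp 1 * σ)) ^ n *
        (m ^ k * jb x ^ k * Real.exp (-(ε * ‖x‖)))) := by
        rw [← mul_one (n : ℝ), Real.exp_nat_mul, pow_add, mul_pow m, mul_pow _ σ]; ring
    _ ≤ A * Real.exp (ε * r) * (((C₂ + 1) * E * M n) * (C₁ * M k)) := by
        refine mul_le_mul_of_nonneg_left (mul_le_mul hpow (h1 k x) (by positivity)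
          (by positivity)) (by positivity)
    _ = _ := by ring

lemma IsExpFrame.exists_decayBound (hM : IsWeightSequence M) {F : Finset (RSp d)} {ξ₀ : RSp d}
    {ε r : ℝ} (hF : IsExpFrame F ξ₀ ε r) {m : ℝ} (hm : 0 < m) :
    ∃ C : ℝ, 0 < C ∧ ∀ ζ : CSp d, reE ζ ∈ Metric.closedBall ξ₀ ε →
      DecayBound M m (C * Real.exp (assocFun M (2 * Real.exp 1 * m * ‖imE ζ‖)))
        fun x => expQuot F ζ (ofRealE d x) := by
  obtain ⟨C, hC, h⟩ := hM.exists_decayBound_of_strip_exp (d := d) hm hF.eps_pos hF.r_pos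
  exact ⟨2 * C, by positivity, fun ζ hζ => h _ 2 ‖imE ζ‖ (by norm_num) (norm_nonneg _)
    (hF.analyticOnNhd_expQuot ζ) fun z hz => hF.norm_expQuot_le hζ hz⟩

lemma IsExpFrame.mem_spaceS (hM : IsWeightSequence M) {F : Finset (RSp d)} {ξ₀ : RSp d}
    {ε r : ℝ} (hF : IsExpFrame F ξ₀ ε r) (t : UltraType) {ζ : CSp d}
    (hζ : reE ζ ∈ Metric.closedBall ξ₀ ε) :
    (fun x => expQuot F ζ (ofRealE d x)) ∈ spaceS d M t := by
  rw [hM.mem_spaceS_iff]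
  refine ⟨contDiff_comp_ofRealE hF.r_pos (hF.analyticOnNhd_expQuot ζ),
    UltraType.forTest_of_forall fun m hm => ?_⟩
  obtain ⟨C, -, h⟩ := hF.exists_decayBound hM hm
  exact ⟨_, h ζ hζ⟩

/-! ### Power series expansion -/

/-- Every term of the tail has degree at least N, so ρ^N can be taken out of the tail of the series
for e^b. -/
lemma norm_exp_sub_sum_le {u : ℂ} {ρ b : ℝ} (hρ : 0 ≤ ρ) (hρ1 : ρ ≤ 1) (hb : 0 ≤ b)
    (hu : ‖u‖ ≤ ρ * b) (N : ℕ) :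
    ‖Complex.exp u - ∑ n ∈ Finset.range N, u ^ n / n.factorial‖ ≤ ρ ^ N * Real.exp b := by
  have hs : ∀ a : ℝ, HasSum (fun n : ℕ => a ^ (n + N) / (n + N).factorial)
      (Real.exp a - ∑ n ∈ Finset.range N, a ^ n / n.factorial) := fun a => by
    have := NormedSpace.expSeries_div_hasSum_exp (𝔸 := ℝ) a
    rw [← Real.exp_eq_exp_ℝ] at this
    exact (hasSum_nat_add_iff' (f := fun n : ℕ => a ^ n / (n.factorial : ℝ)) N).2 this
  refine (Complex.norm_exp_sub_sum_le_exp_norm_sub_sum u N).trans ?_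
  have h := hasSum_le (fun n => ?_) (hs ‖u‖) ((hs b).mul_left (ρ ^ N))
  · refine h.trans ?_
    gcongr
    have : 0 ≤ ∑ n ∈ Finset.range N, b ^ n / (n.factorial : ℝ) :=
      Finset.sum_nonneg fun n _ => by positivity
    linarith
  · rw [mul_div_assoc']
    gcongr
    calc ‖u‖ ^ (n + N) ≤ (ρ * b) ^ (n + N) := by gcongr
      _ = ρ ^ n * (ρ ^ N * b ^ (n + N)) := by rw [mul_pow, pow_add ρ]; ring
      _ ≤ 1 * (ρ ^ N * b ^ (n + N)) := by gcongr; exact pow_le_one₀ hρ hρ1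
      _ = _ := one_mul _

/-- Estimates for the terms and the remainders of the power series of `ζ ↦ θ_ζ`. -/
lemma IsExpFrame.exists_decayBound_series (hM : IsWeightSequence M) {F : Finset (RSp d)}
    {ξ₀ : RSp d} {ε r : ℝ} (hF : IsExpFrame F ξ₀ ε r) {m : ℝ} (hm : 0 < m) {ζ : CSp d}
    (hζ : reE ζ ∈ Metric.closedBall ξ₀ ε) :
    ∃ C : ℝ, 0 < C ∧
      (∀ (n : ℕ) (w : Fin n → CSp d),
        DecayBound M m (C * (n.factorial / (ε / 2) ^ n * ∏ i, ‖w i‖))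
        fun x => expQuot F ζ (ofRealE d x) * ∏ i, cdot (ofRealE d x) (w i)) ∧
      ∀ w : CSp d, ‖w‖ ≤ ε / 2 → ∀ N : ℕ, DecayBound M m (C * (‖w‖ / (ε / 2)) ^ N)
        fun x => expQuot F ζ (ofRealE d x) * (Complex.exp (-cdot (ofRealE d x) w) -
          ∑ n ∈ Finset.range N, (-cdot (ofRealE d x) w) ^ n / n.factorial) := by
  have hε := hF.eps_pos
  have hr := hF.r_pos
  obtain ⟨C, hC, h⟩ := hM.exists_decayBound_of_strip (d := d) hm (half_pos hε) hr
  -- Half of the decay of θ_ζ pays for e^{δ|z|}, which dominates the polynomials and exponential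
  -- remainders; the other half survives.
  set δ : ℝ := ε / 2 with hδ
  have hδ0 : 0 < δ := by positivity
  set A : ℝ := 2 * Real.exp (r * ‖imE ζ‖) * Real.exp (δ * r) with hA
  have hA0 : 0 < A := by positivity
  have hbase : ∀ z ∈ strip d r, ‖expQuot F ζ z‖ * Real.exp (δ * ‖z‖) ≤
      A * Real.exp (-(ε / 2 * ‖reE z‖)) := fun z hz => by
    have hz' : ‖imE z‖ ≤ r := le_of_lt hz
    have h1 := norm_le_reE_add_imE z
    calc _ ≤ 2 * Real.exp (‖imE z‖ * ‖imE ζ‖) * Real.exp (-(ε * ‖reE z‖)) *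
          Real.exp (δ * (‖reE z‖ + r)) := by
          gcongr
          · exact hF.norm_expQuot_le hζ hz
          · linarith
      _ ≤ 2 * Real.exp (r * ‖imE ζ‖) * Real.exp (-(ε * ‖reE z‖)) *
          Real.exp (δ * (‖reE z‖ + r)) := by gcongr
      _ = 2 * Real.exp (r * ‖imE ζ‖) * (Real.exp (-(ε * ‖reE z‖)) *
          Real.exp (δ * (‖reE z‖ + r))) := by ring
      _ = 2 * Real.exp (r * ‖imE ζ‖) * (Real.exp (δ * r) *
          Real.exp (-(ε / 2 * ‖reE z‖))) := by
          rw [← Real.exp_add, ← Real.exp_add]; congr 2; rw [hδ]; ring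
      _ = _ := by rw [hA]; ring
  refine ⟨A * C, by positivity, fun n w => ?_, fun w hw N => ?_⟩
  · set p := ∏ i, ‖w i‖ with hp
    have hp0 : 0 ≤ p := Finset.prod_nonneg fun _ _ => norm_nonneg _
    refine (h (fun z => expQuot F ζ z * ∏ i, cdot z (w i)) (A * (n.factorial / δ ^ n * p))
      (fun z hz => (hF.analyticOnNhd_expQuot ζ z hz).mul
        (Finset.analyticAt_fun_prod _ fun i _ => analyticAt_cdot _ z)) fun z hz => ?_).mono hM
          (le_of_eq (by ring))
    have h1 : ‖∏ i, cdot z (w i)‖ ≤ ‖z‖ ^ n * p := by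
      rw [norm_prod]
      calc _ ≤ ∏ i : Fin n, (‖z‖ * ‖w i‖) :=
            Finset.prod_le_prod (fun _ _ => norm_nonneg _) fun i _ => norm_cdot_le _ _
        _ = _ := by rw [Finset.prod_mul_distrib]; simp [hp]
    have h2 : ‖z‖ ^ n ≤ n.factorial / δ ^ n * Real.exp (δ * ‖z‖) := by
      have := Real.pow_div_factorial_le_exp (δ * ‖z‖) (by positivity) n
      rw [div_le_iff₀ (by positivity), mul_pow] at this
      rw [div_mul_eq_mul_div, le_div_iff₀ (by positivity)]
      linarith
    rw [norm_mul]
    calc _ ≤ ‖expQuot F ζ z‖ * (n.factorial / δ ^ n * Real.exp (δ * ‖z‖) * p) := by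
          gcongr; exact h1.trans (by gcongr)
      _ = (n.factorial / δ ^ n * p) * (‖expQuot F ζ z‖ * Real.exp (δ * ‖z‖)) := by ring
      _ ≤ (n.factorial / δ ^ n * p) * (A * Real.exp (-(ε / 2 * ‖reE z‖))) := by
          exact mul_le_mul_of_nonneg_left (hbase z hz) (by positivity)
      _ = _ := by ring
  · refine (h (fun z => expQuot F ζ z * (Complex.exp (-cdot z w) -
        ∑ n ∈ Finset.range N, (-cdot z w) ^ n / n.factorial)) (A * (‖w‖ / δ) ^ N)
      (fun z hz => (hF.analyticOnNhd_expQuot ζ z hz).mul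
        ((analyticAt_cdot _ z).neg.cexp.sub (Finset.analyticAt_fun_sum _ fun n _ =>
          ((analyticAt_cdot _ z).neg.pow n).div_const))) fun z hz => ?_).mono hM
          (le_of_eq (by ring))
    have h1 := norm_exp_sub_sum_le (u := -cdot z w) (ρ := ‖w‖ / δ) (b := δ * ‖z‖) (by positivity)
      ((div_le_one hδ0).2 hw) (by positivity) (by
        rw [norm_neg]; refine (norm_cdot_le _ _).trans (le_of_eq ?_); field_simp) N
    rw [norm_mul]
    calc _ ≤ ‖expQuot F ζ z‖ * ((‖w‖ / δ) ^ N * Real.exp (δ * ‖z‖)) := by gcongr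
      _ = (‖w‖ / δ) ^ N * (‖expQuot F ζ z‖ * Real.exp (δ * ‖z‖)) := by ring
      _ ≤ (‖w‖ / δ) ^ N * (A * Real.exp (-(ε / 2 * ‖reE z‖))) :=
          mul_le_mul_of_nonneg_left (hbase z hz) (by positivity)
      _ = _ := by ring

end

section

variable {d : ℕ} {M : ℕ → ℝ}

/-! ### Integrals of families of test functions -/

lemma LinearIsometryEquiv.integral_comp_comm' {α X Y : Type*} [MeasurableSpace α] {μ : Measure α}
    [NormedAddCommGroup X] [NormedSpace ℝ X] [NormedAddCommGroup Y] [NormedSpace ℝ Y]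
    (Φ : X ≃ₗᵢ[ℝ] Y) (f : α → X) : ∫ a, Φ (f a) ∂μ = Φ (∫ a, f a ∂μ) :=
  Φ.toContinuousLinearEquiv.integral_comp_comm f

/-- Differentiation under the integral sign, to all orders. -/
lemma iteratedFDeriv_integral {α E F : Type*} [MeasurableSpace α] {μ : Measure α}
    [NormedAddCommGroup E] [NormedSpace ℝ E] [NormedAddCommGroup F] [NormedSpace ℝ F]
    [CompleteSpace F] {g : α → E → F} (hg : ∀ a, ContDiff ℝ ∞ (g a))
    (hmeas : ∀ n x, AEStronglyMeasurable (fun a => iteratedFDeriv ℝ n (g a) x) μ)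
    {b : ℕ → α → ℝ} (hb : ∀ n, Integrable (b n) μ)
    (hle : ∀ n a x, ‖iteratedFDeriv ℝ n (g a) x‖ ≤ b n a) (n : ℕ) (x : E) :
    iteratedFDeriv ℝ n (fun x => ∫ a, g a x ∂μ) x = ∫ a, iteratedFDeriv ℝ n (g a) x ∂μ := by
  have hint : ∀ n x, Integrable (fun a => iteratedFDeriv ℝ n (g a) x) μ := fun n x =>
    (hb n).mono' (hmeas n x) (Filter.Eventually.of_forall fun a => hle n a x)
  induction n generalizing x with
  | zero =>
    ext v
    rw [ContinuousMultilinearMap.integral_apply (hint 0 x)]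
    simp
  | succ n ih =>
    let Φ : (E [×(n + 1)]→L[ℝ] F) ≃ₗᵢ[ℝ] (E →L[ℝ] (E [×n]→L[ℝ] F)) :=
      continuousMultilinearCurryLeftEquiv ℝ (fun _ : Fin (n + 1) => E) F
    have hfd : ∀ a y, fderiv ℝ (iteratedFDeriv ℝ n (g a)) y = Φ (iteratedFDeriv ℝ (n + 1) (g a) y) :=
      fun a y => by
        rw [iteratedFDeriv_succ_eq_comp_left]
        exact (Φ.apply_symm_apply _).symm
    have hder : HasFDerivAt (fun x => ∫ a, iteratedFDeriv ℝ n (g a) x ∂μ)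
        (∫ a, fderiv ℝ (iteratedFDeriv ℝ n (g a)) x ∂μ) x := by
      refine hasFDerivAt_integral_of_dominated_of_fderiv_le (bound := b (n + 1))
        (F' := fun x a => fderiv ℝ (iteratedFDeriv ℝ n (g a)) x) Filter.univ_mem
        (Filter.Eventually.of_forall fun y => hmeas n y) (hint n x) ?_ ?_ (hb (n + 1)) ?_
      · simp only [hfd]
        exact Φ.continuous.comp_aestronglyMeasurable (hmeas (n + 1) x)
      · refine Filter.Eventually.of_forall fun a y _ => ?_
        rw [hfd]
        exact (Φ.norm_map _).le.trans (hle (n + 1) a y)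
      · refine Filter.Eventually.of_forall fun a y _ => ?_
        exact ((hg a).differentiable_iteratedFDeriv
          (by exact_mod_cast ENat.natCast_lt_top n) y).hasFDerivAt
    have hfun : iteratedFDeriv ℝ n (fun x => ∫ a, g a x ∂μ) =
        fun x => ∫ a, iteratedFDeriv ℝ n (g a) x ∂μ := funext ih
    rw [iteratedFDeriv_succ_eq_comp_left, Function.comp_apply, hfun, hder.fderiv]
    simp only [hfd]
    have h1 := LinearIsometryEquiv.integral_comp_comm' (μ := μ) (X := E [×(n + 1)]→L[ℝ] F)
      (Y := E →L[ℝ] (E [×n]→L[ℝ] F)) Φ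
      fun a => iteratedFDeriv ℝ (n + 1) (g a) x
    refine (congrArg Φ.symm h1).trans ?_
    exact Φ.symm_apply_apply _

/-- A linear functional bounded by the norm of the image under a linear map factors through a
continuous functional. -/
lemma exists_continuousLinearMap_comp_eq {W X : Type*} [AddCommGroup W] [Module ℂ W]
    [NormedAddCommGroup X] [NormedSpace ℂ X] (J : W →ₗ[ℂ] X) (s : W →ₗ[ℂ] ℂ) {C : ℝ}
    (h : ∀ w, ‖s w‖ ≤ C * ‖J w‖) : ∃ S : X →L[ℂ] ℂ, ∀ w, S (J w) = s w := by
  obtain ⟨g, hg⟩ := LinearMap.exists_rightInverse_of_surjective J.rangeRestrict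
    J.range_rangeRestrict
  have hgJ : ∀ y : LinearMap.range J, J (g y) = y := fun y => by
    have := LinearMap.congr_fun hg y
    exact congrArg Subtype.val this
  let f : LinearMap.range J →L[ℂ] ℂ := LinearMap.mkContinuous (s.comp g) C fun y => by
    have := h (g y)
    rwa [hgJ] at this
  obtain ⟨S, hS, -⟩ := exists_extension_norm_eq (LinearMap.range J) f
  refine ⟨S, fun w => ?_⟩
  have h1 : S (J w) = s (g (J.rangeRestrict w)) := hS (J.rangeRestrict w)
  -- The choice of preimage under J is harmless: the bound forces s to vanish on the kernel of J.
  have h2 := h (g (J.rangeRestrict w) - w)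
  rw [map_sub J, hgJ, LinearMap.codRestrict_apply, sub_self, norm_zero, mul_zero, map_sub] at h2
  rw [h1]
  exact sub_eq_zero.1 (norm_le_zero_iff.1 h2)

/-- The space of families of weighted derivatives, indexed by the order of the derivative, the
power of the weight and the point. -/
abbrev JetSpace (d : ℕ) : Type :=
  lp (fun i : ℕ × ℕ × RSp d => RSp d [×i.1]→L[ℝ] ℂ) ∞

/-- The weight that belongs to an index. -/
noncomputable def jetWeight (M : ℕ → ℝ) (m : ℝ) (i : ℕ × ℕ × RSp d) : ℝ :=
  m ^ (i.1 + i.2.1) * jb i.2.2 ^ i.2.1 / (M i.1 * M i.2.1)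

lemma jetWeight_pos (hM : IsWeightSequence M) {m : ℝ} (hm : 0 < m) (i : ℕ × ℕ × RSp d) :
    0 < jetWeight M m i := by
  have := hM.pos i.1
  have := hM.pos i.2.1
  have := jb_pos i.2.2
  unfold jetWeight
  positivity

lemma decayBound_iff (hM : IsWeightSequence M) {m A : ℝ} {φ : RSp d → ℂ} :
    DecayBound M m A φ ↔ ∀ i : ℕ × ℕ × RSp d,
      jetWeight M m i * ‖iteratedFDeriv ℝ i.1 φ i.2.2‖ ≤ A := by
  have h : ∀ i : ℕ × ℕ × RSp d, jetWeight M m i * ‖iteratedFDeriv ℝ i.1 φ i.2.2‖ ≤ A ↔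
      m ^ (i.1 + i.2.1) * jb i.2.2 ^ i.2.1 * ‖iteratedFDeriv ℝ i.1 φ i.2.2‖ ≤
        A * (M i.1 * M i.2.1) := fun i => by
    have := hM.pos i.1
    have := hM.pos i.2.1
    rw [jetWeight, div_mul_eq_mul_div, div_le_iff₀ (by positivity)]
  simp only [h]
  exact ⟨fun h i => h i.1 i.2.1 i.2.2, fun h n k x => h (n, k, x)⟩

/-- The test functions with finite `m`-norm. -/
def decaySubmodule (hM : IsWeightSequence M) (t : UltraType) {m : ℝ} (hm : 0 < m) :
    Submodule ℂ (RSp d → ℂ) where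
  carrier := {φ | φ ∈ spaceS d M t ∧ ∃ A, DecayBound M m A φ}
  add_mem' := by
    rintro φ ψ ⟨hφ, A, hA⟩ ⟨hψ, B, hB⟩
    exact ⟨hM.add_mem_spaceS hφ hψ, _,
      hA.add hm (hM.mem_spaceS_iff.1 hφ).1 (hM.mem_spaceS_iff.1 hψ).1 hB⟩
  zero_mem' := by
    have h : ∀ m, DecayBound M m 0 (0 : RSp d → ℂ) := fun m n k x => by
      have : iteratedFDeriv ℝ n (0 : RSp d → ℂ) x = 0 :=
        congrFun (iteratedFDeriv_fun_zero (𝕜 := ℝ) (n := n)) x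
      simp [this]
    exact ⟨hM.mem_spaceS_iff.2 ⟨contDiff_const, UltraType.forTest_of_forall fun m' _ => ⟨0, h m'⟩⟩,
      0, h m⟩
  smul_mem' := by
    rintro a φ ⟨hφ, A, hA⟩
    exact ⟨hM.smul_mem_spaceS a hφ, _, hA.smul (hM.mem_spaceS_iff.1 hφ).1 a⟩

/-- The embedding of the test functions with finite `m`-norm into the space of jets. -/
noncomputable def jet (hM : IsWeightSequence M) (t : UltraType) {m : ℝ} (hm : 0 < m) :
    decaySubmodule (d := d) hM t hm →ₗ[ℂ] JetSpace d where
  toFun φ := ⟨fun i => (jetWeight M m i : ℂ) • iteratedFDeriv ℝ i.1 φ.1 i.2.2, by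
    obtain ⟨A, hA⟩ := φ.2.2
    refine memℓp_infty ⟨A, ?_⟩
    rintro _ ⟨i, rfl⟩
    simp only
    rw [norm_smul, Complex.norm_real, Real.norm_of_nonneg (jetWeight_pos hM hm i).le]
    exact (decayBound_iff hM).1 hA i⟩
  map_add' φ ψ := by
    ext i : 2
    have := iteratedFDeriv_add_apply (𝕜 := ℝ) (i := i.1) (x := i.2.2)
      (((hM.mem_spaceS_iff.1 φ.2.1).1.of_le (by exact_mod_cast le_top)).contDiffAt)
      (((hM.mem_spaceS_iff.1 ψ.2.1).1.of_le (by exact_mod_cast le_top)).contDiffAt)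
    change (jetWeight M m i : ℂ) • iteratedFDeriv ℝ i.1 (φ.1 + ψ.1) i.2.2 =
      (jetWeight M m i : ℂ) • iteratedFDeriv ℝ i.1 φ.1 i.2.2 +
      (jetWeight M m i : ℂ) • iteratedFDeriv ℝ i.1 ψ.1 i.2.2
    rw [this, smul_add]
  map_smul' a φ := by
    ext i : 2
    have := iteratedFDeriv_const_smul_apply (𝕜 := ℝ) (i := i.1) (x := i.2.2) (a := a)
      (((hM.mem_spaceS_iff.1 φ.2.1).1.of_le (by exact_mod_cast le_top)).contDiffAt)
    change (jetWeight M m i : ℂ) • iteratedFDeriv ℝ i.1 (a • φ.1) i.2.2 =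
      a • ((jetWeight M m i : ℂ) • iteratedFDeriv ℝ i.1 φ.1 i.2.2)
    rw [this, smul_comm]

lemma jet_apply (hM : IsWeightSequence M) (t : UltraType) {m : ℝ} (hm : 0 < m)
    (φ : decaySubmodule (d := d) hM t hm) (i : ℕ × ℕ × RSp d) :
    jet hM t hm φ i = (jetWeight M m i : ℂ) • iteratedFDeriv ℝ i.1 φ.1 i.2.2 := rfl

lemma decayBound_norm_jet (hM : IsWeightSequence M) (t : UltraType) {m : ℝ} (hm : 0 < m)
    (φ : decaySubmodule (d := d) hM t hm) : DecayBound M m ‖jet hM t hm φ‖ φ.1 := by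
  rw [decayBound_iff hM]
  intro i
  have := lp.norm_apply_le_norm ENNReal.top_ne_zero (jet hM t hm φ) i
  rwa [jet_apply, norm_smul, Complex.norm_real,
    Real.norm_of_nonneg (jetWeight_pos hM hm i).le] at this

lemma norm_jet_le (hM : IsWeightSequence M) (t : UltraType) {m A : ℝ} (hm : 0 < m)
    (φ : decaySubmodule (d := d) hM t hm) (h : DecayBound M m A φ.1) :
    ‖jet hM t hm φ‖ ≤ A := by
  refine lp.norm_le_of_forall_le (h.nonneg hM) fun i => ?_
  rw [jet_apply, norm_smul, Complex.norm_real, Real.norm_of_nonneg (jetWeight_pos hM hm i).le]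
  exact (decayBound_iff hM).1 h i

/-- Continuity in one norm lets S be extended by Hahn–Banach to the Banach space of bounded jets.
There Bochner integrals exist, whatever the completeness of the test functions in that norm. -/
lemma IsTemperedUltradistribution.exists_jet (hM : IsWeightSequence M) {t : UltraType}
    {S : (RSp d → ℂ) → ℂ} (hS : IsTemperedUltradistribution d M t S) {m : ℝ} (hm : 0 < m)
    (hb : BoundedFor d M t S m) :
    ∃ S' : JetSpace d →L[ℂ] ℂ, ∀ φ, S' (jet hM t hm φ) = S φ.1 := by
  obtain ⟨C, -, h⟩ := hb
  let s : decaySubmodule (d := d) hM t hm →ₗ[ℂ] ℂ :=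
    { toFun := fun φ => S φ.1
      map_add' := fun φ ψ => hS.map_add _ φ.2.1 _ ψ.2.1
      map_smul' := fun a φ => hS.map_smul a _ φ.2.1 }
  exact exists_continuousLinearMap_comp_eq (jet hM t hm) s (C := C) fun φ =>
    h φ.1 φ.2.1 _ (decayBound_norm_jet hM t hm φ)

/-- A tempered ultradistribution can be interchanged with integrals of families of test
functions. -/
lemma IsTemperedUltradistribution.integral (hM : IsWeightSequence M) {t : UltraType}
    {S : (RSp d → ℂ) → ℂ} (hS : IsTemperedUltradistribution d M t S) {m : ℝ} (hm : 0 < m)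
    (hb : BoundedFor d M t S m) {g : RSp d → RSp d → ℂ} (hg : ∀ η, g η ∈ spaceS d M t)
    {a b : RSp d → ℝ} (ha : ∀ η, DecayBound M m (a η) (g η))
    (hcont : ∀ η, ∃ δ > 0, ∃ C, ∀ η', ‖η' - η‖ ≤ δ →
      DecayBound M m (C * ‖η' - η‖) (fun x => g η' x - g η x))
    {ψ : RSp d → ℂ} (hψ : Continuous ψ) (hbi : Integrable b) (hab : ∀ η, a η * ‖ψ η‖ ≤ b η)
    (hG : (fun x => ∫ η, g η x * ψ η) ∈ spaceS d M t) :
    Integrable (fun η => S (g η) * ψ η) ∧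
      S (fun x => ∫ η, g η x * ψ η) = ∫ η, S (g η) * ψ η := by
  obtain ⟨S', hS'⟩ := hS.exists_jet hM hm hb
  let gs : RSp d → decaySubmodule (d := d) hM t hm := fun η => ⟨g η, hg η, _, ha η⟩
  set j : RSp d → JetSpace d := fun η => jet hM t hm (gs η) with hj
  have hjc : Continuous j := by
    refine continuous_iff_continuousAt.2 fun η => ?_
    obtain ⟨δ, hδ, C, hC⟩ := hcont η
    rw [ContinuousAt, tendsto_iff_norm_sub_tendsto_zero]
    have hlim : Filter.Tendsto (fun η' => C * ‖η' - η‖) (nhds η) (nhds 0) := by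
      have : Continuous fun η' => C * ‖η' - η‖ := by fun_prop
      simpa using this.tendsto η
    refine squeeze_zero' (Filter.Eventually.of_forall fun _ => norm_nonneg _) ?_ hlim
    filter_upwards [Metric.closedBall_mem_nhds η hδ] with η' hη'
    rw [hj]
    simp only
    rw [← map_sub]
    exact norm_jet_le hM t hm _ (hC η' (mem_closedBall_iff_norm.1 hη'))
  have hji : Integrable fun η => ψ η • j η := by
    refine hbi.mono' (hψ.smul hjc).aestronglyMeasurable (Filter.Eventually.of_forall fun η => ?_)
    rw [norm_smul, mul_comm]
    refine le_trans ?_ (hab η)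
    gcongr
    exact norm_jet_le hM t hm _ (ha η)
  have hcomp : ∀ (i : ℕ × ℕ × RSp d) (η : RSp d),
      iteratedFDeriv ℝ i.1 (fun x => g η x * ψ η) i.2.2 =
        ((jetWeight M m i : ℂ))⁻¹ • (ψ η • j η) i := fun i η => by
    have h1 : (fun x => g η x * ψ η) = fun x => ψ η • g η x := by
      ext x; rw [smul_eq_mul, mul_comm]
    have h2 := iteratedFDeriv_const_smul_apply' (𝕜 := ℝ) (i := i.1) (x := i.2.2) (a := ψ η)
      (((hM.mem_spaceS_iff.1 (hg η)).1.of_le (by exact_mod_cast le_top)).contDiffAt)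
    have hw : (jetWeight M m i : ℂ) ≠ 0 := by exact_mod_cast (jetWeight_pos hM hm i).ne'
    have h3 : (ψ η • j η) i = ψ η • ((jetWeight M m i : ℂ) •
      iteratedFDeriv ℝ i.1 (g η) i.2.2) := rfl
    rw [h1, h2, h3, smul_comm (ψ η), smul_smul, inv_mul_cancel₀ hw, one_smul]
  have hle : ∀ (n : ℕ) (η x : RSp d), ‖iteratedFDeriv ℝ n (fun x => g η x * ψ η) x‖ ≤
      (jetWeight M m (n, 0, (0 : RSp d)))⁻¹ * b η := fun n η x => by
    have h0 : jetWeight M m (n, 0, x) = jetWeight M m (n, 0, (0 : RSp d)) := by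
      simp [jetWeight]
    have hp := jetWeight_pos hM hm (n, 0, x)
    have h1 := hcomp (n, 0, x) η
    simp only at h1
    rw [h1, norm_smul, norm_inv, Complex.norm_real, Real.norm_of_nonneg hp.le, h0]
    rw [h0] at hp
    gcongr
    refine (lp.norm_apply_le_norm ENNReal.top_ne_zero _ _).trans ?_
    rw [norm_smul, mul_comm]
    refine le_trans ?_ (hab η)
    gcongr
    exact norm_jet_le hM t hm _ (ha η)
  set Φ := ∫ η, ψ η • j η with hΦ
  have hΦi : ∀ i : ℕ × ℕ × RSp d, Φ i = ∫ η, (ψ η • j η) i := fun i =>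
    ((lp.evalCLM ℂ (fun i : ℕ × ℕ × RSp d => RSp d [×i.1]→L[ℝ] ℂ) ∞ i).integral_comp_comm
      hji).symm
  -- Differentiation under the integral identifies the jet of the pointwise integral with the
  -- coordinates of the Bochner integral Φ.
  have hder : ∀ i : ℕ × ℕ × RSp d, iteratedFDeriv ℝ i.1 (fun x => ∫ η, g η x * ψ η) i.2.2 =
      ((jetWeight M m i : ℂ))⁻¹ • Φ i := fun i => by
    rw [iteratedFDeriv_integral (b := fun n η => (jetWeight M m (n, 0, (0 : RSp d)))⁻¹ * b η)
      (fun η => (hM.mem_spaceS_iff.1 (hg η)).1.mul contDiff_const) ?_ (fun n => hbi.const_mul _)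
      hle, hΦi, ← integral_smul]
    · simp only [hcomp]
    · intro n x
      have : (fun η => iteratedFDeriv ℝ n (fun x => g η x * ψ η) x) =
          fun η => ((jetWeight M m (n, 0, x) : ℂ))⁻¹ • (ψ η • j η) (n, 0, x) :=
        funext fun η => hcomp (n, 0, x) η
      rw [this]
      have hc : Continuous fun η => (ψ η • j η) (n, 0, x) :=
        (lp.evalCLM ℂ (fun i : ℕ × ℕ × RSp d => RSp d [×i.1]→L[ℝ] ℂ) ∞ (n, 0, x)).continuous.comp
          (hψ.smul hjc)
      exact (Continuous.const_smul hc ((jetWeight M m (n, 0, x) : ℂ))⁻¹).aestronglyMeasurable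
  have hGb : DecayBound M m ‖Φ‖ (fun x => ∫ η, g η x * ψ η) := by
    rw [decayBound_iff hM]
    intro i
    have hp := jetWeight_pos hM hm i
    rw [hder, norm_smul, norm_inv, Complex.norm_real, Real.norm_of_nonneg hp.le,
      mul_inv_cancel_left₀ hp.ne']
    exact lp.norm_apply_le_norm ENNReal.top_ne_zero _ _
  have hjG : jet hM t hm ⟨_, hG, _, hGb⟩ = Φ := by
    ext i : 2
    have hw : (jetWeight M m i : ℂ) ≠ 0 := by exact_mod_cast (jetWeight_pos hM hm i).ne'
    rw [jet_apply, hder, smul_smul, mul_inv_cancel₀ hw, one_smul]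
  have hSj : ∀ η, S' (ψ η • j η) = S (g η) * ψ η := fun η => by
    rw [S'.map_smul, smul_eq_mul, mul_comm]
    exact congrArg (· * ψ η) (hS' (gs η))
  refine ⟨?_, ?_⟩
  · have := S'.integrable_comp hji
    simpa only [hSj] using this
  · have h1 : S' Φ = S fun x => ∫ η, g η x * ψ η :=
      (congrArg S' hjG).symm.trans (hS' ⟨_, hG, _, hGb⟩)
    have h2 := S'.integral_comp_comm hji
    simp only [hSj] at h2
    exact h1.symm.trans h2.symm

end

section

variable {d : ℕ} {M : ℕ → ℝ} {t : UltraType}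

lemma UltraType.forDual.and {P Q : ℝ → Prop} (hP : t.forDual P) (hQ : t.forDual Q)
    (hP' : ∀ m m' : ℝ, 0 < m → m ≤ m' → P m → P m')
    (hQ' : ∀ m m' : ℝ, 0 < m → m ≤ m' → Q m → Q m') : t.forDual fun m => P m ∧ Q m := by
  cases t with
  | roumieu => exact fun m hm => ⟨hP m hm, hQ m hm⟩
  | beurling =>
    obtain ⟨m, hm, hPm⟩ := hP
    obtain ⟨m', hm', hQm⟩ := hQ
    exact ⟨max m m', lt_max_of_lt_left hm, hP' _ _ hm (le_max_left _ _) hPm,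
      hQ' _ _ hm' (le_max_right _ _) hQm⟩

lemma UltraType.forDual.mono {P Q : ℝ → Prop} (hP : t.forDual P)
    (h : ∀ m : ℝ, 0 < m → P m → Q m) : t.forDual Q :=
  hP.scale one_pos (by simpa using h)

lemma UltraType.forDual_of_forall {P : ℝ → Prop} (h : ∀ m : ℝ, 0 < m → P m) :
    t.forDual P := by
  cases t with
  | roumieu => exact h
  | beurling => exact ⟨1, one_pos, h 1 one_pos⟩

lemma BoundedFor.mono {S : (RSp d → ℂ) → ℂ} {m m' : ℝ} (hm : 0 < m) (hmm : m ≤ m')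
    (h : BoundedFor d M t S m) : BoundedFor d M t S m' := by
  obtain ⟨C, hC, h⟩ := h
  exact ⟨C, hC, fun φ hφ A hA => h φ hφ A (hA.anti hm hmm)⟩

/-! ### Operations on tempered ultradistributions -/

lemma IsTemperedUltradistribution.sum (hM : IsWeightSequence M) {ι : Type*} (F : Finset ι)
    {S : ι → (RSp d → ℂ) → ℂ} (hS : ∀ b ∈ F, IsTemperedUltradistribution d M t (S b)) :
    IsTemperedUltradistribution d M t fun φ => ∑ b ∈ F, S b φ where
  map_add φ hφ ψ hψ := by
    rw [← Finset.sum_add_distrib]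
    exact Finset.sum_congr rfl fun b hb => (hS b hb).map_add φ hφ ψ hψ
  map_smul a φ hφ := by
    rw [Finset.mul_sum]
    exact Finset.sum_congr rfl fun b hb => (hS b hb).map_smul a φ hφ
  cont := by
    rw [hM.continuousOnS_iff]
    classical
    induction F using Finset.induction_on with
    | empty =>
      exact UltraType.forDual_of_forall fun m _ => ⟨0, le_rfl, fun φ _ A _ => by simp⟩
    | insert b F hb ih =>
      have h1 := hM.continuousOnS_iff.1 (hS b (Finset.mem_insert_self _ _)).cont
      have h2 := ih fun c hc => hS c (Finset.mem_insert_of_mem hc)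
      refine (h1.and h2 (fun _ _ h h' => BoundedFor.mono h h')
        (fun _ _ h h' => BoundedFor.mono h h')).mono ?_
      rintro m - ⟨⟨C, hC, h⟩, C', hC', h'⟩
      refine ⟨C + C', by positivity, fun φ hφ A hA => ?_⟩
      simp only [Finset.sum_insert hb, add_mul]
      exact (norm_add_le _ _).trans (add_le_add (h φ hφ A hA) (h' φ hφ A hA))

lemma IsTemperedUltradistribution.mul (hM : IsWeightSequence M) {S : (RSp d → ℂ) → ℂ}
    (hS : IsTemperedUltradistribution d M t S) {f : RSp d → ℂ} (hf : ContDiff ℝ ∞ f)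
    (hf' : ∀ m : ℝ, 0 < m → ∃ A, DerivBound M m⁻¹ A f) :
    IsTemperedUltradistribution d M t fun φ => S fun x => f x * φ x where
  map_add φ hφ ψ hψ := by
    rw [← hS.map_add _ (hM.mul_mem_spaceS hf hf' hφ) _ (hM.mul_mem_spaceS hf hf' hψ)]
    congr 1
    ext x
    simp [mul_add]
  map_smul a φ hφ := by
    rw [← hS.map_smul a _ (hM.mul_mem_spaceS hf hf' hφ)]
    congr 1
    ext x
    simp only [Pi.smul_apply, smul_eq_mul]
    ring
  cont := by
    rw [hM.continuousOnS_iff]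
    refine (hM.continuousOnS_iff.1 hS.cont).scale (c := 2) two_pos fun m hm h => ?_
    obtain ⟨C, hC, h⟩ := h
    obtain ⟨A, hA⟩ := hf' (2 * m) (by positivity)
    have hA0 : 0 ≤ A := by simpa [hM.zero] using (norm_nonneg _).trans (hA 0 0)
    refine ⟨C * A, by positivity, fun φ hφ B hB => ?_⟩
    have h1 := hA.mul_decayBound hM (by positivity) hf (hM.mem_spaceS_iff.1 hφ).1 hB
    rw [show 1 / 2 * (2 * m) = m by ring] at h1
    rw [mul_assoc]
    exact h _ (hM.mul_mem_spaceS hf hf' hφ) _ h1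

/-- Density of 𝒟^* in 𝒮^*: both values are limits of the same sequence of values at χ_N φ. -/
lemma IsTemperedExtension.eq_on (hM : IsWeightSequence M) {U S S' : (RSp d → ℂ) → ℂ}
    (hS : IsTemperedExtension d M t U S) (hS' : IsTemperedExtension d M t U S')
    {φ : RSp d → ℂ} (hφ : φ ∈ spaceS d M t) : S φ = S' φ := by
  obtain ⟨χ, hχ⟩ := hM.exists_cutoff_tendsto d
  obtain ⟨hmem, hlim⟩ := hχ t φ hφ
  refine tendsto_nhds_unique (hlim S hS.1) ((hlim S' hS'.1).congr fun N => ?_)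
  rw [hS.2 _ (hmem N).1, hS'.2 _ (hmem N).1]

lemma IsUltradistribution.map_sum (hM : IsWeightSequence M) {T : (RSp d → ℂ) → ℂ}
    (hT : IsUltradistribution d M t T) {ι : Type*} (F : Finset ι) {φ : ι → RSp d → ℂ}
    (hφ : ∀ b ∈ F, φ b ∈ spaceD d M t) :
    (∑ b ∈ F, φ b) ∈ spaceD d M t ∧ T (∑ b ∈ F, φ b) = ∑ b ∈ F, T (φ b) := by
  classical
  induction F using Finset.induction_on with
  | empty =>
    refine ⟨by simpa using hM.zero_mem_spaceD, ?_⟩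
    have := hT.map_smul 0 0 hM.zero_mem_spaceD
    simpa using this
  | insert b F hb ih =>
    obtain ⟨h1, h2⟩ := ih fun c hc => hφ c (Finset.mem_insert_of_mem hc)
    have h3 := hφ b (Finset.mem_insert_self _ _)
    rw [Finset.sum_insert hb, Finset.sum_insert hb]
    exact ⟨hM.add_mem_spaceD h3 h1, by rw [hT.map_add _ h3 _ h1, h2]⟩

/-! ### The action of tempered ultradistributions on quotients of exponentials -/

lemma expQuot_add (F : Finset (RSp d)) (ζ w z : CSp d) :
    expQuot F (ζ + w) z = expQuot F ζ z * Complex.exp (-cdot z w) := by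
  rw [expQuot, expQuot, cdot_add, neg_add, Complex.exp_add]
  ring

namespace IsExpFrame

variable {F : Finset (RSp d)} {ξ₀ : RSp d} {ε r : ℝ}

lemma contDiff_mul_analytic (hF : IsExpFrame F ξ₀ ε r) (ζ : CSp d) {G : CSp d → ℂ}
    (hG : ∀ z, AnalyticAt ℂ G z) :
    ContDiff ℝ ∞ fun x => expQuot F ζ (ofRealE d x) * G (ofRealE d x) :=
  contDiff_comp_ofRealE (G := fun z => expQuot F ζ z * G z) hF.r_pos
    fun z hz => (hF.analyticOnNhd_expQuot ζ z hz).mul (hG z)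

lemma mul_prod_mem_spaceS (hF : IsExpFrame F ξ₀ ε r) (hM : IsWeightSequence M) {ζ : CSp d}
    (hζ : reE ζ ∈ Metric.closedBall ξ₀ ε) {n : ℕ} (w : Fin n → CSp d) :
    (fun x => expQuot F ζ (ofRealE d x) * ∏ i, cdot (ofRealE d x) (w i)) ∈ spaceS d M t := by
  rw [hM.mem_spaceS_iff]
  refine ⟨hF.contDiff_mul_analytic ζ (G := fun z => ∏ i, cdot z (w i)) fun z =>
    Finset.analyticAt_fun_prod _ fun i _ => analyticAt_cdot _ z,
    UltraType.forTest_of_forall fun m hm => ?_⟩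
  obtain ⟨C, -, h, -⟩ := hF.exists_decayBound_series hM hm hζ
  exact ⟨_, h n w⟩

lemma mul_remainder_mem_spaceS (hF : IsExpFrame F ξ₀ ε r) (hM : IsWeightSequence M) {ζ : CSp d}
    (hζ : reE ζ ∈ Metric.closedBall ξ₀ ε) {w : CSp d} (hw : ‖w‖ ≤ ε / 2) (N : ℕ) :
    (fun x => expQuot F ζ (ofRealE d x) * (Complex.exp (-cdot (ofRealE d x) w) -
      ∑ n ∈ Finset.range N, (-cdot (ofRealE d x) w) ^ n / n.factorial)) ∈ spaceS d M t := by
  rw [hM.mem_spaceS_iff]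
  refine ⟨hF.contDiff_mul_analytic ζ (G := fun z => Complex.exp (-cdot z w) -
      ∑ n ∈ Finset.range N, (-cdot z w) ^ n / n.factorial) fun z =>
    (analyticAt_cdot _ z).neg.cexp.sub (Finset.analyticAt_fun_sum _ fun n _ =>
          ((analyticAt_cdot _ z).neg.pow n).div_const),
    UltraType.forTest_of_forall fun m hm => ?_⟩
  obtain ⟨C, -, -, h⟩ := hF.exists_decayBound_series hM hm hζ
  exact ⟨_, h w hw N⟩

/-- The multilinear map `(w₁, …, wₙ) ↦ S(θ_ζ ∏ (x · wᵢ))`. -/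
noncomputable def seriesTerm (hF : IsExpFrame F ξ₀ ε r) (hM : IsWeightSequence M)
    {S : (RSp d → ℂ) → ℂ} (hS : IsTemperedUltradistribution d M t S) {ζ : CSp d}
    (hζ : reE ζ ∈ Metric.closedBall ξ₀ ε) (n : ℕ) :
    MultilinearMap ℂ (fun _ : Fin n => CSp d) ℂ where
  toFun w := S fun x => expQuot F ζ (ofRealE d x) * ∏ i, cdot (ofRealE d x) (w i)
  map_update_add' w i u v := by
    rw [← hS.map_add _ (hF.mul_prod_mem_spaceS hM hζ _) _ (hF.mul_prod_mem_spaceS hM hζ _)]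
    congr 1
    ext x
    have := ((MultilinearMap.mkPiAlgebra ℂ (Fin n) ℂ).compLinearMap
      fun _ => cdotL (ofRealE d x)).map_update_add w i u v
    simp only [MultilinearMap.compLinearMap_apply, MultilinearMap.mkPiAlgebra_apply] at this
    exact (congrArg _ this).trans (mul_add _ _ _)
  map_update_smul' w i a v := by
    rw [smul_eq_mul, ← hS.map_smul a _ (hF.mul_prod_mem_spaceS hM hζ _)]
    congr 1
    ext x
    have := ((MultilinearMap.mkPiAlgebra ℂ (Fin n) ℂ).compLinearMap
      fun _ => cdotL (ofRealE d x)).map_update_smul w i a v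
    simp only [MultilinearMap.compLinearMap_apply, MultilinearMap.mkPiAlgebra_apply] at this
    exact (congrArg _ this).trans (mul_smul_comm _ _ _)

/-- θ_{ζ+w} = θ_ζ e^{-x·w} is expanded in powers of w, and S is applied term by term; the remainders
are geometrically small in a norm for which S is bounded. -/
lemma analyticAt_apply (hF : IsExpFrame F ξ₀ ε r) (hM : IsWeightSequence M)
    {S : (RSp d → ℂ) → ℂ} (hS : IsTemperedUltradistribution d M t S) {ζ : CSp d}
    (hζ : reE ζ ∈ Metric.closedBall ξ₀ ε) :
    AnalyticAt ℂ (fun ζ => S fun x => expQuot F ζ (ofRealE d x)) ζ := by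
  obtain ⟨m, hm, -, C₀, hC₀, hb⟩ := UltraType.exists_of_forTest_of_forDual (P := fun _ => True)
    (UltraType.forTest_of_forall fun _ _ => trivial) (hM.continuousOnS_iff.1 hS.cont)
  obtain ⟨C, hC, hterm, hrem⟩ := hF.exists_decayBound_series hM hm hζ
  have hε := hF.eps_pos
  have hδ0 : 0 < ε / 2 := by positivity
  have hbd : ∀ (n : ℕ) (w : Fin n → CSp d), ‖hF.seriesTerm hM hS hζ n w‖ ≤
      C₀ * C * (n.factorial / (ε / 2) ^ n) * ∏ i, ‖w i‖ := fun n w => by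
    refine (hb _ (hF.mul_prod_mem_spaceS hM hζ w) _ (hterm n w)).trans (le_of_eq (by ring))
  -- The n! in the bounds for θ_ζ ∏ (x·w_i) cancels the 1/n! of the exponential series, leaving
  -- geometric coefficients and a radius of at least ε/2.
  let p : FormalMultilinearSeries ℂ (CSp d) ℂ := fun n =>
    ((-1 : ℂ) ^ n / n.factorial) • (hF.seriesTerm hM hS hζ n).mkContinuous _ (hbd n)
  have hpn : ∀ n, ‖p n‖ ≤ C₀ * C / (ε / 2) ^ n := fun n => by
    have h1 := MultilinearMap.mkContinuous_norm_le (hF.seriesTerm hM hS hζ n)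
      (C := C₀ * C * (n.factorial / (ε / 2) ^ n)) (by positivity) (hbd n)
    have h2 : ‖p n‖ = ‖(-1 : ℂ) ^ n / n.factorial‖ *
        ‖(hF.seriesTerm hM hS hζ n).mkContinuous _ (hbd n)‖ := norm_smul _ _
    rw [h2, norm_div, norm_pow, norm_neg, norm_one, one_pow, Complex.norm_natCast]
    have hn : (0 : ℝ) < n.factorial := by exact_mod_cast n.factorial_pos
    calc _ ≤ 1 / (n.factorial : ℝ) * (C₀ * C * (n.factorial / (ε / 2) ^ n)) := by gcongr
      _ = _ := by field_simp
  have hpa : ∀ (n : ℕ) (y : CSp d), p n (fun _ => y) =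
      ((-1 : ℂ) ^ n / n.factorial) * S fun x => expQuot F ζ (ofRealE d x) *
        ∏ _i : Fin n, cdot (ofRealE d x) y := fun n y => rfl
  have hsum : ∀ y : CSp d, ‖y‖ ≤ ε / 2 → ∀ N,
      (S fun x => expQuot F (ζ + y) (ofRealE d x)) - ∑ n ∈ Finset.range N, p n (fun _ => y) =
      S fun x => expQuot F ζ (ofRealE d x) * (Complex.exp (-cdot (ofRealE d x) y) -
        ∑ n ∈ Finset.range N, (-cdot (ofRealE d x) y) ^ n / n.factorial) := fun y hy N => by
    induction N with
    | zero => simp [expQuot_add]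
    | succ N ih =>
      rw [Finset.sum_range_succ, ← sub_sub, ih, hpa, sub_eq_iff_eq_add,
        ← hS.map_smul _ _ (hF.mul_prod_mem_spaceS hM hζ _),
        ← hS.map_add _ (hF.mul_remainder_mem_spaceS hM hζ hy _) _
          (hM.smul_mem_spaceS _ (hF.mul_prod_mem_spaceS hM hζ _))]
      congr 1
      ext x
      simp only [Pi.add_apply, Pi.smul_apply, smul_eq_mul, Finset.prod_const, Finset.card_univ,
        Fintype.card_fin]
      rw [Finset.sum_range_succ, neg_pow (cdot (ofRealE d x) y) N]
      ring
  refine HasFPowerSeriesAt.analyticAt (p := p) ⟨ENNReal.ofReal (ε / 2), ?_, by simpa using hε, ?_⟩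
  · rw [ENNReal.ofReal]
    refine p.le_radius_of_bound (C₀ * C) fun n => ?_
    rw [Real.coe_toNNReal _ hδ0.le]
    have := hpn n
    rwa [le_div_iff₀ (by positivity)] at this
  · intro y hy
    have hy' : ‖y‖ < ε / 2 := by
      rw [Metric.eball_ofReal] at hy
      simpa using hy
    have hρ : ‖y‖ / (ε / 2) < 1 := (div_lt_one hδ0).2 hy'
    have hρ0 : 0 ≤ ‖y‖ / (ε / 2) := by positivity
    have hsm : Summable fun n => p n (fun _ => y) := by
      refine Summable.of_norm_bounded ((summable_geometric_of_lt_one hρ0 hρ).mul_left (C₀ * C))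
        fun n => ?_
      refine ((p n).le_opNorm _).trans ?_
      rw [Finset.prod_const, Finset.card_univ, Fintype.card_fin, div_pow, mul_div_assoc',
        mul_div_right_comm]
      gcongr
      exact hpn n
    rw [hsm.hasSum_iff_tendsto_nat, tendsto_iff_norm_sub_tendsto_zero]
    have hlim : Filter.Tendsto (fun N => C₀ * (C * (‖y‖ / (ε / 2)) ^ N)) Filter.atTop (nhds 0) := by
      simpa using ((tendsto_pow_atTop_nhds_zero_of_lt_one hρ0 hρ).const_mul C).const_mul C₀
    refine squeeze_zero (fun _ => norm_nonneg _) (fun N => ?_) hlim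
    rw [norm_sub_rev, hsum y hy'.le N]
    exact hb _ (hF.mul_remainder_mem_spaceS hM hζ hy'.le N) _ (hrem y hy'.le N)

lemma exists_derivBound (hF : IsExpFrame F ξ₀ ε r) (hM : IsWeightSequence M) {ζ : CSp d}
    (hζ : reE ζ ∈ Metric.closedBall ξ₀ ε) {m : ℝ} (hm : 0 < m) :
    ∃ A, DerivBound M m⁻¹ A fun x => expQuot F ζ (ofRealE d x) := by
  obtain ⟨C, -, h⟩ := hF.exists_decayBound hM hm
  exact ⟨_, (h ζ hζ).derivBound hM hm⟩

/-- Moving ζ in an imaginary direction multiplies θ on real points by the Fourier kernel, as the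
denominator does not involve ζ. -/
lemma expQuot_tubePoint (ξ η x : RSp d) :
    expQuot F (tubePoint ξ η) (ofRealE d x) =
      expQuot F (ofRealE d ξ) (ofRealE d x) *
        Complex.exp (-(Complex.I * (inner ℝ x η : ℝ))) := by
  have h : cdot (ofRealE d x) (Complex.I • ofRealE d η) = Complex.I * (inner ℝ x η : ℝ) := by
    rw [← cdot_ofRealE]
    exact (cdotL (ofRealE d x)).map_smul _ _
  rw [tubePoint_eq, expQuot_add, h]

/-- The Fourier transform of `θ_ξ S`. -/
lemma integral_apply (hF : IsExpFrame F ξ₀ ε r) (hM : IsWeightSequence M)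
    {S : (RSp d → ℂ) → ℂ} (hS : IsTemperedUltradistribution d M t S) {ξ : RSp d}
    (hξ : ξ ∈ Metric.closedBall ξ₀ ε) {ψ : RSp d → ℂ} (hψ : ψ ∈ spaceS d M t) :
    Integrable (fun η => (S fun x => expQuot F (tubePoint ξ η) (ofRealE d x)) * ψ η) ∧
      (S fun x => expQuot F (ofRealE d ξ) (ofRealE d x) * fourierT ψ x) =
        ∫ η, (S fun x => expQuot F (tubePoint ξ η) (ofRealE d x)) * ψ η := by
  obtain ⟨c, hc, hcm⟩ := DecayBound.exists_exp_assocFun_mul_le hM d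
  have hψ' := hM.mem_spaceS_iff.1 hψ
  -- Chosen so that m = m'/q satisfies 2e·m = c·m': the growth e^{M(2e m|η|)} of the m-norm of
  -- θ_{ξ+iη} is then integrable against ψ, whose decay has parameter m'.
  set q : ℝ := 2 * Real.exp 1 / c with hq
  have hq0 : 0 < q := by positivity
  obtain ⟨m', hm', ⟨A, hA⟩, hb⟩ := UltraType.exists_of_forTest_of_forDual hψ'.2
    ((hM.continuousOnS_iff.1 hS.cont).scale (Q := fun m' => BoundedFor d M t S (m' / q)) hq0
      fun m hm h => by rwa [mul_div_cancel_left₀ _ hq0.ne'])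
  set m : ℝ := m' / q with hm_def
  have hm : 0 < m := by positivity
  obtain ⟨K, hK⟩ := hcm m' A ψ hm' hA
  have hkm : 2 * Real.exp 1 * m ≤ c * m' := by
    rw [hm_def, hq]; field_simp; exact le_rfl
  obtain ⟨C, hC, hθ⟩ := hF.exists_decayBound hM hm
  have hre : ∀ η, reE (tubePoint ξ η) ∈ Metric.closedBall ξ₀ ε := fun η => by simpa using hξ
  have hfun : (fun x => expQuot F (ofRealE d ξ) (ofRealE d x) * fourierT ψ x) =
      fun x => ∫ η, expQuot F (tubePoint ξ η) (ofRealE d x) * ψ η := by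
    ext x
    rw [fourierT, ← integral_const_mul]
    refine integral_congr_ae (Filter.Eventually.of_forall fun η => ?_)
    simp only [expQuot_tubePoint, mul_assoc]
  have hξ' : reE (ofRealE d ξ) ∈ Metric.closedBall ξ₀ ε := by simpa using hξ
  have hG := hM.mul_mem_spaceS (contDiff_comp_ofRealE hF.r_pos
    (hF.analyticOnNhd_expQuot (ofRealE d ξ))) (fun m hm => hF.exists_derivBound hM hξ' hm)
    (hM.fourierT_mem_spaceS hψ)
  rw [hfun] at hG ⊢
  have hε := hF.eps_pos
  refine hS.integral hM hm hb (g := fun η x => expQuot F (tubePoint ξ η) (ofRealE d x))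
    (fun η => hF.mem_spaceS hM t (hre η))
    (a := fun η => C * Real.exp (assocFun M (2 * Real.exp 1 * m * ‖η‖)))
    (b := fun η => C * (K * (jb η ^ (d + 1))⁻¹)) (fun η => by simpa using hθ _ (hre η))
    (fun η => ?_) hψ'.1.continuous (((integrable_inv_jb_pow d).const_mul K).const_mul C)
    (fun η => ?_) hG
  -- Lipschitz continuity in η is the remainder estimate with N = 1.
  · obtain ⟨C', -, -, hrem⟩ := hF.exists_decayBound_series hM hm (hre η)
    refine ⟨ε / 2, by positivity, C' / (ε / 2), fun η' hη' => ?_⟩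
    have hw : ‖Complex.I • ofRealE d (η' - η)‖ = ‖η' - η‖ := by
      rw [norm_smul, Complex.norm_I, one_mul, LinearIsometry.norm_map]
    have h1 := hrem (Complex.I • ofRealE d (η' - η)) (hw.le.trans hη') 1
    rw [hw, pow_one] at h1
    have h2 : tubePoint ξ η' = tubePoint ξ η + Complex.I • ofRealE d (η' - η) := by
      rw [tubePoint_eq, tubePoint_eq, map_sub, smul_sub]; abel
    simp only [h2, expQuot_add]
    convert h1 using 1
    · ring
    · ext x
      simp [mul_sub]
  · rw [mul_assoc]
    exact mul_le_mul_of_nonneg_left (hK _ (by positivity) hkm η) hC.le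

end IsExpFrame

/-! ### Growth estimates -/

lemma growthBound_iff {K : Set (RSp d)} {f : CSp d → ℂ} : GrowthBound M K f t ↔
    t.forDual fun k => ∃ C : ℝ, 0 < C ∧ ∀ ξ ∈ K, ∀ η : RSp d,
      ‖f (tubePoint ξ η)‖ ≤ C * Real.exp (assocFun M (k * ‖η‖)) := by
  cases t <;> rfl

lemma exists_growth_mono (hM : IsWeightSequence M) {K : Set (RSp d)} {f : CSp d → ℂ} {k k' : ℝ}
    (hk : 0 < k) (hkk : k ≤ k')
    (h : ∃ C : ℝ, 0 < C ∧ ∀ ξ ∈ K, ∀ η : RSp d,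
      ‖f (tubePoint ξ η)‖ ≤ C * Real.exp (assocFun M (k * ‖η‖))) :
    ∃ C : ℝ, 0 < C ∧ ∀ ξ ∈ K, ∀ η : RSp d,
      ‖f (tubePoint ξ η)‖ ≤ C * Real.exp (assocFun M (k' * ‖η‖)) := by
  obtain ⟨C, hC, h⟩ := h
  refine ⟨C, hC, fun ξ hξ η => (h ξ hξ η).trans ?_⟩
  gcongr
  exact hM.assocFun_mono (by positivity) (by gcongr)

lemma GrowthBound.union (hM : IsWeightSequence M) {K K' : Set (RSp d)} {f : CSp d → ℂ}
    (h : GrowthBound M K f t) (h' : GrowthBound M K' f t) : GrowthBound M (K ∪ K') f t := by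
  rw [growthBound_iff] at *
  refine (h.and h' (fun _ _ => exists_growth_mono hM) (fun _ _ => exists_growth_mono hM)).mono ?_
  rintro k - ⟨⟨C, hC, h⟩, C', hC', h'⟩
  refine ⟨max C C', lt_max_of_lt_left hC, fun ξ hξ η => ?_⟩
  rcases hξ with hξ | hξ
  · exact (h ξ hξ η).trans (by gcongr; exact le_max_left _ _)
  · exact (h' ξ hξ η).trans (by gcongr; exact le_max_right _ _)

lemma GrowthBound.sum (hM : IsWeightSequence M) {ι : Type*} (F : Finset ι) {K : Set (RSp d)}
    {f : ι → CSp d → ℂ} (h : ∀ b ∈ F, GrowthBound M K (f b) t) :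
    GrowthBound M K (fun ζ => ∑ b ∈ F, f b ζ) t := by
  classical
  induction F using Finset.induction_on with
  | empty =>
    rw [growthBound_iff]
    refine UltraType.forDual_of_forall fun k _ => ⟨1, one_pos, fun ξ _ η => ?_⟩
    rw [Finset.sum_empty, norm_zero]
    positivity
  | insert b F hb ih =>
    have h1 := h b (Finset.mem_insert_self _ _)
    have h2 := ih fun c hc => h c (Finset.mem_insert_of_mem hc)
    rw [growthBound_iff] at *
    refine (h1.and h2 (fun _ _ => exists_growth_mono hM)
      (fun _ _ => exists_growth_mono (f := fun ζ => ∑ b ∈ F, f b ζ) hM)).mono ?_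
    rintro k - ⟨⟨C, hC, h⟩, C', hC', h'⟩
    refine ⟨C + C', by positivity, fun ξ hξ η => ?_⟩
    rw [Finset.sum_insert hb, add_mul]
    exact (norm_add_le _ _).trans (add_le_add (h ξ hξ η) (h' ξ hξ η))

lemma GrowthBound.mono {K K' : Set (RSp d)} {f : CSp d → ℂ} (h : GrowthBound M K' f t)
    (hK : K ⊆ K') : GrowthBound M K f t := by
  rw [growthBound_iff] at *
  exact h.mono fun k _ ⟨C, hC, h⟩ => ⟨C, hC, fun ξ hξ => h ξ (hK hξ)⟩

lemma GrowthBound.congr {K : Set (RSp d)} {f g : CSp d → ℂ} (h : GrowthBound M K f t)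
    (hfg : ∀ ζ ∈ tube K, g ζ = f ζ) : GrowthBound M K g t := by
  rw [growthBound_iff] at *
  refine h.mono fun k _ ⟨C, hC, h⟩ => ⟨C, hC, fun ξ hξ η => ?_⟩
  rw [hfg _ ⟨ξ, hξ, η, rfl⟩]
  exact h ξ hξ η

/-- The growth parameter is k = 2e·m with m a parameter of continuity of S: some m in the Beurling
case and every m in the Roumieu case, which is the dichotomy in the theorem. -/
lemma IsExpFrame.growthBound {F : Finset (RSp d)} {ξ₀ : RSp d} {ε r : ℝ}
    (hF : IsExpFrame F ξ₀ ε r) (hM : IsWeightSequence M) {S : (RSp d → ℂ) → ℂ}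
    (hS : IsTemperedUltradistribution d M t S) :
    GrowthBound M (Metric.closedBall ξ₀ ε)
      (fun ζ => S fun x => expQuot F ζ (ofRealE d x)) t := by
  rw [growthBound_iff]
  refine (hM.continuousOnS_iff.1 hS.cont).scale (c := 2 * Real.exp 1) (by positivity) ?_
  rintro m hm ⟨C, hC, hb⟩
  obtain ⟨C', hC', h⟩ := hF.exists_decayBound hM hm
  refine ⟨(C + 1) * C', by positivity, fun ξ hξ η => ?_⟩
  have hre : reE (tubePoint ξ η) ∈ Metric.closedBall ξ₀ ε := by simpa using hξ
  have h1 := hb _ (hF.mem_spaceS hM t hre) _ (h _ hre)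
  rw [imE_tubePoint] at h1
  refine h1.trans ?_
  rw [mul_assoc (C + 1)]
  exact mul_le_mul_of_nonneg_right (by linarith) (by positivity)

/-! ### The Fourier–Laplace transform -/

lemma analyticOnNhd_exp_neg_cdot (ζ : CSp d) (r : ℝ) :
    AnalyticOnNhd ℂ (fun z => Complex.exp (-cdot z ζ)) (strip d r) := fun z _ =>
  (analyticAt_cdot ζ z).neg.cexp

lemma exp_neg_cdot_ofRealE (x ξ : RSp d) :
    Complex.exp (-cdot (ofRealE d x) (ofRealE d ξ)) = (Real.exp (-inner ℝ x ξ) : ℂ) := by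
  rw [cdot_ofRealE]
  push_cast
  rfl

/-- The product θ_ζ φ, rather than φ, is required to lie in 𝒟^*. This covers both φ ∈ 𝒟^*, used for
the temperedness of e^{-xξ}T, and φ a cut-off function, used for f. -/
lemma IsExpFrame.apply_exp_mul {F : Finset (RSp d)} {ξ₀ : RSp d} {ε r : ℝ}
    (hF : IsExpFrame F ξ₀ ε r) (hM : IsWeightSequence M) {T : (RSp d → ℂ) → ℂ}
    (hT : IsUltradistribution d M t T) {S : RSp d → (RSp d → ℂ) → ℂ}
    (hS : ∀ b ∈ F, IsTemperedExtension d M t (expMul b T) (S b)) {ζ : CSp d} {φ : RSp d → ℂ}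
    (hφ : (fun x => expQuot F ζ (ofRealE d x) * φ x) ∈ spaceD d M t) :
    T (fun x => Complex.exp (-cdot (ofRealE d x) ζ) * φ x) =
      ∑ b ∈ F, S b fun x => expQuot F ζ (ofRealE d x) * φ x := by
  have h1 : (fun x => Complex.exp (-cdot (ofRealE d x) ζ) * φ x) = ∑ b ∈ F, fun x =>
      (Real.exp (-inner ℝ x b) : ℂ) * (expQuot F ζ (ofRealE d x) * φ x) := by
    ext x
    rw [Finset.sum_apply, ← hF.sum_exp_mul_expQuot, Finset.sum_mul]
    exact Finset.sum_congr rfl fun b _ => mul_assoc _ _ _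
  rw [h1, (hT.map_sum hM F fun b _ => ?_).2]
  · exact Finset.sum_congr rfl fun b hb => ((hS b hb).2 _ hφ).symm
  · simp only [← exp_neg_cdot_ofRealE]
    exact hM.analytic_mul_mem_spaceD one_pos (analyticOnNhd_exp_neg_cdot (ofRealE d b) 1) hφ

/-- θ_ξ is a multiplier of 𝒮^*, so ∑ θ_ξ S_b is tempered; on 𝒟^* it agrees with e^{-xξ}T by the
partition identity. -/
lemma IsExpFrame.isTemperedExtension {F : Finset (RSp d)} {ξ₀ : RSp d} {ε r : ℝ}
    (hF : IsExpFrame F ξ₀ ε r) (hM : IsWeightSequence M) {T : (RSp d → ℂ) → ℂ}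
    (hT : IsUltradistribution d M t T) {S : RSp d → (RSp d → ℂ) → ℂ}
    (hS : ∀ b ∈ F, IsTemperedExtension d M t (expMul b T) (S b)) {ξ : RSp d}
    (hξ : ξ ∈ Metric.closedBall ξ₀ ε) :
    IsTemperedExtension d M t (expMul ξ T)
      fun φ => ∑ b ∈ F, S b fun x => expQuot F (ofRealE d ξ) (ofRealE d x) * φ x := by
  have hξ' : reE (ofRealE d ξ) ∈ Metric.closedBall ξ₀ ε := by simpa using hξ
  have han := hF.analyticOnNhd_expQuot (ofRealE d ξ)
  refine ⟨IsTemperedUltradistribution.sum hM F fun b hb => (hS b hb).1.mul hM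
    (contDiff_comp_ofRealE hF.r_pos han) fun m hm => hF.exists_derivBound hM hξ' hm,
    fun φ hφ => ?_⟩
  refine (hF.apply_exp_mul hM hT hS (hM.analytic_mul_mem_spaceD hF.r_pos han hφ)).symm.trans ?_
  simp only [exp_neg_cdot_ofRealE]
  rfl

end

/-! ### Proof of the theorem -/

theorem theorem1 (d : ℕ) (M : ℕ → ℝ) (hM : IsWeightSequence M) (t : UltraType)
    (B : Set (RSp d)) (hBopen : IsOpen B) (hBconn : IsPreconnected B)
    (T : (RSp d → ℂ) → ℂ) (hT : IsUltradistribution d M t T)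
    (hTemp : ∀ ξ ∈ B, ∃ S, IsTemperedExtension d M t (expMul ξ T) S) :
    ∃ f : CSp d → ℂ,
      AnalyticOnNhd ℂ f (tube (convexHull ℝ B)) ∧
      (∀ ξ ∈ convexHull ℝ B,
        (∃ S, IsTemperedExtension d M t (expMul ξ T) S) ∧
        ∀ S, IsTemperedExtension d M t (expMul ξ T) S →
          FourierIsFunction d M t S (fun η => f (tubePoint ξ η))) ∧
      ∀ K : Set (RSp d), IsCompact K → K ⊆ convexHull ℝ B → GrowthBound M K f t := by
  obtain ⟨χ, hχ⟩ := hM.exists_cutoff_tendsto d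
  choose! S hS using hTemp
  -- A definition without reference to F: each frame then yields a formula for the same function,
  -- and no compatibility between frames has to be checked.
  let f : CSp d → ℂ := fun ζ => Filter.limUnder Filter.atTop fun N =>
    T fun x => Complex.exp (-cdot (ofRealE d x) ζ) * χ N x
  have hf : ∀ {F : Finset (RSp d)} {ξ₀ : RSp d} {ε r : ℝ}, ↑F ⊆ B → IsExpFrame F ξ₀ ε r →
      ∀ ζ ∈ tube (Metric.closedBall ξ₀ ε),
        f ζ = ∑ b ∈ F, S b fun x => expQuot F ζ (ofRealE d x) := by
    intro F ξ₀ ε r hFB hF ζ hζ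
    obtain ⟨hmem, hlim⟩ := hχ t _ (hF.mem_spaceS hM t (mem_tube.1 hζ))
    refine Filter.Tendsto.limUnder_eq ?_
    refine (tendsto_finsetSum F fun b hb => hlim (S b) (hS b (hFB hb)).1).congr fun N => ?_
    have h1 := (hmem N).1
    simp only [mul_comm (χ N _)] at h1 ⊢
    exact (hF.apply_exp_mul hM hT (fun b hb => hS b (hFB hb)) h1).symm
  refine ⟨f, fun ζ hζ => ?_, fun ξ hξ => ?_, fun K hK hKB => ?_⟩
  · obtain ⟨F, ε, r, hFB, hF⟩ := exists_isExpFrame hBopen (mem_tube.1 hζ)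
    have hball : reE ζ ∈ Metric.ball (reE ζ) ε := Metric.mem_ball_self hF.eps_pos
    have han : AnalyticAt ℂ (fun ζ => ∑ b ∈ F, S b fun x => expQuot F ζ (ofRealE d x)) ζ :=
      Finset.analyticAt_fun_sum _ fun b hb =>
        hF.analyticAt_apply hM (hS b (hFB hb)).1 (Metric.ball_subset_closedBall hball)
    refine han.congr ?_
    filter_upwards [(Metric.isOpen_ball.preimage continuous_reE).mem_nhds hball] with ζ' hζ'
    exact (hf hFB hF ζ' (mem_tube.2 (Metric.ball_subset_closedBall hζ'))).symm
  · obtain ⟨F, ε, r, hFB, hF⟩ := exists_isExpFrame hBopen hξ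
    have hξε : ξ ∈ Metric.closedBall ξ ε := Metric.mem_closedBall_self hF.eps_pos.le
    have hext := hF.isTemperedExtension hM hT (fun b hb => hS b (hFB hb)) hξε
    refine ⟨⟨_, hext⟩, fun S' hS' ψ hψ => ?_⟩
    have hFψ := hM.fourierT_mem_spaceS hψ
    have hfη : ∀ η, f (tubePoint ξ η) * ψ η =
        ∑ b ∈ F, (S b fun x => expQuot F (tubePoint ξ η) (ofRealE d x)) * ψ η := fun η => by
      rw [hf hFB hF _ ⟨ξ, hξε, η, rfl⟩, Finset.sum_mul]
    have hint : ∀ b ∈ F, _ := fun b hb => hF.integral_apply hM (hS b (hFB hb)).1 hξε hψ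
    refine ⟨hFψ, ?_, ?_⟩
    · simp only [hfη]
      exact integrable_finsetSum _ fun b hb => (hint b hb).1
    -- An arbitrary extension agrees on 𝒮^* with the one built from the frame, for which the
    -- integral formula is known.
    · rw [hS'.eq_on hM hext hFψ]
      simp only [hfη]
      rw [integral_finsetSum _ fun b hb => (hint b hb).1]
      exact Finset.sum_congr rfl fun b hb => (hint b hb).2
  -- The estimate holds on a ball about each point and passes to subsets and finite unions, hence to
  -- compact sets.
  · refine hK.induction_on (p := fun K => GrowthBound M K f t) ?_
      (fun _ _ hst h => h.mono hst) (fun _ _ h h' => h.union hM h') fun ξ hξ => ?_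
    · rw [growthBound_iff]
      exact UltraType.forDual_of_forall fun k _ => ⟨1, one_pos, fun ξ hξ => hξ.elim⟩
    · obtain ⟨F, ε, r, hFB, hF⟩ := exists_isExpFrame hBopen (hKB hξ)
      refine ⟨Metric.closedBall ξ ε,
        mem_nhdsWithin_of_mem_nhds (Metric.closedBall_mem_nhds ξ hF.eps_pos), ?_⟩
      exact (GrowthBound.sum hM F fun b hb => hF.growthBound hM (hS b (hFB hb)).1).congr
        (hf hFB hF)
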